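/- Let $\mathbb T^2=\mathbb R^2/\mathbb Z^2$, $\tfrac12<\alpha<1$, $T>0$, $s>0$ and $0<\tfrac1q<\alpha-\tfrac12$. Write $\hat u(k)$ for the Fourier coefficients of $u$ with respect to $e^{2\pi i x\cdot k}$, $\|u\|_{H^r}^2=\sum_{k\in\mathbb Z^2}(1+|k|^2)^r|\hat u(k)|^2$, and $(-\Delta)^\alpha u=\sum_k|2\pi k|^{2\alpha}\hat u(k)e^{2\pi ix\cdot k}$. Let $K:\mathbb T^2\to\mathbb R$ satisfy $K\in L^1(\mathbb T^2)\cap C^\infty(\mathbb T^2\setminus\{0\})$ and $c|k|^{-1}\le\hat K(k)\le C|k|^{-1}$ for all $k\ne0$ with constants $c,C>0$ (in particular $\hat K(k)$ is real for $k\neq 0$), put $\mathcal K\theta=K*\theta$ and $\mathcal R\theta=(-\partial_2\mathcal K\theta,\partial_1\mathcal K\theta)$, and suppose that $\mathcal R$ is bounded on $L^p(\mathbb T^2)$ for every $p\in(1,\infty)$. For a real-valued $f\in C_c^\infty(\mathbb T^2\times(0,T))$ let $\theta_f$ denote the (real-valued, weak) solution of $$\partial_t\theta+\mathcal R\theta\cdot\nabla\theta+(-\Delta)^\alpha\theta=f\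 \text{ in }\mathbb T^2\times(0,T),\qquad\theta(0)=0,$$ in the class $L^\infty(0,T;L^q(\mathbb T^2))\cap L^\infty(0,T;H^s(\mathbb T^2))\cap L^2(0,T;H^{s+\alpha}(\mathbb T^2))$. Let $f_1,f_2\in C_c^\infty(\mathbb T^2\times(0,T))$ be real-valued. For $j=1,2$ let $w_j\in L^2(0,T;H^\alpha(\mathbb T^2))\cap C([0,T];L^2(\mathbb T^2))$ be the weak solution of $\partial_tw_j+(-\Delta)^\alpha w_j=f_j$, $w_j(0)=0$, and let $v\in L^2(0,T;H^\alpha(\mathbb T^2))\cap C([0,T];L^2(\mathbb T^2))$ be the weak solution of $$\partial_tv+\mathcal Rw_1\cdot\nabla w_2+\mathcal Rw_2\cdot\nabla w_1+(-\Delta)^\alpha v=0,\qquad v(0)=0.$$ Then $$\frac{\theta_{\epsilon(f_1+f_2)}-\theta_{\epsilon f_1}-\theta_{\epsilon f_2}}{\epsilon^2}\to v\quad\text{in }L^2(0,T;H^\alpha(\mathbb T^2))\cap C([0,T];L^2(\mathbb T^2))\ \text{ as }\epsilon\to0$$ (the difference quotients being identified with their representatives that are continuous in time with values in $L^2(\mathbb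 T^2)$). -/

import Mathlib

open MeasureTheory Set
open scoped ContDiff ENNReal

noncomputable section

namespace ActiveScalar

/-- The flat torus `ℝ² / ℤ²`. -/
abbrev Torus : Type := UnitAddTorus (Fin 2)

/-- The normalised Haar (Lebesgue) measure on the torus; it is the measure used by
`UnitAddTorus.mFourierCoeff`. -/
abbrev torusMeasure : Measure Torus := Measure.pi fun _ => AddCircle.haarAddCircle

/-- Real-valued `L²` functions on the torus. -/
abbrev L2 : Type := Lp ℝ 2 torusMeasure

/-- The projection `ℝ² → ℝ² / ℤ²`. -/
def proj (y : Fin 2 → ℝ) : Torus := fun i => (y i : UnitAddCircle)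

/-- The Euclidean length `|k|` of a frequency `k ∈ ℤ²`. -/
def freqNorm (k : Fin 2 → ℤ) : ℝ := Real.sqrt (∑ i, (k i : ℝ) ^ 2)

/-- The Fourier coefficient `∫ g(x) e^{-2πi k·x} dx` of a real function. -/
def fourierCoeffR (g : Torus → ℝ) (k : Fin 2 → ℤ) : ℂ :=
  UnitAddTorus.mFourierCoeff (fun x => (g x : ℂ)) k

/-- The (inhomogeneous) Sobolev norm `‖g‖_{H^r} = (∑ₖ (1 + |k|²)^r |ĝ(k)|²)^{1/2}`,
with value `∞` when `g ∉ H^r`. -/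
def sobolevNorm (r : ℝ) (g : Torus → ℝ) : ℝ≥0∞ :=
  (∑' k : Fin 2 → ℤ,
    ENNReal.ofReal ((1 + freqNorm k ^ 2) ^ r) * ‖fourierCoeffR g k‖ₑ ^ 2) ^ (1 / 2 : ℝ)

/-- The norm of `L²(0, T; H^r)`, with value `∞` when it is not finite. -/
def normL2H (T r : ℝ) (h : ℝ → L2) : ℝ≥0∞ :=
  (∫⁻ t in Ioo 0 T, sobolevNorm r (h t) ^ 2) ^ (1 / 2 : ℝ)

/-- `h ∈ L²(0, T; H^r)`, for `r ≥ 0`. -/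
def MemL2H (T r : ℝ) (h : ℝ → L2) : Prop :=
  AEStronglyMeasurable h (volume.restrict (Ioo 0 T)) ∧ normL2H T r h < ⊤

/-- `h ∈ L^∞(0, T; H^r)`, for `r ≥ 0`. -/
def MemLinftyH (T r : ℝ) (h : ℝ → L2) : Prop :=
  AEStronglyMeasurable h (volume.restrict (Ioo 0 T)) ∧
    essSup (fun t => sobolevNorm r (h t)) (volume.restrict (Ioo 0 T)) < ⊤

/-- `h ∈ L^∞(0, T; L^q)`, for `2 ≤ q < ∞`. -/
def MemLinftyLq (T q : ℝ) (h : ℝ → L2) : Prop :=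
  AEStronglyMeasurable h (volume.restrict (Ioo 0 T)) ∧
    essSup (fun t => eLpNorm (h t) (ENNReal.ofReal q) torusMeasure)
      (volume.restrict (Ioo 0 T)) < ⊤

/-- The partial derivative `∂ᵢ φ` of a function on the torus (`i = 0, 1`). -/
def partialX (i : Fin 2) (φ : Torus → ℂ) (x : Torus) : ℂ :=
  deriv (fun r : ℝ => φ (x + Pi.single i (r : UnitAddCircle))) 0

/-- The fractional Laplacian `(-Δ)^r φ = ∑ₖ |2πk|^{2r} φ̂(k) e^{2πi k·x}` of a smooth function. -/
def fracLaplacian (r : ℝ) (φ : Torus → ℂ) (x : Torus) : ℂ :=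
  ∑' k : Fin 2 → ℤ, (((2 * Real.pi * freqNorm k) ^ (2 * r) : ℝ) : ℂ) *
    UnitAddTorus.mFourierCoeff φ k * UnitAddTorus.mFourier k x

/-- `φ ∈ C^∞(𝕋²)`. -/
def IsSmooth (φ : Torus → ℂ) : Prop :=
  ContDiff ℝ ∞ fun y : Fin 2 → ℝ => φ (proj y)

/-- `φ` is smooth as a function of time and space. -/
def IsSmoothST {E : Type} [NormedAddCommGroup E] [NormedSpace ℝ E] (φ : ℝ × Torus → E) : Prop :=
  ContDiff ℝ ∞ fun p : ℝ × (Fin 2 → ℝ) => φ (p.1, proj p.2)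

/-- Real sources `f ∈ C_c^∞(𝕋² × (0, T))`. -/
def IsSource (T : ℝ) (f : ℝ × Torus → ℝ) : Prop :=
  IsSmoothST f ∧ HasCompactSupport f ∧ tsupport f ⊆ Ioo 0 T ×ˢ univ

/-- Test functions for initial value problems on `[0, T)`: smooth, with compact support in
`𝕋² × (-∞, T)`. They need not vanish at time `0`. -/
def IsTest (T : ℝ) (φ : ℝ × Torus → ℂ) : Prop :=
  IsSmoothST φ ∧ HasCompactSupport φ ∧ tsupport φ ⊆ Iio T ×ˢ univ

/-- `𝒦 θ = K * θ`. -/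
def conv (K θ : Torus → ℝ) (x : Torus) : ℝ := ∫ y, K (x - y) * θ y ∂torusMeasure

/-- `u = ℛ θ = (-∂₂ 𝒦θ, ∂₁ 𝒦θ)`, the derivatives being taken in the sense of distributions
(the two coordinates are indexed by `0` and `1` here). -/
def IsDrift (K θ : Torus → ℝ) (u : Fin 2 → Torus → ℝ) : Prop :=
  (∀ i, Integrable (u i) torusMeasure) ∧
  ∀ φ : Torus → ℂ, IsSmooth φ →
    (∫ x, (u 0 x : ℂ) * φ x ∂torusMeasure =
      ∫ x, (conv K θ x : ℂ) * partialX 1 φ x ∂torusMeasure) ∧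
    (∫ x, (u 1 x : ℂ) * φ x ∂torusMeasure =
      - ∫ x, (conv K θ x : ℂ) * partialX 0 φ x ∂torusMeasure)

/-- The standing assumptions on the kernel `K` of `𝒦`. -/
structure IsAdmissibleKernel (K : Torus → ℝ) : Prop where
  /-- `K ∈ L¹(𝕋²)` -/
  integrable : Integrable K torusMeasure
  /-- `K ∈ C^∞(𝕋² ∖ {0})` -/
  smooth : ContDiffOn ℝ ∞ (fun y : Fin 2 → ℝ => K (proj y)) {y | proj y ≠ 0}
  /-- `c |k|⁻¹ ≤ K̂(k) ≤ C |k|⁻¹` for `k ≠ 0` (in particular `K̂(k)` is real) -/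
  fourier : ∃ c C : ℝ, 0 < c ∧ 0 < C ∧ ∀ k : Fin 2 → ℤ, k ≠ 0 →
    (fourierCoeffR K k).im = 0 ∧
    c * (freqNorm k)⁻¹ ≤ (fourierCoeffR K k).re ∧
    (fourierCoeffR K k).re ≤ C * (freqNorm k)⁻¹
  /-- `ℛ : L^p → L^p` is bounded for `1 < p < ∞` -/
  bounded : ∀ p : ℝ, 1 < p → ∃ C : ℝ, ∀ θ : Torus → ℝ,
    MemLp θ (ENNReal.ofReal p) torusMeasure →
    ∃ u : Fin 2 → Torus → ℝ, IsDrift K θ u ∧ ∀ i,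
      MemLp (u i) (ENNReal.ofReal p) torusMeasure ∧
      eLpNorm (u i) (ENNReal.ofReal p) torusMeasure ≤
        ENNReal.ofReal C * eLpNorm θ (ENNReal.ofReal p) torusMeasure

/-- The weak form of the initial value problem
`∂ₜ θ + div F + (-Δ)^α θ = f` in `𝕋² × (0, T)`, `θ(0) = 0`. -/
def WeakIVP (α T : ℝ) (θ : ℝ → L2) (F : ℝ → Fin 2 → Torus → ℝ) (f : ℝ × Torus → ℝ) : Prop :=
  ∀ φ : ℝ × Torus → ℂ, IsTest T φ →
    (∫ t in Ioo 0 T, ∫ x,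
        (-(θ t x : ℂ) * deriv (fun τ => φ (τ, x)) t
          - ∑ i, (F t i x : ℂ) * partialX i (fun y => φ (t, y)) x
          + (θ t x : ℂ) * fracLaplacian α (fun y => φ (t, y)) x) ∂torusMeasure) =
      ∫ t in Ioo 0 T, ∫ x, (f (t, x) : ℂ) * φ (t, x) ∂torusMeasure

/-- `u(t) = ℛ θ(t)` for almost every `t ∈ (0, T)`. -/
def IsDriftAE (T : ℝ) (K : Torus → ℝ) (θ : ℝ → L2) (u : ℝ → Fin 2 → L2) : Prop :=
  ∀ᵐ t ∂(volume.restrict (Ioo 0 T)), IsDrift K (θ t) (fun i => u t i)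

/-- `θ` is a solution of `∂ₜ θ + ℛθ · ∇θ + (-Δ)^α θ = f`, `θ(0) = 0`, in the class
`L^∞(0,T;L^q) ∩ L^∞(0,T;H^s) ∩ L²(0,T;H^{s+α})`. As `ℛθ` is divergence free, `ℛθ · ∇θ` is
`div (θ ℛθ)`. -/
structure IsASESolution (α s q T : ℝ) (K : Torus → ℝ) (f : ℝ × Torus → ℝ) (θ : ℝ → L2) :
    Prop where
  memLinftyLq : MemLinftyLq T q θ
  memLinftyH : MemLinftyH T s θ
  memL2H : MemL2H T (s + α) θ
  equation : ∃ u : ℝ → Fin 2 → L2, IsDriftAE T K θ u ∧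
    WeakIVP α T θ (fun t i x => u t i x * θ t x) f

/-- `w` is the solution in `L²(0,T;H^α) ∩ C([0,T];L²)` of `∂ₜ w + (-Δ)^α w = f`, `w(0) = 0`. -/
structure IsHeatSolution (α T : ℝ) (f : ℝ × Torus → ℝ) (w : ℝ → L2) : Prop where
  memL2H : MemL2H T α w
  continuousOn : ContinuousOn w (Icc 0 T)
  initial : w 0 = 0
  equation : WeakIVP α T w (fun _ _ _ => 0) f

/-- `v` is the solution in `L²(0,T;H^α) ∩ C([0,T];L²)` of
`∂ₜ v + ℛw₁ · ∇w₂ + ℛw₂ · ∇w₁ + (-Δ)^α v = 0`, `v(0) = 0`. -/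
structure IsSecondLinearization (α T : ℝ) (K : Torus → ℝ) (w₁ w₂ v : ℝ → L2) : Prop where
  memL2H : MemL2H T α v
  continuousOn : ContinuousOn v (Icc 0 T)
  initial : v 0 = 0
  equation : ∃ u₁ u₂ : ℝ → Fin 2 → L2, IsDriftAE T K w₁ u₁ ∧ IsDriftAE T K w₂ u₂ ∧
    WeakIVP α T v (fun t i x => u₁ t i x * w₂ t x + u₂ t i x * w₁ t x) (fun _ => 0)

end ActiveScalar

end

open ActiveScalar

/-! Write `θ = ε w + ε² z + ρ`, where `w` solves the heat equation with source `f` and `z` solves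
the heat equation with source `-ℛw·∇w`. Since `ℛθ·∇θ` is quadratic, the remainder satisfies `∂ₜρ +
ℛθ·∇ρ + B + (-Δ)^α ρ = 0`. Here `B`, called `forcing`, is linear in `ρ` with a factor `ε`, plus a
term of size `ε³`, and it differentiates only the smooth profiles `w` and `z`. Pairing with `ρ`
removes the transport term, because `ℛθ` is divergence free, so `ρ = O(ε³)` in the energy space
(`exists_remainder`). Applying this to `f₁ + f₂`, `f₁` and `f₂`, the first order terms cancel in
`θ₁₂ - θ₁ - θ₂`. What is left is `ε²(z - z₁ - z₂) + O(ε³)`, and by polarisation `z - z₁ - z₂` solves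
the linear equation of `v` (`IsSecondLinearization.ae_eq`).

The delicate point is the pairing itself. The function `ρ` lies only in `L²H^α` with `α < 1`, and
the drift only in `L^∞L^q`, so `∫ (ℛθ·∇ρ) ρ` has no direct meaning. The pairing is regularised by a
Gaussian multiplier of width `δ`, and the regularised form equals `-(1/2δ) ∫ y · ∫ u |ρ(x) - ρ(x -
δy)|² dx dγ(y)`, with `γ` the Gaussian measure (`re_transportForm_eq`, for trigonometric
polynomials). Splitting `u` at a height `δ^(-μ)` and using `H^β ⊂ L⁴` for `β > 1/2` bounds this by a
positive power of `δ` exactly when `1/q < α - 1/2` (`exists_transportForm_le`, carried to `L²` data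
by `exists_regularised_adv_le`).

Everything is done on Fourier coefficients. The weak formulation becomes one scalar integral
equation per mode (`WeakIVP.mode`). An abstract energy identity for countably many modes
(`energy_identity`) combines these equations with the commutator bound. It also shows that the norm
of the remainder is continuous in time, and this, together with continuity of each mode, gives the
representative in `C([0,T];L²)`. For small `ε` the quadratic part of the energy balance is absorbed,
with no Gronwall argument (`energy_absorption`). -/

noncomputable section

namespace ActiveScalar

section

open UnitAddTorus ComplexConjugate

/-! ### Fourier coefficients of real functions on the torus -/

instance : IsProbabilityMeasure torusMeasure := by
  unfold torusMeasure; infer_instance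

lemma norm_mFourier_apply (k : Fin 2 → ℤ) (x : Torus) : ‖mFourier k x‖ = 1 := by
  simp [mFourier, Circle.norm_coe]

lemma integrable_mul_mFourier {g : Torus → ℝ} (hg : Integrable g torusMeasure)
    (k : Fin 2 → ℤ) : Integrable (fun x => mFourier k x * (g x : ℂ)) torusMeasure := by
  refine (hg.ofReal (𝕜 := ℂ)).bdd_mul (c := 1) ?_ ?_
  · exact (mFourier k).continuous.aestronglyMeasurable
  · exact Filter.Eventually.of_forall fun x => (norm_mFourier_apply k x).le

lemma fourierCoeffR_eq (g : Torus → ℝ) (k : Fin 2 → ℤ) :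
    fourierCoeffR g k = ∫ x, mFourier (-k) x * (g x : ℂ) ∂torusMeasure := rfl

lemma fourierCoeffR_congr_ae {g h : Torus → ℝ} (e : g =ᵐ[torusMeasure] h) (k : Fin 2 → ℤ) :
    fourierCoeffR g k = fourierCoeffR h k := by
  rw [fourierCoeffR_eq, fourierCoeffR_eq]
  refine integral_congr_ae ?_
  filter_upwards [e] with x hx
  rw [hx]

lemma fourierCoeffR_add {g h : Torus → ℝ} (hg : Integrable g torusMeasure)
    (hh : Integrable h torusMeasure) (k : Fin 2 → ℤ) :
    fourierCoeffR (fun x => g x + h x) k = fourierCoeffR g k + fourierCoeffR h k := by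
  simp only [fourierCoeffR_eq]
  rw [← integral_add (integrable_mul_mFourier hg _) (integrable_mul_mFourier hh _)]
  refine integral_congr_ae (Filter.Eventually.of_forall fun x => ?_)
  push_cast; ring

lemma fourierCoeffR_const_mul (c : ℝ) (g : Torus → ℝ) (k : Fin 2 → ℤ) :
    fourierCoeffR (fun x => c * g x) k = c * fourierCoeffR g k := by
  simp only [fourierCoeffR_eq]
  rw [← integral_const_mul]
  refine integral_congr_ae (Filter.Eventually.of_forall fun x => ?_)
  push_cast; ring

lemma fourierCoeffR_sub {g h : Torus → ℝ} (hg : Integrable g torusMeasure)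
    (hh : Integrable h torusMeasure) (k : Fin 2 → ℤ) :
    fourierCoeffR (fun x => g x - h x) k = fourierCoeffR g k - fourierCoeffR h k := by
  have := fourierCoeffR_add hg (hh.const_mul (-1)) k
  rw [fourierCoeffR_const_mul] at this
  rw [show (fun x => g x - h x) = fun x => g x + -1 * h x by ext; ring, this]
  push_cast; ring

lemma fourierCoeffR_neg (g : Torus → ℝ) (k : Fin 2 → ℤ) :
    fourierCoeffR g (-k) = conj (fourierCoeffR g k) := by
  rw [fourierCoeffR_eq, fourierCoeffR_eq, ← integral_conj]
  refine integral_congr_ae (Filter.Eventually.of_forall fun x => ?_)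
  simp [← mFourier_neg]

lemma norm_fourierCoeffR_le (g : Torus → ℝ) (k : Fin 2 → ℤ) :
    ‖fourierCoeffR g k‖ ≤ ∫ x, |g x| ∂torusMeasure := by
  rw [fourierCoeffR_eq]
  refine (norm_integral_le_integral_norm _).trans_eq ?_
  refine integral_congr_ae (Filter.Eventually.of_forall fun x => ?_)
  simp [norm_mFourier_apply]

lemma L2.integrable (g : L2) : Integrable g torusMeasure :=
  (Lp.memLp g).integrable one_le_two

lemma L2.integrable_mul (g h : L2) : Integrable (fun x => g x * h x) torusMeasure :=
  (Lp.memLp g).integrable_mul (Lp.memLp h)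

lemma L2.integral_sq (g : L2) : ∫ x, g x ^ 2 ∂torusMeasure = ‖g‖ ^ 2 := by
  rw [← real_inner_self_eq_norm_sq, MeasureTheory.L2.inner_def]
  simp [sq]

lemma L2.integral_mul_abs_le (g h : L2) : ∫ x, |g x * h x| ∂torusMeasure ≤ ‖g‖ * ‖h‖ := by
  have h1 : inner ℝ |g| |h| = ∫ x, |g x * h x| ∂torusMeasure := by
    rw [MeasureTheory.L2.inner_def]
    refine integral_congr_ae ?_
    filter_upwards [Lp.coeFn_abs g, Lp.coeFn_abs h] with x h1 h2
    simp only [h1, h2, RCLike.inner_apply, conj_trivial, abs_mul]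
    ring
  rw [← h1]
  refine (real_inner_le_norm _ _).trans_eq ?_
  rw [norm_abs_eq_norm, norm_abs_eq_norm]

@[simp] lemma L2.fourierCoeffR_add (g h : L2) (k : Fin 2 → ℤ) :
    fourierCoeffR (g + h : L2) k = fourierCoeffR g k + fourierCoeffR h k := by
  rw [fourierCoeffR_congr_ae (Lp.coeFn_add g h)]
  exact ActiveScalar.fourierCoeffR_add g.integrable h.integrable k

@[simp] lemma L2.fourierCoeffR_sub (g h : L2) (k : Fin 2 → ℤ) :
    fourierCoeffR (g - h : L2) k = fourierCoeffR g k - fourierCoeffR h k := by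
  rw [fourierCoeffR_congr_ae (Lp.coeFn_sub g h)]
  exact ActiveScalar.fourierCoeffR_sub g.integrable h.integrable k

@[simp] lemma L2.fourierCoeffR_smul (c : ℝ) (g : L2) (k : Fin 2 → ℤ) :
    fourierCoeffR (c • g : L2) k = c * fourierCoeffR g k := by
  rw [fourierCoeffR_congr_ae (Lp.coeFn_smul c g)]
  exact ActiveScalar.fourierCoeffR_const_mul c g k

lemma L2.norm_fourierCoeffR_mul_le (g h : L2) (k : Fin 2 → ℤ) :
    ‖fourierCoeffR (fun x => g x * h x) k‖ ≤ ‖g‖ * ‖h‖ :=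
  (norm_fourierCoeffR_le _ k).trans (L2.integral_mul_abs_le g h)

/-- The Fourier basis of the complex `L²` space of the torus. -/
def fourierBasis : HilbertBasis (Fin 2 → ℤ) ℂ (Lp ℂ 2 torusMeasure) := mFourierBasis

lemma fourierBasis_repr (f : Lp ℂ 2 torusMeasure) (k : Fin 2 → ℤ) :
    fourierBasis.repr f k = mFourierCoeff f k := mFourierBasis_repr f k

lemma hasSum_conj_mul (f g : Lp ℂ 2 torusMeasure) :
    HasSum (fun k => conj (mFourierCoeff f k) * mFourierCoeff g k)
      (∫ x, conj (f x) * g x ∂torusMeasure) := hasSum_prod_mFourierCoeff f g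

lemma mFourierCoeff_congr {f g : Torus → ℂ} (e : f =ᵐ[torusMeasure] g) (k : Fin 2 → ℤ) :
    mFourierCoeff f k = mFourierCoeff g k := by
  change ∫ x, mFourier (-k) x • f x ∂torusMeasure = ∫ x, mFourier (-k) x • g x ∂torusMeasure
  refine integral_congr_ae ?_
  filter_upwards [e] with x hx
  rw [hx]

lemma hasSum_conj_mul' {f g : Torus → ℂ} (hf : MemLp f 2 torusMeasure)
    (hg : MemLp g 2 torusMeasure) :
    HasSum (fun k => conj (mFourierCoeff f k) * mFourierCoeff g k)
      (∫ x, conj (f x) * g x ∂torusMeasure) := by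
  have := hasSum_conj_mul (hf.toLp f) (hg.toLp g)
  simp only [mFourierCoeff_congr hf.coeFn_toLp, mFourierCoeff_congr hg.coeFn_toLp] at this
  convert this using 1
  refine integral_congr_ae ?_
  filter_upwards [hf.coeFn_toLp, hg.coeFn_toLp] with x h1 h2
  rw [h1, h2]

lemma hasSum_sq_fourierCoeffR {g : Torus → ℝ} (hg : MemLp g 2 torusMeasure) :
    HasSum (fun k => ‖fourierCoeffR g k‖ ^ 2) (∫ x, g x ^ 2 ∂torusMeasure) := by
  have := hasSum_conj_mul' hg.ofReal hg.ofReal (f := fun x => (g x : ℂ)) (g := fun x => (g x : ℂ))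
  have h2 := RCLike.hasSum_re ℂ this
  convert h2 using 1
  · ext k
    change _ = Complex.re _
    rw [mul_comm, Complex.mul_conj, Complex.ofReal_re, Complex.normSq_eq_norm_sq]
    rfl
  · change _ = Complex.re _
    have : ∀ x, conj (g x : ℂ) * (g x : ℂ) = ((g x ^ 2 : ℝ) : ℂ) := by
      intro x; simp [sq]
    simp only [this]
    exact (congrArg Complex.re (integral_ofReal (𝕜 := ℂ) (f := fun x => g x ^ 2))).symm

lemma L2.hasSum_sq (g : L2) : HasSum (fun k => ‖fourierCoeffR g k‖ ^ 2) (‖g‖ ^ 2) := by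
  rw [← L2.integral_sq]
  exact hasSum_sq_fourierCoeffR (Lp.memLp g)

lemma L2.norm_fourierCoeffR_le (g : L2) (k : Fin 2 → ℤ) : ‖fourierCoeffR g k‖ ≤ ‖g‖ := by
  have := le_hasSum (L2.hasSum_sq g) k (fun _ _ => sq_nonneg _)
  exact le_of_sq_le_sq this (norm_nonneg _)

lemma L2.ext_fourier {g h : L2} (e : ∀ k, fourierCoeffR g k = fourierCoeffR h k) : g = h := by
  have h1 := L2.hasSum_sq (g - h)
  simp only [L2.fourierCoeffR_sub, e, sub_self, norm_zero] at h1
  have h2 : ‖g - h‖ ^ 2 = 0 := h1.unique (by simp)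
  exact sub_eq_zero.1 (norm_eq_zero.1 (by simpa using h2))

/-- The Fourier coefficients of a product are the convolution of the Fourier coefficients. -/
lemma hasSum_fourierCoeffR_mul {u a : Torus → ℝ} (hu : MemLp u 2 torusMeasure)
    (ha : MemLp a 2 torusMeasure) (k : Fin 2 → ℤ) :
    HasSum (fun l => fourierCoeffR u (k - l) * fourierCoeffR a l)
      (fourierCoeffR (fun x => u x * a x) k) := by
  -- Parseval is applied to the pair `e_k u` and `a`: as `u` is real, the conjugate of the `l`-th
  -- coefficient of `e_k u` is `û(k - l)`.
  have h1 : MemLp (fun x => mFourier k x * (u x : ℂ)) 2 torusMeasure := by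
    refine MemLp.of_le hu ?_ ?_
    · exact (mFourier k).continuous.aestronglyMeasurable.mul
        (hu.ofReal (K := ℂ)).aestronglyMeasurable
    · exact Filter.Eventually.of_forall fun x => by simp [norm_mFourier_apply]
  have := hasSum_conj_mul' h1 ha.ofReal (g := fun x => (a x : ℂ))
  convert this using 1
  · ext l
    congr 1
    change _ = conj (∫ x, mFourier (-l) x • _ ∂torusMeasure)
    rw [fourierCoeffR_eq, ← integral_conj]
    refine integral_congr_ae (Filter.Eventually.of_forall fun x => ?_)
    simp only [smul_eq_mul, map_mul, ← mFourier_neg, neg_neg, Complex.conj_ofReal]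
    rw [← mul_assoc, ← mFourier_add]
    congr 3; abel
  · rw [fourierCoeffR_eq]
    refine integral_congr_ae (Filter.Eventually.of_forall fun x => ?_)
    simp only [map_mul, ← mFourier_neg, Complex.conj_ofReal]
    push_cast; ring

/-- Riesz–Fischer: a conjugation symmetric square summable family is the family of Fourier
coefficients of a real `L²` function. -/
lemma exists_L2_of_summable {c : (Fin 2 → ℤ) → ℂ} (hc : Summable fun k => ‖c k‖ ^ 2)
    (hsymm : ∀ k, c (-k) = conj (c k)) : ∃ g : L2, ∀ k, fourierCoeffR g k = c k := by
  have hmem : Memℓp c 2 := memℓp_gen (by simpa using hc)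
  obtain ⟨f, hf⟩ := fourierBasis.repr.surjective (⟨c, hmem⟩ : lp (fun _ => ℂ) 2)
  have hfc : ∀ k, mFourierCoeff f k = c k := by
    intro k
    rw [← fourierBasis_repr, hf]
  have hfi : Integrable f torusMeasure := (Lp.memLp f).integrable one_le_two
  refine ⟨(Lp.memLp f).re.toLp _, fun k => ?_⟩
  rw [fourierCoeffR_congr_ae (MemLp.coeFn_toLp _)]
  have hint : ∀ k : Fin 2 → ℤ, Integrable (fun x => mFourier k x * f x) torusMeasure := by
    intro k
    refine hfi.bdd_mul (c := 1) (mFourier k).continuous.aestronglyMeasurable ?_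
    exact Filter.Eventually.of_forall fun x => (norm_mFourier_apply k x).le
  have hint' : ∀ k : Fin 2 → ℤ, Integrable (fun x => mFourier k x * conj (f x)) torusMeasure := by
    intro k
    refine Integrable.bdd_mul (c := 1) ?_ (mFourier k).continuous.aestronglyMeasurable ?_
    · exact (LinearIsometryEquiv.integrable_comp_iff Complex.conjLIE).2 hfi
    exact Filter.Eventually.of_forall fun x => (norm_mFourier_apply k x).le
  have h1 : ∫ x, mFourier (-k) x * f x ∂torusMeasure = c k := hfc k
  -- The symmetry of `c` means that `conj f` has the same coefficients as `f`; hence so does their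
  -- average, the real part.
  have h2 : ∫ x, mFourier (-k) x * conj (f x) ∂torusMeasure = c k := by
    have : ∫ x, mFourier (-(-k)) x * f x ∂torusMeasure = c (-k) := hfc (-k)
    rw [hsymm] at this
    rw [← Complex.conj_conj (c k), ← this, ← integral_conj]
    refine integral_congr_ae (Filter.Eventually.of_forall fun x => ?_)
    simp [← mFourier_neg]
  rw [fourierCoeffR_eq]
  have h3 : ∀ x, mFourier (-k) x * ((RCLike.re (f x) : ℝ) : ℂ)
      = (1 / 2 : ℂ) * (mFourier (-k) x * f x + mFourier (-k) x * conj (f x)) := by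
    intro x
    change mFourier (-k) x * ((f x).re : ℂ) = _
    rw [Complex.re_eq_add_conj]; ring
  simp only [h3]
  rw [integral_const_mul, integral_add (hint _) (hint' _), h1, h2]
  ring

end

section

open UnitAddTorus ComplexConjugate

/-! ### Characters and the drift operator on the Fourier side -/

lemma mFourier_apply_add (n : Fin 2 → ℤ) (x y : Torus) :
    mFourier n (x + y) = mFourier n x * mFourier n y := by
  simp [mFourier, Fin.prod_univ_two, fourier_apply, smul_add, AddCircle.toCircle_add]
  ring

lemma mFourier_apply_sub (n : Fin 2 → ℤ) (x y : Torus) :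
    mFourier n (x - y) = mFourier n x * conj (mFourier n y) := by
  have h := mFourier_apply_add n (x - y) y
  rw [sub_add_cancel] at h
  rw [h, mul_assoc, Complex.mul_conj, Complex.normSq_eq_norm_sq, norm_mFourier_apply]
  simp

lemma mFourier_proj (n : Fin 2 → ℤ) (y : Fin 2 → ℝ) :
    mFourier n (proj y) = Complex.exp ((2 * Real.pi * (n 0 * y 0 + n 1 * y 1) : ℝ) * Complex.I) := by
  simp only [mFourier, proj, Fin.prod_univ_two, ContinuousMap.coe_mk, fourier_coe_apply]
  rw [← Complex.exp_add]
  congr 1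
  push_cast
  ring

lemma mFourier_single_coe (n : Fin 2 → ℤ) (i : Fin 2) (r : ℝ) :
    mFourier n (Pi.single i (r : UnitAddCircle)) =
      Complex.exp ((2 * Real.pi * n i : ℝ) * Complex.I * r) := by
  have : (Pi.single i (r : UnitAddCircle) : Torus) = proj (Pi.single i r) := by
    ext j
    by_cases h : j = i
    · subst h; simp [proj]
    · simp [proj, h]
  rw [this, mFourier_proj]
  congr 1
  fin_cases i <;> simp <;> ring

lemma isSmooth_mFourier (n : Fin 2 → ℤ) : IsSmooth (mFourier n) := by
  unfold IsSmooth
  simp only [mFourier_proj]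
  refine ContDiff.cexp (ContDiff.mul (Complex.ofRealCLM.contDiff.comp ?_) contDiff_const)
  change ContDiff ℝ ∞ fun y : Fin 2 → ℝ => (2 * Real.pi) * ((n 0 : ℝ) * y 0 + (n 1 : ℝ) * y 1)
  fun_prop

lemma partialX_mFourier (i : Fin 2) (n : Fin 2 → ℤ) (x : Torus) :
    partialX i (mFourier n) x = 2 * Real.pi * Complex.I * n i * mFourier n x := by
  unfold partialX
  simp only [mFourier_apply_add, mFourier_single_coe]
  have h : HasDerivAt (fun r : ℝ => Complex.exp ((2 * Real.pi * n i : ℝ) * Complex.I * r))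
      ((2 * Real.pi * n i : ℝ) * Complex.I) 0 := by
    have h1 : HasDerivAt (fun r : ℝ => ((2 * Real.pi * n i : ℝ) * Complex.I) * (r : ℂ))
      (((2 * Real.pi * n i : ℝ) * Complex.I) * 1) 0 :=
      (Complex.ofRealCLM.hasDerivAt (x := (0 : ℝ))).const_mul _
    simpa using h1.cexp
  rw [(h.const_mul _).deriv]
  push_cast; ring

lemma integral_mul_mFourier_neg (g : Torus → ℝ) (k : Fin 2 → ℤ) :
    ∫ x, (g x : ℂ) * mFourier (-k) x ∂torusMeasure = fourierCoeffR g k := by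
  rw [fourierCoeffR_eq]
  simp only [mul_comm]

/-- Characters are multiplicative, so `e_{-k} (K * θ)` is the convolution of `e_{-k} θ` and `e_{-k}
K`, and the integral of a convolution is the product of the integrals. -/
lemma fourierCoeffR_conv {K θ : Torus → ℝ} (hK : Integrable K torusMeasure)
    (hθ : Integrable θ torusMeasure) (k : Fin 2 → ℤ) :
    fourierCoeffR (conv K θ) k = fourierCoeffR K k * fourierCoeffR θ k := by
  have h := integral_convolution (L := ContinuousLinearMap.mul ℝ ℂ) (μ := torusMeasure)
    (ν := torusMeasure) (integrable_mul_mFourier hθ (-k)) (integrable_mul_mFourier hK (-k))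
  simp only [ContinuousLinearMap.mul_apply'] at h
  rw [← fourierCoeffR_eq, ← fourierCoeffR_eq, mul_comm (fourierCoeffR θ k)] at h
  rw [← h, fourierCoeffR_eq]
  refine integral_congr_ae (Filter.Eventually.of_forall fun x => ?_)
  simp only [convolution, ContinuousLinearMap.mul_apply', conv]
  rw [← integral_complex_ofReal, ← integral_const_mul]
  refine integral_congr_ae (Filter.Eventually.of_forall fun y => ?_)
  have : mFourier (-k) x = mFourier (-k) y * mFourier (-k) (x - y) := by
    rw [← mFourier_apply_add]; congr 1; abel
  simp only [this]
  push_cast; ring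

/-- The Fourier multiplier of the drift operator `ℛ`. -/
def driftSymbol (K : Torus → ℝ) (i : Fin 2) (k : Fin 2 → ℤ) : ℂ :=
  2 * Real.pi * Complex.I * (if i = 0 then -(k 1 : ℂ) else k 0) * fourierCoeffR K k

/-- Characters are admissible test functions, and on them a distributional derivative is a factor
`2πi k`. A drift is thereby determined by `θ`, whichever `L^p` bound produced it. -/
lemma IsDrift.fourierCoeffR {K θ : Torus → ℝ} {u : Fin 2 → Torus → ℝ} (h : IsDrift K θ u)
    (hK : Integrable K torusMeasure) (hθ : Integrable θ torusMeasure) (i : Fin 2)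
    (k : Fin 2 → ℤ) :
    fourierCoeffR (u i) k = driftSymbol K i k * fourierCoeffR θ k := by
  have h1 := h.2 (mFourier (-k)) (isSmooth_mFourier _)
  simp only [partialX_mFourier] at h1
  have h2 : ∀ c : ℂ, ∫ x, (conv K θ x : ℂ) * (c * mFourier (-k) x) ∂torusMeasure
      = c * (ActiveScalar.fourierCoeffR K k * ActiveScalar.fourierCoeffR θ k) := by
    intro c
    rw [← fourierCoeffR_conv hK hθ, ← integral_mul_mFourier_neg, ← integral_const_mul]
    refine integral_congr_ae (Filter.Eventually.of_forall fun x => ?_)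
    simp only; ring
  rw [integral_mul_mFourier_neg, integral_mul_mFourier_neg, h2, h2] at h1
  obtain rfl | rfl : i = 0 ∨ i = 1 := by omega
  · rw [h1.1]; simp [driftSymbol]; ring
  · rw [h1.2]; simp [driftSymbol]; ring

lemma driftSymbol_divergence (K : Torus → ℝ) (k : Fin 2 → ℤ) :
    ∑ i, (k i : ℂ) * driftSymbol K i k = 0 := by
  simp [driftSymbol, Fin.sum_univ_two]; ring

lemma freqNorm_nonneg (k : Fin 2 → ℤ) : 0 ≤ freqNorm k := Real.sqrt_nonneg _

lemma freqNorm_sq (k : Fin 2 → ℤ) : freqNorm k ^ 2 = (k 0 : ℝ) ^ 2 + (k 1 : ℝ) ^ 2 := by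
  unfold freqNorm
  rw [Real.sq_sqrt (by positivity), Fin.sum_univ_two]

lemma abs_le_freqNorm (k : Fin 2 → ℤ) (i : Fin 2) : |(k i : ℝ)| ≤ freqNorm k := by
  refine abs_le_of_sq_le_sq' ?_ (freqNorm_nonneg k) |> abs_le.2
  rw [freqNorm_sq]
  fin_cases i <;> simp <;> positivity

lemma freqNorm_neg (k : Fin 2 → ℤ) : freqNorm (-k) = freqNorm k := by
  simp [freqNorm]

lemma freqNorm_pos {k : Fin 2 → ℤ} (hk : k ≠ 0) : 0 < freqNorm k := by
  obtain ⟨i, hi⟩ := Function.ne_iff.1 hk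
  refine lt_of_lt_of_le ?_ (abs_le_freqNorm k i)
  simpa using hi

/-- The decay `|k|⁻¹` of the kernel offsets the one derivative, so `ℛ` has order zero. At `k = 0`,
where nothing is assumed of `K̂`, the derivative factor vanishes. -/
lemma IsAdmissibleKernel.exists_driftSymbol_le {K : Torus → ℝ} (hK : IsAdmissibleKernel K) :
    ∃ C : ℝ, 0 ≤ C ∧ ∀ i k, ‖driftSymbol K i k‖ ≤ C := by
  obtain ⟨c, C, hc, hC, h⟩ := hK.fourier
  refine ⟨2 * Real.pi * C, by positivity, fun i k => ?_⟩
  by_cases hk : k = 0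
  · subst hk
    have : driftSymbol K i 0 = 0 := by simp [driftSymbol]
    rw [this, norm_zero]; positivity
  obtain ⟨him, hre1, hre2⟩ := h k hk
  have hpos := freqNorm_pos hk
  have h1 : ‖fourierCoeffR K k‖ ≤ C * (freqNorm k)⁻¹ := by
    refine (Complex.norm_le_abs_re_add_abs_im _).trans ?_
    rw [him, abs_zero, add_zero, abs_of_nonneg]
    · exact hre2
    · exact le_trans (by positivity) hre1
  have h2 : ‖(if i = 0 then -(k 1 : ℂ) else k 0)‖ ≤ freqNorm k := by
    split_ifs
    · rw [norm_neg]; simpa using abs_le_freqNorm k 1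
    · simpa using abs_le_freqNorm k 0
  unfold driftSymbol
  rw [norm_mul, norm_mul]
  have h3 : ‖(2 * Real.pi * Complex.I : ℂ)‖ = 2 * Real.pi := by
    simp [abs_of_pos Real.pi_pos]
  rw [h3]
  calc 2 * Real.pi * ‖(if i = 0 then -(k 1 : ℂ) else k 0)‖ * ‖fourierCoeffR K k‖
      ≤ 2 * Real.pi * freqNorm k * (C * (freqNorm k)⁻¹) := by gcongr
    _ = 2 * Real.pi * C := by field_simp

lemma IsAdmissibleKernel.exists_isDrift {K : Torus → ℝ} (hK : IsAdmissibleKernel K) (θ : L2) :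
    ∃ u : Fin 2 → L2, IsDrift K θ (fun i => u i) := by
  obtain ⟨C, hC⟩ := hK.bounded 2 one_lt_two
  have h2 : ENNReal.ofReal 2 = 2 := by simp
  obtain ⟨u, hu, hu'⟩ := hC θ (by rw [h2]; exact Lp.memLp θ)
  rw [h2] at hu'
  refine ⟨fun i => (hu' i).1.toLp _, ?_, ?_⟩
  · exact fun i => L2.integrable _
  · intro φ hφ
    rw [← (hu.2 φ hφ).1, ← (hu.2 φ hφ).2]
    constructor
    all_goals
      refine integral_congr_ae ?_
      filter_upwards [(hu' 0).1.coeFn_toLp, (hu' 1).1.coeFn_toLp] with x h1 h2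
      simp only [h1, h2]

/-- The drift inherits `L^q` bounds, `q ≥ 2`. -/
lemma IsAdmissibleKernel.exists_eLpNorm_drift_le {K : Torus → ℝ} (hK : IsAdmissibleKernel K)
    {q : ℝ} (hq : 2 ≤ q) : ∃ C : ℝ, ∀ (θ : L2) (u : Fin 2 → L2),
      IsDrift K θ (fun i => u i) → MemLp θ (ENNReal.ofReal q) torusMeasure → ∀ i,
        MemLp (u i) (ENNReal.ofReal q) torusMeasure ∧
        eLpNorm (u i) (ENNReal.ofReal q) torusMeasure ≤
          ENNReal.ofReal C * eLpNorm θ (ENNReal.ofReal q) torusMeasure := by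
  obtain ⟨C, hC⟩ := hK.bounded q (by linarith)
  refine ⟨C, fun θ u hu hθ i => ?_⟩
  obtain ⟨u', hu', hb⟩ := hC θ hθ
  have hq2 : (2 : ℝ≥0∞) ≤ ENNReal.ofReal q := by
    rw [show (2 : ℝ≥0∞) = ENNReal.ofReal 2 by simp]
    exact ENNReal.ofReal_le_ofReal hq
  have hm : MemLp (u' i) 2 torusMeasure := (hb i).1.mono_exponent hq2
  -- The field provided by the `L^q` bound and the given `L²` field have the same Fourier
  -- coefficients, so the bound passes from one to the other.
  have heq : u i = hm.toLp _ := by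
    refine L2.ext_fourier fun k => ?_
    rw [hu.fourierCoeffR hK.integrable θ.integrable i k, fourierCoeffR_congr_ae hm.coeFn_toLp,
      hu'.fourierCoeffR hK.integrable θ.integrable i k]
  have hae : u i =ᵐ[torusMeasure] u' i := by rw [heq]; exact hm.coeFn_toLp
  exact ⟨(hb i).1.ae_eq hae.symm, (eLpNorm_congr_ae hae).trans_le (hb i).2⟩

end

section

open UnitAddTorus ComplexConjugate

/-! ### Primitives of integrable functions of time -/

/-- Integration by parts for absolutely continuous functions. The time data are only integrable, so
the primitive of `b` has derivative `b` merely almost everywhere. -/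
lemma integral_deriv_mul_primitive_real {f b : ℝ → ℝ} {t : ℝ}
    (hf : AbsolutelyContinuousOnInterval f 0 t) (hb : IntervalIntegrable b volume 0 t) :
    ∫ τ in (0 : ℝ)..t, (deriv f τ * (∫ σ in (0 : ℝ)..τ, b σ) + f τ * b τ)
      = f t * ∫ σ in (0 : ℝ)..t, b σ := by
  have hB := hb.absolutelyContinuousOnInterval_intervalIntegral (c := 0) (by simp)
  have h := hf.integral_deriv_mul_eq_sub hB
  simp only [intervalIntegral.integral_same, mul_zero, sub_zero] at h
  rw [← h]
  refine intervalIntegral.integral_congr_ae ?_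
  filter_upwards [hb.ae_hasDerivAt_integral] with τ hτ hmem
  rw [(hτ (uIoc_subset_uIcc hmem) 0 (by simp)).deriv]

lemma re_intervalIntegral {b : ℝ → ℂ} {s t : ℝ} (hb : IntervalIntegrable b volume s t) :
    (∫ τ in s..t, b τ).re = ∫ τ in s..t, (b τ).re :=
  (Complex.reCLM.intervalIntegral_comp_comm hb).symm

lemma im_intervalIntegral {b : ℝ → ℂ} {s t : ℝ} (hb : IntervalIntegrable b volume s t) :
    (∫ τ in s..t, b τ).im = ∫ τ in s..t, (b τ).im :=
  (Complex.imCLM.intervalIntegral_comp_comm hb).symm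

lemma intervalIntegrable_re {b : ℝ → ℂ} {s t : ℝ} (hb : IntervalIntegrable b volume s t) :
    IntervalIntegrable (fun τ => (b τ).re) volume s t :=
  ⟨hb.1.re, hb.2.re⟩

lemma intervalIntegrable_im {b : ℝ → ℂ} {s t : ℝ} (hb : IntervalIntegrable b volume s t) :
    IntervalIntegrable (fun τ => (b τ).im) volume s t :=
  ⟨hb.1.im, hb.2.im⟩

lemma intervalIntegrable_deriv_mul_primitive {f : ℝ → ℝ} {b : ℝ → ℂ} {t : ℝ}
    (hf : AbsolutelyContinuousOnInterval f 0 t) (hb : IntervalIntegrable b volume 0 t) :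
    IntervalIntegrable (fun τ => ((deriv f τ : ℝ) : ℂ) * (∫ σ in (0 : ℝ)..τ, b σ) + f τ * b τ)
      volume 0 t := by
  have h1 : IntervalIntegrable (fun τ => ((deriv f τ : ℝ) : ℂ)) volume 0 t :=
    ⟨hf.intervalIntegrable_deriv.1.ofReal, hf.intervalIntegrable_deriv.2.ofReal⟩
  refine (h1.mul_continuousOn ?_).add (hb.continuousOn_mul ?_)
  · exact intervalIntegral.continuousOn_primitive_interval' hb (by simp)
  · exact Complex.continuous_ofReal.comp_continuousOn hf.continuousOn

lemma integral_deriv_mul_primitive {f : ℝ → ℝ} {b : ℝ → ℂ} {t : ℝ}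
    (hf : AbsolutelyContinuousOnInterval f 0 t) (hb : IntervalIntegrable b volume 0 t) :
    ∫ τ in (0 : ℝ)..t, (((deriv f τ : ℝ) : ℂ) * (∫ σ in (0 : ℝ)..τ, b σ) + f τ * b τ)
      = f t * ∫ σ in (0 : ℝ)..t, b σ := by
  have hi := intervalIntegrable_deriv_mul_primitive hf hb
  have hsub : ∀ τ ∈ uIcc 0 t, IntervalIntegrable b volume 0 τ := fun τ hτ =>
    hb.mono_set (uIcc_subset_uIcc (by simp) hτ)
  refine Complex.ext ?_ ?_
  · rw [re_intervalIntegral hi, Complex.re_ofReal_mul, re_intervalIntegral hb,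
      ← integral_deriv_mul_primitive_real hf (intervalIntegrable_re hb)]
    refine intervalIntegral.integral_congr fun τ hτ => ?_
    simp only [Complex.add_re, Complex.re_ofReal_mul, re_intervalIntegral (hsub τ hτ)]
  · rw [im_intervalIntegral hi, Complex.im_ofReal_mul, im_intervalIntegral hb,
      ← integral_deriv_mul_primitive_real hf (intervalIntegrable_im hb)]
    refine intervalIntegral.integral_congr fun τ hτ => ?_
    simp only [Complex.add_im, Complex.im_ofReal_mul, im_intervalIntegral (hsub τ hτ)]

/-- The energy balance of a single mode, `d|c|² = 2 Re(c̄ c')`, obtained from the real and imaginary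
parts separately. -/
lemma sq_norm_primitive {g : ℝ → ℂ} {t : ℝ} (hg : IntervalIntegrable g volume 0 t) :
    ‖∫ τ in (0 : ℝ)..t, g τ‖ ^ 2
      = ∫ τ in (0 : ℝ)..t, 2 * (conj (∫ σ in (0 : ℝ)..τ, g σ) * g τ).re := by
  have key : ∀ b : ℝ → ℝ, IntervalIntegrable b volume 0 t →
      IntervalIntegrable (fun τ => 2 * ((∫ σ in (0 : ℝ)..τ, b σ) * b τ)) volume 0 t ∧
      (∫ τ in (0 : ℝ)..t, 2 * ((∫ σ in (0 : ℝ)..τ, b σ) * b τ))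
        = (∫ τ in (0 : ℝ)..t, b τ) ^ 2 := by
    intro b hb
    constructor
    · exact (hb.continuousOn_mul
        (intervalIntegral.continuousOn_primitive_interval' hb (by simp))).const_mul 2
    · rw [sq, ← integral_deriv_mul_primitive_real
        (hb.absolutelyContinuousOnInterval_intervalIntegral (c := 0) (by simp)) hb]
      refine intervalIntegral.integral_congr_ae ?_
      filter_upwards [hb.ae_hasDerivAt_integral] with τ hτ hmem
      rw [(hτ (uIoc_subset_uIcc hmem) 0 (by simp)).deriv]
      ring
  obtain ⟨i1, e1⟩ := key _ (intervalIntegrable_re hg)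
  obtain ⟨i2, e2⟩ := key _ (intervalIntegrable_im hg)
  rw [← Complex.normSq_eq_norm_sq, Complex.normSq_apply, re_intervalIntegral hg,
    im_intervalIntegral hg, ← sq, ← sq, ← e1, ← e2, ← intervalIntegral.integral_add i1 i2]
  refine intervalIntegral.integral_congr fun τ hτ => ?_
  have hs : IntervalIntegrable g volume 0 τ := hg.mono_set (uIcc_subset_uIcc (by simp) hτ)
  simp only [Complex.mul_re, Complex.conj_re, Complex.conj_im, re_intervalIntegral hs,
    im_intervalIntegral hs]
  ring

lemma absolutelyContinuous_of_contDiff {f : ℝ → ℝ} (hf : ContDiff ℝ 1 f) (a b : ℝ) :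
    AbsolutelyContinuousOnInterval f a b :=
  hf.contDiffOn.absolutelyContinuousOnInterval

/-- The initial value problem `c' + λ c = g`, `c(0) = 0`, in integrated form is solved by the
Duhamel formula. -/
lemma eq_duhamel {lam t : ℝ} {g c : ℝ → ℂ} (ht : 0 ≤ t)
    (hg : IntervalIntegrable g volume 0 t) (hc : IntervalIntegrable c volume 0 t)
    (h : ∀ᵐ τ ∂(volume.restrict (Ioo 0 t)), c τ = ∫ σ in (0 : ℝ)..τ, (g σ - lam * c σ)) :
    ∫ σ in (0 : ℝ)..t, (g σ - lam * c σ)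
      = ∫ τ in (0 : ℝ)..t, (Real.exp (-(lam * (t - τ))) : ℂ) * g τ := by
  have hb : IntervalIntegrable (fun σ => g σ - lam * c σ) volume 0 t :=
    hg.sub (hc.const_mul _)
  have hexp : ContDiff ℝ 1 fun τ : ℝ => Real.exp (lam * τ) := by fun_prop
  have h1 := integral_deriv_mul_primitive
    (absolutelyContinuous_of_contDiff hexp 0 t) hb
  have h2 : Real.exp (-(lam * t)) * Real.exp (lam * t) = 1 := by
    rw [← Real.exp_add]; simp
  have h2' : ((Real.exp (-(lam * t)) : ℝ) : ℂ) * (Real.exp (lam * t) : ℝ) = 1 := by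
    exact_mod_cast h2
  calc ∫ σ in (0 : ℝ)..t, (g σ - lam * c σ)
      = (Real.exp (-(lam * t)) : ℝ) * ((Real.exp (lam * t) : ℝ) *
          ∫ σ in (0 : ℝ)..t, (g σ - lam * c σ)) := by rw [← mul_assoc, h2', one_mul]
    _ = _ := by
      rw [← h1, ← intervalIntegral.integral_const_mul]
      refine intervalIntegral.integral_congr_ae ?_
      rw [uIoc_of_le ht, ← ae_restrict_iff' measurableSet_Ioc,
        ← restrict_Ioo_eq_restrict_Ioc]
      filter_upwards [h] with τ hτ
      rw [← hτ]
      have hd : deriv (fun τ : ℝ => Real.exp (lam * τ)) τ = lam * Real.exp (lam * τ) := by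
        have : HasDerivAt (fun τ : ℝ => Real.exp (lam * τ)) (Real.exp (lam * τ) * (lam * 1)) τ :=
          ((hasDerivAt_id τ).const_mul lam).exp
        rw [this.deriv]; ring
      have he : Real.exp (-(lam * (t - τ))) = Real.exp (-(lam * t)) * Real.exp (lam * τ) := by
        rw [← Real.exp_add]; congr 1; ring
      rw [hd, he]
      push_cast; ring

/-- The converse of `eq_duhamel`: modes defined by the Duhamel formula do solve the integrated
equation. This is how the second order profile is constructed. -/
lemma duhamel_eq {lam t : ℝ} {g : ℝ → ℂ} (hg : IntervalIntegrable g volume 0 t) :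
    ∫ τ in (0 : ℝ)..t, (Real.exp (-(lam * (t - τ))) : ℂ) * g τ
      = ∫ σ in (0 : ℝ)..t, (g σ - lam * ∫ τ in (0 : ℝ)..σ,
          (Real.exp (-(lam * (σ - τ))) : ℂ) * g τ) := by
  have he : ∀ σ τ : ℝ, ((Real.exp (-(lam * (σ - τ))) : ℝ) : ℂ) * g τ
      = (Real.exp (-lam * σ) : ℝ) * ((Real.exp (lam * τ) : ℝ) * g τ) := by
    intro σ τ
    rw [← mul_assoc, ← Complex.ofReal_mul, ← Real.exp_add]; congr 3; ring
  have hb : IntervalIntegrable (fun τ => (Real.exp (lam * τ) : ℝ) * g τ) volume 0 t := by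
    refine hg.continuousOn_mul (Continuous.continuousOn ?_)
    fun_prop
  have hexp : ContDiff ℝ 1 fun τ : ℝ => Real.exp (-lam * τ) := by fun_prop
  have h1 := integral_deriv_mul_primitive
    (absolutelyContinuous_of_contDiff hexp 0 t) hb
  simp only [he, intervalIntegral.integral_const_mul]
  rw [← h1]
  refine intervalIntegral.integral_congr fun τ _ => ?_
  have hd : deriv (fun τ : ℝ => Real.exp (-lam * τ)) τ = -lam * Real.exp (-lam * τ) := by
    have : HasDerivAt (fun τ : ℝ => Real.exp (-lam * τ)) (Real.exp (-lam * τ) * (-lam * 1)) τ :=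
      ((hasDerivAt_id τ).const_mul (-lam)).exp
    rw [this.deriv]; ring
  have h3 : ((Real.exp (-lam * τ) : ℝ) : ℂ) * ((Real.exp (lam * τ) : ℝ) * g τ) = g τ := by
    rw [← mul_assoc, ← Complex.ofReal_mul, ← Real.exp_add]; simp
  simp only [hd, h3]
  push_cast; ring

/-- A weak solution of `h' = g`, `h(0) = 0` on `(0, T)` is the primitive of `g`. -/
lemma ae_eq_primitive_of_weak {T : ℝ} (hT : 0 < T) {h g : ℝ → ℂ}
    (hh : IntegrableOn h (Ioo 0 T)) (hg : IntegrableOn g (Ioo 0 T))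
    (H : ∀ χ : ℝ → ℝ, ContDiff ℝ ∞ χ → HasCompactSupport χ → tsupport χ ⊆ Iio T →
      ∫ t in Ioo 0 T, (((deriv χ t : ℝ) : ℂ) * h t + χ t * g t) = 0) :
    ∀ᵐ t ∂(volume.restrict (Ioo 0 T)), h t = ∫ τ in (0 : ℝ)..t, g τ := by
  have hgI : IntervalIntegrable g volume 0 T := by
    rw [intervalIntegrable_iff_integrableOn_Ioo_of_le hT.le]; exact hg
  set G : ℝ → ℂ := fun t => ∫ τ in (0 : ℝ)..t, g τ with hG
  have hGc : ContinuousOn G (Icc 0 T) := by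
    have := intervalIntegral.continuousOn_primitive_interval' hgI (a := 0) (by simp)
    rwa [uIcc_of_le hT.le] at this
  have hGi : IntegrableOn G (Ioo 0 T) :=
    (hGc.integrableOn_Icc).mono_set Ioo_subset_Icc_self
  have hloc : LocallyIntegrableOn (fun t => h t - G t) (Ioo 0 T) :=
    (hh.sub hGi).locallyIntegrableOn
  have key := isOpen_Ioo.ae_eq_zero_of_integral_contDiff_smul_eq_zero hloc ?_
  · rw [ae_restrict_iff' measurableSet_Ioo]
    filter_upwards [key] with t ht hmem
    exact sub_eq_zero.1 (ht hmem)
  intro ψ hψ hψc hψs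
  -- The primitive is normalised at `T`, so it vanishes near `T` but in general not at `0`.
  -- Admitting such test functions is what encodes the initial value zero.
  set P : ℝ → ℝ := fun t => ∫ τ in T..t, ψ τ with hP
  have hPd : ∀ t, HasDerivAt P (ψ t) t := fun t =>
    intervalIntegral.integral_hasDerivAt_right (hψ.continuous.intervalIntegrable _ _)
      (hψ.continuous.stronglyMeasurableAtFilter _ _) hψ.continuous.continuousAt
  have hPdiff : ContDiff ℝ ∞ P := by
    rw [contDiff_infty_iff_deriv]
    refine ⟨fun t => (hPd t).differentiableAt, ?_⟩
    have : deriv P = ψ := funext fun t => (hPd t).deriv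
    rw [this]; exact hψ
  obtain ⟨b, hbT, hb⟩ : ∃ b < T, tsupport ψ ⊆ Iic b := by
    by_cases hne : (tsupport ψ).Nonempty
    · obtain ⟨b, hb1, hb2⟩ := IsCompact.exists_isMaxOn hψc hne continuousOn_id
      exact ⟨b, (hψs hb1).2, fun x hx => hb2 hx⟩
    · rw [not_nonempty_iff_eq_empty] at hne
      exact ⟨T - 1, by linarith, by rw [hne]; exact empty_subset _⟩
  have hψ0 : ∀ t, b < t → ψ t = 0 := by
    intro t ht
    by_contra hne
    exact absurd (hb (subset_tsupport _ hne)) (by simpa using ht)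
  have hP0 : ∀ t, b < t → P t = 0 := by
    intro t ht
    simp only [hP]
    refine (intervalIntegral.integral_congr fun τ hτ => hψ0 τ ?_).trans
      intervalIntegral.integral_zero
    exact lt_of_lt_of_le (lt_min hbT ht) hτ.1
  -- To the left of the support of `ψ` the primitive is a constant, possibly nonzero, so a cutoff is
  -- needed for compact support. It equals `1` on `[-(T+1), T+1]`, which contains `[0, T]`.
  let κ : ContDiffBump (0 : ℝ) := ⟨T + 1, T + 2, by linarith, by linarith⟩
  set χ : ℝ → ℝ := fun t => κ t * P t with hχ
  have hκ : ContDiff ℝ ∞ κ := κ.contDiff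
  have hχd : ContDiff ℝ ∞ χ := hκ.mul hPdiff
  have hχc : HasCompactSupport χ := κ.hasCompactSupport.mul_right
  have hχs : tsupport χ ⊆ Iio T := by
    refine subset_trans (closure_minimal ?_ isClosed_Iic) (Iic_subset_Iio.2 hbT)
    intro t ht
    by_contra hlt
    exact ht (by simp [hχ, hP0 t (by simpa using hlt)])
  have hχP : ∀ t ∈ Ioo 0 T, χ =ᶠ[nhds t] P := by
    intro t ht
    filter_upwards [isOpen_Ioo.mem_nhds (show t ∈ Ioo (-(T + 1)) (T + 1) from
      ⟨by linarith [ht.1], by linarith [ht.2]⟩)] with τ hτ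
    have : κ τ = 1 := κ.one_of_mem_closedBall (by
      simp only [Metric.mem_closedBall, dist_zero_right, Real.norm_eq_abs]
      exact (abs_lt.2 hτ).le)
    simp [hχ, this]
  have hw := H χ hχd hχc hχs
  have hw2 : ∫ t in Ioo 0 T, ((ψ t : ℂ) * h t + P t * g t) = 0 := by
    rw [← hw]
    refine setIntegral_congr_fun measurableSet_Ioo fun t ht => ?_
    simp only [(hχP t ht).deriv_eq, (hPd t).deriv, (hχP t ht).eq_of_nhds]
  -- Integration by parts gives the same identity for `G` in place of `h`. Subtracting it from the
  -- weak one leaves `∫ ψ (h - G) = 0`.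
  have hparts := integral_deriv_mul_primitive
    (absolutelyContinuous_of_contDiff (hPdiff.of_le (by simp)) 0 T) hgI
  rw [hP0 T hbT, intervalIntegral.integral_of_le hT.le, integral_Ioc_eq_integral_Ioo] at hparts
  simp only [Complex.ofReal_zero, zero_mul, (hPd _).deriv] at hparts
  have hψcont : Continuous fun t => (ψ t : ℂ) := Complex.continuous_ofReal.comp hψ.continuous
  have hPcont : Continuous fun t => (P t : ℂ) := Complex.continuous_ofReal.comp hPdiff.continuous
  have mulint : ∀ {a b : ℝ → ℂ}, Continuous a → IntegrableOn b (Ioo 0 T) →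
      IntegrableOn (fun t => a t * b t) (Ioo 0 T) := by
    intro a b ha hb
    have hb' : IntervalIntegrable b volume 0 T := by
      rw [intervalIntegrable_iff_integrableOn_Ioo_of_le hT.le]; exact hb
    have := hb'.continuousOn_mul (ha.continuousOn : ContinuousOn a (uIcc 0 T))
    rwa [intervalIntegrable_iff_integrableOn_Ioo_of_le hT.le] at this
  rw [integral_add (mulint hψcont hh) (mulint hPcont hg)] at hw2
  rw [integral_add (mulint hψcont hGi) (mulint hPcont hg)] at hparts
  have h3 : ∫ x, ψ x • (h x - G x) = ∫ x in Ioo 0 T, ψ x • (h x - G x) := by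
    refine (setIntegral_eq_integral_of_forall_compl_eq_zero fun x hx => ?_).symm
    have : ψ x = 0 := by
      by_contra hne
      exact hx (hψs (subset_tsupport _ hne))
    simp [this]
  rw [h3]
  simp only [Complex.real_smul, mul_sub]
  rw [integral_sub (mulint hψcont hh) (mulint hψcont hGi)]
  linear_combination hw2 - hparts

end

section

open UnitAddTorus ComplexConjugate

/-! ### The weak formulation in terms of Fourier modes -/

/-- The symbol `|2πk|^{2α}` of the fractional Laplacian. -/
def eig (α : ℝ) (k : Fin 2 → ℤ) : ℝ := (2 * Real.pi * freqNorm k) ^ (2 * α)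

lemma eig_nonneg (α : ℝ) (k : Fin 2 → ℤ) : 0 ≤ eig α k :=
  Real.rpow_nonneg (mul_nonneg (by positivity) (freqNorm_nonneg k)) _

lemma mFourierCoeff_mFourier (n k : Fin 2 → ℤ) :
    mFourierCoeff (mFourier n) k = if k = n then 1 else 0 := by
  have h1 := orthonormal_iff_ite.1 (orthonormal_mFourier (d := Fin 2)) k n
  rw [← h1, ContinuousMap.inner_toLp]
  change ∫ x, mFourier (-k) x • mFourier n x ∂torusMeasure = ∫ x, _ ∂torusMeasure
  refine integral_congr_ae (Filter.Eventually.of_forall fun x => ?_)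
  simp [← mFourier_neg, mul_comm]

lemma fracLaplacian_mul_mFourier (α : ℝ) (c : ℂ) (n : Fin 2 → ℤ) (x : Torus) :
    fracLaplacian α (fun y => c * mFourier n y) x = eig α n * (c * mFourier n x) := by
  have h : ∀ k, mFourierCoeff (fun y => c * mFourier n y) k = if k = n then c else 0 := by
    intro k
    have h1 : mFourierCoeff (fun y => c * mFourier n y) k = c * mFourierCoeff (mFourier n) k := by
      change ∫ x, mFourier (-k) x • (c * mFourier n x) ∂torusMeasure
        = c * ∫ x, mFourier (-k) x • mFourier n x ∂torusMeasure
      rw [← integral_const_mul]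
      refine integral_congr_ae (Filter.Eventually.of_forall fun x => ?_)
      simp only [smul_eq_mul]; ring
    rw [h1, mFourierCoeff_mFourier]; simp
  unfold fracLaplacian
  simp only [h]
  rw [tsum_eq_single n]
  · simp [eig]; ring
  · intro k hk; simp [hk]

lemma partialX_mul_mFourier (i : Fin 2) (c : ℂ) (n : Fin 2 → ℤ) (x : Torus) :
    partialX i (fun y => c * mFourier n y) x
      = 2 * Real.pi * Complex.I * n i * (c * mFourier n x) := by
  have h := partialX_mFourier i n x
  unfold partialX at h ⊢
  simp only [deriv_const_mul_field', h]
  ring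

instance : CompactSpace Torus := inferInstanceAs (CompactSpace (Fin 2 → UnitAddCircle))

lemma isTest_mul_mFourier {T : ℝ} {χ : ℝ → ℝ} (h : ContDiff ℝ ∞ χ) (hc : HasCompactSupport χ)
    (hs : tsupport χ ⊆ Iio T) (n : Fin 2 → ℤ) :
    IsTest T (fun p : ℝ × Torus => (χ p.1 : ℂ) * mFourier n p.2) := by
  have hsub : tsupport (fun p : ℝ × Torus => (χ p.1 : ℂ) * mFourier n p.2)
      ⊆ tsupport χ ×ˢ univ := by
    refine closure_minimal ?_ ((isClosed_tsupport χ).prod isClosed_univ)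
    intro p hp
    refine ⟨subset_tsupport _ fun h0 => hp (by simp [h0]), mem_univ _⟩
  refine ⟨?_, ?_, ?_⟩
  · have h1 : ContDiff ℝ ∞ fun p : ℝ × (Fin 2 → ℝ) => (χ p.1 : ℂ) :=
      Complex.ofRealCLM.contDiff.comp (h.comp contDiff_fst)
    have h2 : ContDiff ℝ ∞ fun p : ℝ × (Fin 2 → ℝ) => mFourier n (proj p.2) :=
      (isSmooth_mFourier n).comp contDiff_snd
    exact h1.mul h2
  · exact IsCompact.of_isClosed_subset (IsCompact.prod hc isCompact_univ) (isClosed_tsupport _) hsub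
  · exact hsub.trans (prod_mono hs (subset_univ _))

/-- The Fourier modes of a weak solution solve ordinary differential equations. -/
lemma WeakIVP.mode {α T : ℝ} (hT : 0 < T) {θ : ℝ → L2} {F : ℝ → Fin 2 → Torus → ℝ}
    {f : ℝ × Torus → ℝ} (h : WeakIVP α T θ F f) (k : Fin 2 → ℤ)
    (hθ : IntegrableOn (fun t => fourierCoeffR (θ t) k) (Ioo 0 T))
    (hFi : ∀ᵐ t ∂(volume.restrict (Ioo 0 T)), ∀ i, Integrable (F t i) torusMeasure)
    (hF : ∀ i, IntegrableOn (fun t => fourierCoeffR (F t i) k) (Ioo 0 T))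
    (hf : IntegrableOn (fun t => fourierCoeffR (fun x => f (t, x)) k) (Ioo 0 T)) :
    ∀ᵐ t ∂(volume.restrict (Ioo 0 T)), fourierCoeffR (θ t) k
      = ∫ τ in (0 : ℝ)..t, (fourierCoeffR (fun x => f (τ, x)) k
          - 2 * Real.pi * Complex.I * ∑ i, (k i : ℂ) * fourierCoeffR (F τ i) k
          - eig α k * fourierCoeffR (θ τ) k) := by
  refine ae_eq_primitive_of_weak hT hθ ?_ ?_
  · exact (hf.sub ((integrable_finsetSum _ fun i _ => (hF i).const_mul _).const_mul _)).sub
      (hθ.const_mul _)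
  intro χ hχ hχc hχs
  -- The test function `χ(t) e_{-k}` isolates the `k`-th mode: the derivatives falling on `e_{-k}`
  -- become the factors `-2πi k` and `|2πk|^{2α}`.
  have hw := h _ (isTest_mul_mFourier hχ hχc hχs (-k))
  have hL : ∀ᵐ t ∂(volume.restrict (Ioo 0 T)),
      (∫ x, (-(θ t x : ℂ) * deriv (fun τ => (χ τ : ℂ) * mFourier (-k) x) t
          - ∑ i, (F t i x : ℂ) * partialX i (fun y => (χ t : ℂ) * mFourier (-k) y) x
          + (θ t x : ℂ) * fracLaplacian α (fun y => (χ t : ℂ) * mFourier (-k) y) x) ∂torusMeasure)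
      = -(((deriv χ t : ℝ) : ℂ) * fourierCoeffR (θ t) k)
        + χ t * (2 * Real.pi * Complex.I * ∑ i, (k i : ℂ) * fourierCoeffR (F t i) k
          + eig α k * fourierCoeffR (θ t) k) := by
    filter_upwards [hFi] with t ht
    have hd : ∀ x, deriv (fun τ => (χ τ : ℂ) * mFourier (-k) x) t
        = ((deriv χ t : ℝ) : ℂ) * mFourier (-k) x := by
      intro x
      have h1 : HasDerivAt (fun τ => (χ τ : ℂ)) ((deriv χ t : ℝ) : ℂ) t :=
        ((hχ.differentiable (by simp)) t).hasDerivAt.ofReal_comp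
      exact (h1.mul_const _).deriv
    have heig : eig α (-k) = eig α k := by simp [eig, freqNorm_neg]
    simp only [hd, partialX_mul_mFourier, fracLaplacian_mul_mFourier, heig]
    have hpt : ∀ x, (-(θ t x : ℂ) * (((deriv χ t : ℝ) : ℂ) * mFourier (-k) x)
        - ∑ i, (F t i x : ℂ) * (2 * Real.pi * Complex.I * ((-k) i : ℤ)
            * ((χ t : ℂ) * mFourier (-k) x))
        + (θ t x : ℂ) * (eig α k * ((χ t : ℂ) * mFourier (-k) x)))
        = (-((deriv χ t : ℝ) : ℂ) + χ t * eig α k) * (mFourier (-k) x * (θ t x : ℂ))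
          + ∑ i, (χ t * (2 * Real.pi * Complex.I * (k i : ℂ)))
              * (mFourier (-k) x * (F t i x : ℂ)) := by
      intro x
      simp only [Fin.sum_univ_two, Pi.neg_apply]
      push_cast; ring
    simp only [hpt]
    rw [integral_add ((integrable_mul_mFourier (θ t).integrable _).const_mul _)
      (integrable_finsetSum _ fun i _ => (integrable_mul_mFourier (ht i) _).const_mul _),
      integral_finsetSum _ fun i _ => (integrable_mul_mFourier (ht i) _).const_mul _]
    simp only [integral_const_mul, ← fourierCoeffR_eq, Fin.sum_univ_two]
    ring
  have hR : ∀ t, (∫ x, (f (t, x) : ℂ) * ((χ t : ℂ) * mFourier (-k) x) ∂torusMeasure)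
      = χ t * fourierCoeffR (fun x => f (t, x)) k := by
    intro t
    rw [fourierCoeffR_eq, ← integral_const_mul]
    refine integral_congr_ae (Filter.Eventually.of_forall fun x => ?_)
    simp only; ring
  rw [integral_congr_ae hL] at hw
  simp only [hR] at hw
  have hχcont : Continuous fun t => (χ t : ℂ) := Complex.continuous_ofReal.comp hχ.continuous
  have hdcont : Continuous fun t => ((deriv χ t : ℝ) : ℂ) :=
    Complex.continuous_ofReal.comp (hχ.continuous_deriv (by simp))
  have mulint : ∀ {a b : ℝ → ℂ}, Continuous a → IntegrableOn b (Ioo 0 T) →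
      IntegrableOn (fun t => a t * b t) (Ioo 0 T) := by
    intro a b ha hb
    have hb' : IntervalIntegrable b volume 0 T := by
      rw [intervalIntegrable_iff_integrableOn_Ioo_of_le hT.le]; exact hb
    have := hb'.continuousOn_mul (ha.continuousOn : ContinuousOn a (uIcc 0 T))
    rwa [intervalIntegrable_iff_integrableOn_Ioo_of_le hT.le] at this
  have hrest := ((integrable_finsetSum (Finset.univ : Finset (Fin 2))
    fun i _ => (hF i).const_mul (k i : ℂ)).const_mul
      (2 * Real.pi * Complex.I)).add (hθ.const_mul (eig α k : ℂ))
  have e1 := mulint hdcont hθ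
  have e2 := mulint hχcont hrest
  have e3 := mulint hχcont hf
  have e4 : ∀ t, ((deriv χ t : ℝ) : ℂ) * fourierCoeffR (θ t) k
      + χ t * (fourierCoeffR (fun x => f (t, x)) k
          - 2 * Real.pi * Complex.I * ∑ i, (k i : ℂ) * fourierCoeffR (F t i) k
          - eig α k * fourierCoeffR (θ t) k)
      = χ t * fourierCoeffR (fun x => f (t, x)) k -
        (-(((deriv χ t : ℝ) : ℂ) * fourierCoeffR (θ t) k)
        + χ t * (2 * Real.pi * Complex.I * ∑ i, (k i : ℂ) * fourierCoeffR (F t i) k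
          + eig α k * fourierCoeffR (θ t) k)) := by
    intro t; ring
  simp only [e4]
  have e12 : IntegrableOn (fun t => -(((deriv χ t : ℝ) : ℂ) * fourierCoeffR (θ t) k)
        + χ t * (2 * Real.pi * Complex.I * ∑ i, (k i : ℂ) * fourierCoeffR (F t i) k
          + eig α k * fourierCoeffR (θ t) k)) (Ioo 0 T) := e1.neg.add e2
  rw [integral_sub e3 e12, hw]
  exact sub_self _

end

section

open UnitAddTorus ComplexConjugate ProbabilityTheory

/-! ### Gaussian regularisation -/

/-- `1 + |k|²`. -/
def bracket (k : Fin 2 → ℤ) : ℝ := 1 + freqNorm k ^ 2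

lemma one_le_bracket (k : Fin 2 → ℤ) : 1 ≤ bracket k := by
  unfold bracket; nlinarith [sq_nonneg (freqNorm k)]

lemma bracket_pos (k : Fin 2 → ℤ) : 0 < bracket k := lt_of_lt_of_le one_pos (one_le_bracket k)

lemma freqNorm_sq_le_bracket (k : Fin 2 → ℤ) : freqNorm k ^ 2 ≤ bracket k := by
  unfold bracket; linarith

lemma freqNorm_le_bracket (k : Fin 2 → ℤ) : freqNorm k ≤ bracket k := by
  unfold bracket; nlinarith [sq_nonneg (freqNorm k - 1)]

/-- In two dimensions `∑ |k|^{-2r}` converges for `2r > 2`. Away from the origin `1 + |k|²`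
dominates the squared sup norm, for which the lattice sum is known from Eisenstein series. The
threshold here is where `β > 1/2` comes from later. -/
lemma summable_bracket_rpow {r : ℝ} (hr : 1 < r) :
    Summable fun k : Fin 2 → ℤ => bracket k ^ (-r) := by
  have h := EisensteinSeries.summable_one_div_norm_rpow (k := 2 * r) (by linarith)
  refine Summable.of_norm_bounded_eventually h ?_
  have hfin : ({0} : Set (Fin 2 → ℤ)).Finite := finite_singleton 0
  filter_upwards [hfin.compl_mem_cofinite] with k hk
  have hk0 : k ≠ 0 := by simpa using hk
  have hpos : 0 < ‖k‖ := norm_pos_iff.2 hk0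
  have hle : ‖k‖ ≤ freqNorm k := by
    refine (pi_norm_le_iff_of_nonneg (freqNorm_nonneg k)).2 fun i => ?_
    simpa [Int.norm_eq_abs] using abs_le_freqNorm k i
  rw [Real.norm_of_nonneg (Real.rpow_nonneg (bracket_pos k).le _)]
  have h2 : ‖k‖ ^ (-(2 * r)) = (‖k‖ ^ 2) ^ (-r) := by
    rw [← Real.rpow_natCast, ← Real.rpow_mul hpos.le]; congr 1; push_cast; ring
  rw [h2]
  refine Real.rpow_le_rpow_of_nonpos (by positivity) ?_ (by linarith)
  calc ‖k‖ ^ 2 ≤ freqNorm k ^ 2 := by gcongr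
    _ ≤ bracket k := freqNorm_sq_le_bracket k

/-- The Gaussian Fourier multiplier `exp(-(2πδ)²|k|²/2)`. -/
def gaussWeight (δ : ℝ) (k : Fin 2 → ℤ) : ℝ := Real.exp (-((2 * Real.pi * δ) ^ 2 * freqNorm k ^ 2 / 2))

lemma gaussWeight_pos (δ : ℝ) (k : Fin 2 → ℤ) : 0 < gaussWeight δ k := Real.exp_pos _

lemma gaussWeight_le_one (δ : ℝ) (k : Fin 2 → ℤ) : gaussWeight δ k ≤ 1 := by
  refine Real.exp_le_one_iff.2 ?_
  have : 0 ≤ (2 * Real.pi * δ) ^ 2 * freqNorm k ^ 2 / 2 := by positivity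
  linarith

lemma tendsto_gaussWeight (k : Fin 2 → ℤ) {l : Filter ℝ} (hl : l ≤ nhds 0) :
    Filter.Tendsto (fun δ => gaussWeight δ k) l (nhds 1) := by
  have : Continuous fun δ => gaussWeight δ k := by unfold gaussWeight; fun_prop
  have h := (this.tendsto 0).mono_left hl
  simpa [gaussWeight] using h

/-- The eigenvalues and the coefficients of the advection term grow at most like `1 + |k|²`. The
Gaussian makes all the regularised sums absolutely convergent; the cubic term of the exponential
series is enough. -/
lemma summable_gaussWeight_mul_bracket {δ : ℝ} (hδ : 0 < δ) :
    Summable fun k => gaussWeight δ k * bracket k := by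
  set a : ℝ := (2 * Real.pi * δ) ^ 2 / 2 with ha
  have hapos : 0 < a := by positivity
  refine Summable.of_nonneg_of_le (fun k => mul_nonneg (gaussWeight_pos δ k).le (bracket_pos k).le)
    (fun k => ?_) ((summable_bracket_rpow (r := 2) (by norm_num)).mul_left (Real.exp a * (6 / a ^ 3)))
  have hb := bracket_pos k
  have h1 : gaussWeight δ k = Real.exp a * Real.exp (-(a * bracket k)) := by
    rw [← Real.exp_add, gaussWeight, bracket, ha]; congr 1; ring
  have h2 : (a * bracket k) ^ 3 / 6 ≤ Real.exp (a * bracket k) := by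
    have := Real.pow_div_factorial_le_exp (a * bracket k) (by positivity) 3
    simpa [Nat.factorial] using this
  have h3 : Real.exp (-(a * bracket k)) ≤ 6 / (a * bracket k) ^ 3 := by
    rw [Real.exp_neg, inv_le_comm₀ (Real.exp_pos _) (by positivity), inv_div]
    exact h2
  have h4 : bracket k ^ (-2 : ℝ) = (bracket k ^ 2)⁻¹ := by
    rw [Real.rpow_neg hb.le]; norm_cast
  rw [h1, h4]
  calc Real.exp a * Real.exp (-(a * bracket k)) * bracket k
      ≤ Real.exp a * (6 / (a * bracket k) ^ 3) * bracket k := by gcongr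
    _ = Real.exp a * (6 / a ^ 3) * (bracket k ^ 2)⁻¹ := by field_simp

lemma integral_exp_gaussianReal (t : ℝ) :
    ∫ x : ℝ, Complex.exp (t * x * Complex.I) ∂(gaussianReal 0 1) = Real.exp (-(t ^ 2 / 2)) := by
  rw [← charFun_apply_real, charFun_gaussianReal]
  push_cast; congr 1; simp

/-- This is the derivative of the complex moment generating function `exp(z²/2)` at `z = it`. -/
lemma integral_mul_exp_gaussianReal (t : ℝ) :
    ∫ x : ℝ, (x : ℂ) * Complex.exp (t * x * Complex.I) ∂(gaussianReal 0 1)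
      = t * Complex.I * Real.exp (-(t ^ 2 / 2)) := by
  have h1 := hasDerivAt_complexMGF (X := id) (μ := gaussianReal 0 1) (z := t * Complex.I)
    (by rw [integrableExpSet_id_gaussianReal]; simp)
  have h2 : HasDerivAt (complexMGF id (gaussianReal 0 1))
      (Complex.exp ((t * Complex.I) ^ 2 / 2) * (t * Complex.I)) (t * Complex.I) := by
    have : complexMGF id (gaussianReal 0 1) = fun z => Complex.exp (z ^ 2 / 2) := by
      ext z; rw [complexMGF_id_gaussianReal]; simp
    rw [this]
    have h3 : HasDerivAt (fun z : ℂ => z ^ 2 / 2) (t * Complex.I) (t * Complex.I) := by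
      have := ((hasDerivAt_pow 2 ((t : ℂ) * Complex.I)).div_const 2)
      rwa [show (((2 : ℕ) : ℂ) * ((t : ℂ) * Complex.I) ^ (2 - 1)) / 2 = t * Complex.I by
        push_cast; ring] at this
    exact h3.cexp
  have h4 := h1.unique h2
  have h5 : ((t : ℂ) * Complex.I) ^ 2 / 2 = ((-(t ^ 2 / 2) : ℝ) : ℂ) := by
    rw [mul_pow, Complex.I_sq]; push_cast; ring
  rw [h5, ← Complex.ofReal_exp] at h4
  rw [mul_comm, ← h4]
  refine integral_congr_ae (Filter.Eventually.of_forall fun x => ?_)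
  simp only [id]
  rw [show (t : ℂ) * x * Complex.I = t * Complex.I * x by ring]

/-- The standard Gaussian measure on `ℝ²`. -/
def gauss2 : Measure (Fin 2 → ℝ) := Measure.pi fun _ => gaussianReal 0 1

instance : IsProbabilityMeasure gauss2 := by unfold gauss2; infer_instance

lemma mFourier_proj_smul (k : Fin 2 → ℤ) (δ : ℝ) (y : Fin 2 → ℝ) :
    mFourier k (proj (δ • y)) = Complex.exp (((2 * Real.pi * δ * k 0 : ℝ) : ℂ) * y 0 * Complex.I)
      * Complex.exp (((2 * Real.pi * δ * k 1 : ℝ) : ℂ) * y 1 * Complex.I) := by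
  rw [mFourier_proj, ← Complex.exp_add]
  congr 1
  simp only [Pi.smul_apply, smul_eq_mul]
  push_cast; ring

lemma integral_gauss2_prod (f g : ℝ → ℂ) :
    ∫ y, f (y 0) * g (y 1) ∂gauss2
      = (∫ x, f x ∂(gaussianReal 0 1)) * ∫ x, g x ∂(gaussianReal 0 1) := by
  have := integral_fintype_prod_eq_prod (μ := fun _ : Fin 2 => gaussianReal 0 1)
    (f := fun i => if i = 0 then f else g)
  simpa [Fin.prod_univ_two, gauss2] using this

/-- The weight `y i` brings down a factor `δ k i`. A derivative of a mollified function is thus an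
average of translates of the function, at the price of a factor `1/δ`. -/
lemma integral_mul_mFourier_gauss2 (δ : ℝ) (k : Fin 2 → ℤ) (i : Fin 2) :
    ∫ y, (y i : ℂ) * mFourier k (proj (δ • y)) ∂gauss2
      = 2 * Real.pi * Complex.I * δ * k i * gaussWeight δ k := by
  have hw : gaussWeight δ k = Real.exp (-((2 * Real.pi * δ * k 0) ^ 2 / 2))
      * Real.exp (-((2 * Real.pi * δ * k 1) ^ 2 / 2)) := by
    rw [← Real.exp_add, gaussWeight, freqNorm_sq]; congr 1; ring
  simp only [mFourier_proj_smul]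
  obtain rfl | rfl : i = 0 ∨ i = 1 := by omega
  · have := integral_gauss2_prod
      (fun x => (x : ℂ) * Complex.exp (((2 * Real.pi * δ * k 0 : ℝ) : ℂ) * x * Complex.I))
      (fun x => Complex.exp (((2 * Real.pi * δ * k 1 : ℝ) : ℂ) * x * Complex.I))
    rw [integral_mul_exp_gaussianReal, integral_exp_gaussianReal] at this
    simp only [mul_assoc] at this ⊢
    rw [this, hw]
    push_cast; ring_nf
  · have := integral_gauss2_prod
      (fun x => Complex.exp (((2 * Real.pi * δ * k 0 : ℝ) : ℂ) * x * Complex.I))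
      (fun x => (x : ℂ) * Complex.exp (((2 * Real.pi * δ * k 1 : ℝ) : ℂ) * x * Complex.I))
    rw [integral_mul_exp_gaussianReal, integral_exp_gaussianReal] at this
    have h2 : ∀ y : Fin 2 → ℝ, (y 1 : ℂ) *
        (Complex.exp (((2 * Real.pi * δ * k 0 : ℝ) : ℂ) * y 0 * Complex.I)
        * Complex.exp (((2 * Real.pi * δ * k 1 : ℝ) : ℂ) * y 1 * Complex.I)) =
        Complex.exp (((2 * Real.pi * δ * k 0 : ℝ) : ℂ) * y 0 * Complex.I) * ((y 1 : ℂ) *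
         Complex.exp (((2 * Real.pi * δ * k 1 : ℝ) : ℂ) * y 1 * Complex.I)) := fun y => by ring
    simp only [h2]
    rw [this, hw]
    push_cast; ring

lemma integrable_norm_gauss2_pow (n : ℕ) (i : Fin 2) :
    Integrable (fun y : Fin 2 → ℝ => |y i| ^ n) gauss2 := by
  have h := (memLp_id_gaussianReal (μ := 0) (v := 1) (n : NNReal)).integrable_norm_pow'
  have h2 : Integrable (fun x : ℝ => |x| ^ n) (gaussianReal 0 1) := by simpa using h
  exact integrable_comp_eval (μ := fun _ : Fin 2 => gaussianReal 0 1) (i := i) h2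

/-- Third moments suffice for the commutator: one power comes from the weight `y i` and two from the
squared increments. -/
lemma integrable_gauss2_moment :
    Integrable (fun y : Fin 2 → ℝ => (1 + |y 0| + |y 1|) ^ 3) gauss2 := by
  have hd : Integrable (fun y : Fin 2 → ℝ => 9 * (1 + |y 0| ^ 3 + |y 1| ^ 3)) gauss2 :=
    (((integrable_const _).add (integrable_norm_gauss2_pow 3 0)).add
      (integrable_norm_gauss2_pow 3 1)).const_mul 9
  refine hd.mono' (by fun_prop) (Filter.Eventually.of_forall fun y => ?_)
  have h0 := abs_nonneg (y 0)
  have h1 := abs_nonneg (y 1)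
  rw [Real.norm_of_nonneg (by positivity)]
  generalize |y 0| = a at *
  generalize |y 1| = b at *
  nlinarith [mul_nonneg (add_nonneg h0 h1) (sq_nonneg (a - b)),
    mul_nonneg (add_nonneg h0 zero_le_one) (sq_nonneg (a - 1)),
    mul_nonneg (add_nonneg h1 zero_le_one) (sq_nonneg (b - 1)),
    mul_nonneg h0 (sq_nonneg (b - 1)), mul_nonneg h1 (sq_nonneg (a - 1)), sq_nonneg (a - b)]

end

section

open UnitAddTorus ComplexConjugate ProbabilityTheory

/-! ### Weighted estimates for trigonometric polynomials -/

/-- The trigonometric polynomial with coefficients `b` on the finite set `s`. -/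
def trigPoly (s : Finset (Fin 2 → ℤ)) (b : (Fin 2 → ℤ) → ℂ) (x : Torus) : ℂ :=
  ∑ k ∈ s, b k * mFourier k x

lemma continuous_trigPoly (s : Finset (Fin 2 → ℤ)) (b : (Fin 2 → ℤ) → ℂ) :
    Continuous (trigPoly s b) := by
  unfold trigPoly
  exact continuous_finsetSum _ fun k _ => continuous_const.mul (mFourier k).continuous

lemma norm_sq_trigPoly (s : Finset (Fin 2 → ℤ)) (b : (Fin 2 → ℤ) → ℂ) (x : Torus) :
    ((‖trigPoly s b x‖ ^ 2 : ℝ) : ℂ)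
      = ∑ k ∈ s, ∑ l ∈ s, conj (b k) * b l * mFourier (-(k - l)) x := by
  rw [← Complex.normSq_eq_norm_sq, ← Complex.mul_conj, mul_comm, trigPoly, map_sum,
    Finset.sum_mul_sum]
  refine Finset.sum_congr rfl fun k _ => Finset.sum_congr rfl fun l _ => ?_
  rw [map_mul, ← mFourier_neg, show -(k - l) = -k + l by abel, mFourier_add]
  ring

lemma integral_mul_norm_sq_trigPoly {u : Torus → ℝ} (hu : Integrable u torusMeasure)
    (s : Finset (Fin 2 → ℤ)) (b : (Fin 2 → ℤ) → ℂ) :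
    ((∫ x, u x * ‖trigPoly s b x‖ ^ 2 ∂torusMeasure : ℝ) : ℂ)
      = ∑ k ∈ s, ∑ l ∈ s, conj (b k) * b l * fourierCoeffR u (k - l) := by
  rw [← integral_complex_ofReal]
  have : ∀ x, ((u x * ‖trigPoly s b x‖ ^ 2 : ℝ) : ℂ) = ∑ k ∈ s, ∑ l ∈ s,
      conj (b k) * b l * (mFourier (-(k - l)) x * (u x : ℂ)) := by
    intro x
    rw [Complex.ofReal_mul, norm_sq_trigPoly, Finset.mul_sum]
    refine Finset.sum_congr rfl fun k _ => ?_
    rw [Finset.mul_sum]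
    refine Finset.sum_congr rfl fun l _ => ?_
    ring
  simp only [this]
  have hi : ∀ k l : Fin 2 → ℤ, Integrable (fun x => conj (b k) * b l *
      (mFourier (-(k - l)) x * (u x : ℂ))) torusMeasure := fun k l =>
    (integrable_mul_mFourier hu _).const_mul _
  rw [integral_finsetSum _ fun k _ => integrable_finsetSum _ fun l _ => hi k l]
  refine Finset.sum_congr rfl fun k _ => ?_
  rw [integral_finsetSum _ fun l _ => hi k l]
  refine Finset.sum_congr rfl fun l _ => ?_
  rw [integral_const_mul, fourierCoeffR_eq]

lemma integral_norm_sq_trigPoly (s : Finset (Fin 2 → ℤ)) (b : (Fin 2 → ℤ) → ℂ) :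
    ∫ x, ‖trigPoly s b x‖ ^ 2 ∂torusMeasure = ∑ k ∈ s, ‖b k‖ ^ 2 := by
  have h := integral_mul_norm_sq_trigPoly (u := fun _ => 1) (integrable_const _) s b
  have h1 : ∀ m : Fin 2 → ℤ, fourierCoeffR (fun _ => 1) m = if m = 0 then 1 else 0 := by
    intro m
    rw [← mFourierCoeff_mFourier 0 m, mFourier_zero]
    unfold fourierCoeffR
    congr 1
  have h2 : ∀ k ∈ s, ∑ l ∈ s, conj (b k) * b l * fourierCoeffR (fun _ => 1) (k - l)
      = ((‖b k‖ ^ 2 : ℝ) : ℂ) := by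
    intro k hk
    rw [Finset.sum_eq_single k]
    · rw [sub_self, h1, if_pos rfl, mul_one, mul_comm, Complex.mul_conj,
        Complex.normSq_eq_norm_sq]
    · intro l _ hl
      rw [h1, if_neg (sub_ne_zero.2 hl.symm), mul_zero]
    · exact fun h => absurd hk h
  rw [Finset.sum_congr rfl h2, ← Complex.ofReal_sum] at h
  simpa using Complex.ofReal_injective h

lemma sum_sq_fourierCoeffR_sub_le {u : Torus → ℝ} (hu : MemLp u 2 torusMeasure)
    (s : Finset (Fin 2 → ℤ)) (k : Fin 2 → ℤ) :
    ∑ l ∈ s, ‖fourierCoeffR u (k - l)‖ ^ 2 ≤ ∫ x, u x ^ 2 ∂torusMeasure := by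
  have h := (Equiv.subLeft k).hasSum_iff.2 (hasSum_sq_fourierCoeffR hu)
  exact sum_le_hasSum s (fun _ _ => sq_nonneg _) h

/-- The bilinear estimate behind the embedding `H^β ⊂ L⁴`, `β > 1/2`. -/
lemma abs_integral_mul_norm_sq_trigPoly_le {β : ℝ} (hβ : 1 / 2 < β) {u : Torus → ℝ}
    (hu : MemLp u 2 torusMeasure) (s : Finset (Fin 2 → ℤ)) (b : (Fin 2 → ℤ) → ℂ) :
    |∫ x, u x * ‖trigPoly s b x‖ ^ 2 ∂torusMeasure|
      ≤ Real.sqrt (∑' k, bracket k ^ (-(2 * β))) * Real.sqrt (∫ x, u x ^ 2 ∂torusMeasure)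
        * ∑ k ∈ s, bracket k ^ β * ‖b k‖ ^ 2 := by
  set S : ℝ := ∑' k, bracket k ^ (-(2 * β)) with hS
  set U : ℝ := ∫ x, u x ^ 2 ∂torusMeasure with hU
  set N : ℝ := ∑ k ∈ s, bracket k ^ β * ‖b k‖ ^ 2 with hN
  have hS0 : 0 ≤ S := tsum_nonneg fun k => Real.rpow_nonneg (bracket_pos k).le _
  have hU0 : 0 ≤ U := integral_nonneg fun x => sq_nonneg _
  have hN0 : 0 ≤ N := Finset.sum_nonneg fun k _ =>
    mul_nonneg (Real.rpow_nonneg (bracket_pos k).le _) (sq_nonneg _)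
  have hsum := summable_bracket_rpow (r := 2 * β) (by linarith)
  have hw : ∀ k : Fin 2 → ℤ, 0 < bracket k ^ (β / 2) := fun k => Real.rpow_pos_of_pos (bracket_pos k) _
  -- The weights and their inverses are inserted in order to apply Cauchy–Schwarz over pairs of
  -- frequencies: the first factor gives the weighted norm of `b`, the second depends only on `u`.
  have h1 : |∫ x, u x * ‖trigPoly s b x‖ ^ 2 ∂torusMeasure|
      ≤ ∑ p ∈ s ×ˢ s, ((bracket p.1 ^ (β / 2) * ‖b p.1‖) * (bracket p.2 ^ (β / 2) * ‖b p.2‖)) *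
        ((bracket p.1 ^ (β / 2))⁻¹ * (bracket p.2 ^ (β / 2))⁻¹ * ‖fourierCoeffR u (p.1 - p.2)‖) := by
    rw [← Real.norm_eq_abs, ← Complex.norm_real,
      integral_mul_norm_sq_trigPoly (hu.integrable one_le_two), ← Finset.sum_product']
    refine (norm_sum_le _ _).trans_eq (Finset.sum_congr rfl fun p _ => ?_)
    have e1 := (hw p.1).ne'
    have e2 := (hw p.2).ne'
    rw [norm_mul, norm_mul, RCLike.norm_conj]
    field_simp
  have h2 := Finset.sum_mul_sq_le_sq_mul_sq (s ×ˢ s)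
    (fun p => (bracket p.1 ^ (β / 2) * ‖b p.1‖) * (bracket p.2 ^ (β / 2) * ‖b p.2‖))
    (fun p => (bracket p.1 ^ (β / 2))⁻¹ * (bracket p.2 ^ (β / 2))⁻¹ * ‖fourierCoeffR u (p.1 - p.2)‖)
  have hsq : ∀ k : Fin 2 → ℤ, (bracket k ^ (β / 2)) ^ 2 = bracket k ^ β := by
    intro k
    rw [← Real.rpow_natCast, ← Real.rpow_mul (bracket_pos k).le]; congr 1; push_cast; ring
  have h3 : ∑ p ∈ s ×ˢ s, ((bracket p.1 ^ (β / 2) * ‖b p.1‖) * (bracket p.2 ^ (β / 2) * ‖b p.2‖)) ^ 2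
      = N ^ 2 := by
    rw [sq N, hN, Finset.sum_mul_sum, ← Finset.sum_product']
    refine Finset.sum_congr rfl fun p _ => ?_
    rw [← hsq, ← hsq]; ring
  have hinv : ∀ k : Fin 2 → ℤ, (((bracket k ^ (β / 2))⁻¹) ^ 2) ^ 2 = bracket k ^ (-(2 * β)) := by
    intro k
    rw [inv_pow, hsq, inv_pow, ← Real.rpow_natCast, ← Real.rpow_mul (bracket_pos k).le,
      Real.rpow_neg (bracket_pos k).le]
    congr 2; push_cast; ring
  -- By the arithmetic-geometric mean inequality the two weights are separated. Each half is then
  -- summed by Parseval for `u` in one variable and by the convergent weight, as `2β > 1`, in the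
  -- other.
  have h4 : ∑ p ∈ s ×ˢ s, ((bracket p.1 ^ (β / 2))⁻¹ * (bracket p.2 ^ (β / 2))⁻¹
      * ‖fourierCoeffR u (p.1 - p.2)‖) ^ 2 ≤ S * U := by
    have e1 : ∑ p ∈ s ×ˢ s, bracket p.1 ^ (-(2 * β)) * ‖fourierCoeffR u (p.1 - p.2)‖ ^ 2 ≤ S * U := by
      rw [Finset.sum_product]
      calc _ = ∑ k ∈ s, bracket k ^ (-(2 * β)) * ∑ l ∈ s, ‖fourierCoeffR u (k - l)‖ ^ 2 := by
            simp only [Finset.mul_sum]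
        _ ≤ ∑ k ∈ s, bracket k ^ (-(2 * β)) * U := by
            refine Finset.sum_le_sum fun k _ => ?_
            exact mul_le_mul_of_nonneg_left (sum_sq_fourierCoeffR_sub_le hu s k)
              (Real.rpow_nonneg (bracket_pos k).le _)
        _ ≤ S * U := by
            rw [← Finset.sum_mul]
            exact mul_le_mul_of_nonneg_right (hsum.sum_le_tsum s
              fun k _ => Real.rpow_nonneg (bracket_pos k).le _) hU0
    have e2 : ∑ p ∈ s ×ˢ s, bracket p.2 ^ (-(2 * β)) * ‖fourierCoeffR u (p.1 - p.2)‖ ^ 2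
        = ∑ p ∈ s ×ˢ s, bracket p.1 ^ (-(2 * β)) * ‖fourierCoeffR u (p.1 - p.2)‖ ^ 2 := by
      rw [Finset.sum_product_right, Finset.sum_product]
      refine Finset.sum_congr rfl fun k _ => Finset.sum_congr rfl fun l _ => ?_
      rw [← neg_sub k l, fourierCoeffR_neg, RCLike.norm_conj]
    calc _ ≤ ∑ p ∈ s ×ˢ s, ((1 / 2) * (bracket p.1 ^ (-(2 * β)) * ‖fourierCoeffR u (p.1 - p.2)‖ ^ 2)
          + (1 / 2) * (bracket p.2 ^ (-(2 * β)) * ‖fourierCoeffR u (p.1 - p.2)‖ ^ 2)) := by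
          refine Finset.sum_le_sum fun p _ => ?_
          rw [← hinv, ← hinv]
          generalize (bracket p.1 ^ (β / 2))⁻¹ = x
          generalize (bracket p.2 ^ (β / 2))⁻¹ = y
          generalize ‖fourierCoeffR u (p.1 - p.2)‖ = z
          nlinarith [mul_nonneg (sq_nonneg (x ^ 2 - y ^ 2)) (sq_nonneg z)]
      _ ≤ S * U := by
          rw [Finset.sum_add_distrib, ← Finset.mul_sum, ← Finset.mul_sum, e2]
          linarith
  refine h1.trans (abs_le_of_sq_le_sq' (h2.trans ?_) (by positivity) |>.2)
  rw [h3, mul_pow, mul_pow, Real.sq_sqrt hS0, Real.sq_sqrt hU0]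
  calc _ ≤ N ^ 2 * (S * U) := mul_le_mul_of_nonneg_left h4 (sq_nonneg _)
    _ = _ := by ring

/-- Splitting `u ∈ L^q` at height `M` into a bounded part and a small `L²` part. -/
lemma integral_abs_mul_norm_sq_trigPoly_le {β q M : ℝ} (hβ : 1 / 2 < β) (hq : 2 ≤ q) (hM : 0 < M)
    {u : Torus → ℝ} (hu : MemLp u (ENNReal.ofReal q) torusMeasure)
    (s : Finset (Fin 2 → ℤ)) (b : (Fin 2 → ℤ) → ℂ) :
    ∫ x, |u x| * ‖trigPoly s b x‖ ^ 2 ∂torusMeasure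
      ≤ M * ∑ k ∈ s, ‖b k‖ ^ 2 + Real.sqrt (∑' k, bracket k ^ (-(2 * β)))
        * (M ^ (1 - q / 2) * Real.sqrt (∫ x, |u x| ^ q ∂torusMeasure))
        * ∑ k ∈ s, bracket k ^ β * ‖b k‖ ^ 2 := by
  have hq2 : (2 : ℝ≥0∞) ≤ ENNReal.ofReal q := by
    rw [show (2 : ℝ≥0∞) = ENNReal.ofReal 2 by simp]
    exact ENNReal.ofReal_le_ofReal hq
  have hu2 : MemLp u 2 torusMeasure := hu.mono_exponent hq2
  -- The excess of `|u|` over the height `M`, so that `|u| ≤ M + v`.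
  set v : Torus → ℝ := fun x => max (|u x| - M) 0 with hv
  have hvm : AEStronglyMeasurable v torusMeasure :=
    ((hu2.1.norm.sub aestronglyMeasurable_const).sup aestronglyMeasurable_const)
  have hvle : ∀ x, |v x| ≤ |u x| := by
    intro x
    rw [abs_of_nonneg (le_max_right _ _)]
    exact max_le (by linarith) (abs_nonneg _)
  have hv2 : MemLp v 2 torusMeasure :=
    hu2.of_le hvm (Filter.Eventually.of_forall fun x => by simpa using hvle x)
  have hG := continuous_trigPoly s b
  obtain ⟨B, hB⟩ : ∃ B, ∀ x, ‖‖trigPoly s b x‖ ^ 2‖ ≤ B := by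
    have hcont : Continuous fun x => ‖trigPoly s b x‖ ^ 2 := hG.norm.pow 2
    obtain ⟨B, hB⟩ := isCompact_univ.exists_bound_of_continuousOn hcont.continuousOn
    exact ⟨B, fun x => hB x (mem_univ x)⟩
  have hmulint : ∀ {w : Torus → ℝ}, Integrable w torusMeasure →
      Integrable (fun x => w x * ‖trigPoly s b x‖ ^ 2) torusMeasure := fun hw =>
    hw.mul_bdd (c := B) (hG.norm.pow 2).aestronglyMeasurable (Filter.Eventually.of_forall hB)
  have h1 : ∫ x, |u x| * ‖trigPoly s b x‖ ^ 2 ∂torusMeasure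
      ≤ ∫ x, (M * ‖trigPoly s b x‖ ^ 2 + v x * ‖trigPoly s b x‖ ^ 2) ∂torusMeasure := by
    refine integral_mono (hmulint (hu2.integrable one_le_two).abs)
      ((hmulint (integrable_const M)).add (hmulint (hv2.integrable one_le_two))) fun x => ?_
    have : |u x| ≤ M + v x := by
      have := le_max_left (|u x| - M) 0
      simp only [hv]; linarith
    simp only [← add_mul]
    exact mul_le_mul_of_nonneg_right this (sq_nonneg _)
  rw [integral_add (hmulint (integrable_const M)) (hmulint (hv2.integrable one_le_two)),
    integral_const_mul, integral_norm_sq_trigPoly] at h1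
  have h2 := (le_abs_self _).trans (abs_integral_mul_norm_sq_trigPoly_le hβ hv2 s b)
  have hqi : Integrable (fun x => |u x| ^ q) torusMeasure := by
    have := hu.integrable_norm_rpow (by simp; linarith) (by simp)
    simpa [ENNReal.toReal_ofReal (by linarith : 0 ≤ q)] using this
  -- Where `v` is nonzero, `|u| > M` and hence `|u|² = |u|^{2-q} |u|^q ≤ M^{2-q} |u|^q`, because `q
  -- ≥ 2`.
  have h3 : Real.sqrt (∫ x, v x ^ 2 ∂torusMeasure)
      ≤ M ^ (1 - q / 2) * Real.sqrt (∫ x, |u x| ^ q ∂torusMeasure) := by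
    have e : M ^ (1 - q / 2) = Real.sqrt (M ^ (2 - q)) := by
      rw [Real.sqrt_eq_rpow, ← Real.rpow_mul hM.le]; congr 1; ring
    rw [e, ← Real.sqrt_mul (Real.rpow_nonneg hM.le _), ← integral_const_mul]
    refine Real.sqrt_le_sqrt (integral_mono hv2.integrable_sq (hqi.const_mul _) fun x => ?_)
    simp only [hv]
    rcases le_or_gt (|u x|) M with hx | hx
    · rw [max_eq_right (by linarith)]
      simp only [ne_eq, OfNat.ofNat_ne_zero, not_false_eq_true, zero_pow]
      exact mul_nonneg (Real.rpow_nonneg hM.le _) (Real.rpow_nonneg (abs_nonneg _) _)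
    · rw [max_eq_left (by linarith)]
      have hpos : 0 < |u x| := hM.trans hx
      have e1 : |u x| ^ (2 : ℕ) = |u x| ^ (2 - q) * |u x| ^ q := by
        rw [← Real.rpow_add hpos, ← Real.rpow_natCast]; congr 1; push_cast; ring
      calc (|u x| - M) ^ 2 ≤ |u x| ^ 2 := by
            refine pow_le_pow_left₀ (by linarith) (by linarith) 2
        _ = |u x| ^ (2 - q) * |u x| ^ q := e1
        _ ≤ M ^ (2 - q) * |u x| ^ q := by
            refine mul_le_mul_of_nonneg_right ?_ (Real.rpow_nonneg hpos.le _)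
            exact Real.rpow_le_rpow_of_nonpos hM hx.le (by linarith)
  refine h1.trans (add_le_add_right (h2.trans ?_) _)
  have hN0 : 0 ≤ ∑ k ∈ s, bracket k ^ β * ‖b k‖ ^ 2 := Finset.sum_nonneg fun k _ =>
    mul_nonneg (Real.rpow_nonneg (bracket_pos k).le _) (sq_nonneg _)
  gcongr

end

section

open UnitAddTorus ComplexConjugate ProbabilityTheory

/-! ### The commutator identity and estimate -/

/-- The regularised transport form `∑ m(k) conj(c k) (k · (u c)^(k))` of a trigonometric
polynomial. -/
def transportForm (δ : ℝ) (u : Fin 2 → Torus → ℝ) (s : Finset (Fin 2 → ℤ))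
    (c : (Fin 2 → ℤ) → ℂ) : ℂ :=
  ∑ k ∈ s, ∑ l ∈ s, conj (c k) * c l *
    (gaussWeight δ k * ∑ i, (k i : ℂ) * fourierCoeffR (u i) (k - l))

/-- The Fourier coefficients of `g - g(· - h)`. -/
def diffCoeff (c : (Fin 2 → ℤ) → ℂ) (h : Torus) (k : Fin 2 → ℤ) : ℂ :=
  c k * (1 - conj (mFourier k h))

lemma continuous_proj : Continuous proj := by
  unfold proj
  exact continuous_pi fun i => (AddCircle.continuous_mk' 1).comp (continuous_apply i)

lemma integrable_mul_mFourier_gauss2 (δ : ℝ) (k : Fin 2 → ℤ) (i : Fin 2) :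
    Integrable (fun y : Fin 2 → ℝ => (y i : ℂ) * mFourier k (proj (δ • y))) gauss2 := by
  have h1 : Integrable (fun y : Fin 2 → ℝ => (y i : ℂ)) gauss2 := by
    have := integrable_norm_gauss2_pow 1 i
    refine Integrable.mono this (Complex.continuous_ofReal.comp
      (continuous_apply i)).aestronglyMeasurable (Filter.Eventually.of_forall fun y => by simp)
  refine h1.mul_bdd (c := 1) ?_ (Filter.Eventually.of_forall fun y => (norm_mFourier_apply _ _).le)
  exact ((mFourier k).continuous.comp
    (continuous_proj.comp (continuous_const_smul δ))).aestronglyMeasurable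

/-- The product of the two increments expands into the characters `0`, `k`, `-l` and `k - l`, whose
first Gaussian moments are known; the one of frequency `0` vanishes. -/
lemma integral_mul_diff_gauss2 (δ : ℝ) (k l : Fin 2 → ℤ) (i : Fin 2) :
    Integrable (fun y : Fin 2 → ℝ => (y i : ℂ) *
      ((1 - mFourier k (proj (δ • y))) * (1 - conj (mFourier l (proj (δ • y)))))) gauss2 ∧
    ∫ y : Fin 2 → ℝ, (y i : ℂ) * ((1 - mFourier k (proj (δ • y)))
        * (1 - conj (mFourier l (proj (δ • y))))) ∂gauss2
      = -(2 * Real.pi * Complex.I * δ) * (k i * gaussWeight δ k - l i * gaussWeight δ l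
        - (k - l) i * gaussWeight δ (k - l)) := by
  have e : ∀ y : Fin 2 → ℝ, (y i : ℂ) * ((1 - mFourier k (proj (δ • y)))
        * (1 - conj (mFourier l (proj (δ • y)))))
      = (y i : ℂ) * mFourier 0 (proj (δ • y)) - (y i : ℂ) * mFourier k (proj (δ • y))
        - (y i : ℂ) * mFourier (-l) (proj (δ • y))
        + (y i : ℂ) * mFourier (k - l) (proj (δ • y)) := by
    intro y
    rw [sub_eq_add_neg k l, mFourier_add, mFourier_zero, mFourier_neg]
    simp only [ContinuousMap.one_apply]
    ring
  have hI := fun k => integrable_mul_mFourier_gauss2 δ k i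
  simp only [e]
  refine ⟨(((hI 0).sub (hI k)).sub (hI (-l))).add (hI (k - l)), ?_⟩
  have e1 : Integrable (fun y : Fin 2 → ℝ => (y i : ℂ) * mFourier 0 (proj (δ • y))
      - (y i : ℂ) * mFourier k (proj (δ • y))) gauss2 := (hI 0).sub (hI k)
  have e2 : Integrable (fun y : Fin 2 → ℝ => (y i : ℂ) * mFourier 0 (proj (δ • y))
      - (y i : ℂ) * mFourier k (proj (δ • y)) - (y i : ℂ) * mFourier (-l) (proj (δ • y)))
      gauss2 := e1.sub (hI (-l))
  rw [integral_add e2 (hI (k - l)), integral_sub e1 (hI (-l)), integral_sub (hI 0) (hI k)]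
  simp only [integral_mul_mFourier_gauss2]
  have hw : gaussWeight δ (-l) = gaussWeight δ l := by simp [gaussWeight, freqNorm_neg]
  simp only [hw, Pi.zero_apply, Pi.neg_apply]
  push_cast; ring

/-- As `u` is real and divergence free, exchanging `k` and `l` conjugates the form and replaces the
weight `m(k)` by `m(l)`, where `m` is the Gaussian multiplier. Only the commutator `(m(k) - m(l))
k·û(k - l)` therefore enters the real part. The same commutator arises on averaging the increments
`g - g(· - δy)` against `y`: in `integral_mul_diff_gauss2` the term with `k - l` is killed by the
divergence condition, and in the term with `l` the factor `l·û(k - l)` equals `k·û(k - l)`. -/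
lemma re_transportForm_eq {δ : ℝ} (hδ : 0 < δ) {u : Fin 2 → Torus → ℝ}
    (hu : ∀ i, Integrable (u i) torusMeasure)
    (hdiv : ∀ k : Fin 2 → ℤ, ∑ i, (k i : ℂ) * fourierCoeffR (u i) k = 0)
    (s : Finset (Fin 2 → ℤ)) (c : (Fin 2 → ℤ) → ℂ) :
    (2 * Real.pi * Complex.I * transportForm δ u s c).re
      = -(1 / (2 * δ)) * ∑ i, ∫ y : Fin 2 → ℝ, y i *
        (∫ x, u i x * ‖trigPoly s (diffCoeff c (proj (δ • y))) x‖ ^ 2 ∂torusMeasure) ∂gauss2 := by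
  have hinner : ∀ (i : Fin 2),
      ((∫ y : Fin 2 → ℝ, y i *
        (∫ x, u i x * ‖trigPoly s (diffCoeff c (proj (δ • y))) x‖ ^ 2 ∂torusMeasure) ∂gauss2 : ℝ) : ℂ)
      = ∑ k ∈ s, ∑ l ∈ s, conj (c k) * c l * fourierCoeffR (u i) (k - l) *
        (-(2 * Real.pi * Complex.I * δ) * (k i * gaussWeight δ k - l i * gaussWeight δ l
        - (k - l) i * gaussWeight δ (k - l))) := by
    intro i
    rw [← integral_complex_ofReal]
    have e : ∀ y : Fin 2 → ℝ, ((y i *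
        (∫ x, u i x * ‖trigPoly s (diffCoeff c (proj (δ • y))) x‖ ^ 2 ∂torusMeasure) : ℝ) : ℂ)
        = ∑ k ∈ s, ∑ l ∈ s, conj (c k) * c l * fourierCoeffR (u i) (k - l) * ((y i : ℂ) *
      ((1 - mFourier k (proj (δ • y))) * (1 - conj (mFourier l (proj (δ • y)))))) := by
      intro y
      rw [Complex.ofReal_mul, integral_mul_norm_sq_trigPoly (hu i), Finset.mul_sum]
      refine Finset.sum_congr rfl fun k _ => ?_
      rw [Finset.mul_sum]
      refine Finset.sum_congr rfl fun l _ => ?_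
      simp only [diffCoeff, map_mul, map_sub, map_one, Complex.conj_conj]
      ring
    simp only [e]
    rw [integral_finsetSum _ fun k _ => integrable_finsetSum _ fun l _ =>
      (integral_mul_diff_gauss2 δ k l i).1.const_mul _]
    refine Finset.sum_congr rfl fun k _ => ?_
    rw [integral_finsetSum _ fun l _ => (integral_mul_diff_gauss2 δ k l i).1.const_mul _]
    refine Finset.sum_congr rfl fun l _ => ?_
    rw [integral_const_mul, (integral_mul_diff_gauss2 δ k l i).2]
  set X := transportForm δ u s c with hX
  have hswap : ∀ k l : Fin 2 → ℤ, ∑ i, (k i : ℂ) * fourierCoeffR (u i) (k - l)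
      = ∑ i, (l i : ℂ) * fourierCoeffR (u i) (k - l) := by
    intro k l
    rw [← sub_eq_zero, ← Finset.sum_sub_distrib, ← hdiv (k - l)]
    refine Finset.sum_congr rfl fun i _ => ?_
    simp only [Pi.sub_apply]; push_cast; ring
  have hY : ∑ k ∈ s, ∑ l ∈ s, conj (c k) * c l *
      (gaussWeight δ l * ∑ i, (k i : ℂ) * fourierCoeffR (u i) (k - l)) = conj X := by
    rw [hX, transportForm, map_sum, Finset.sum_comm]
    refine Finset.sum_congr rfl fun l _ => ?_
    rw [map_sum]
    refine Finset.sum_congr rfl fun k _ => ?_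
    rw [hswap]
    simp only [map_mul, map_sum, Complex.conj_conj, Complex.conj_ofReal, ← fourierCoeffR_neg,
      neg_sub, map_intCast]
    ring
  have hsum : ((∑ i, ∫ y : Fin 2 → ℝ, y i *
        (∫ x, u i x * ‖trigPoly s (diffCoeff c (proj (δ • y))) x‖ ^ 2 ∂torusMeasure) ∂gauss2 : ℝ) : ℂ)
      = -(2 * Real.pi * Complex.I * δ) * (X - conj X) := by
    rw [Complex.ofReal_sum]
    simp only [hinner]
    rw [← hY, hX, transportForm, ← Finset.sum_sub_distrib, Finset.mul_sum, Finset.sum_comm]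
    refine Finset.sum_congr rfl fun k _ => ?_
    rw [Finset.sum_comm, ← Finset.sum_sub_distrib, Finset.mul_sum]
    refine Finset.sum_congr rfl fun l _ => ?_
    have h1 := hswap k l
    have h2 := hdiv (k - l)
    simp only [Fin.sum_univ_two] at h1 h2 ⊢
    linear_combination (-(conj (c k) * c l * (2 * Real.pi * Complex.I * δ) * gaussWeight δ l)) * h1
      + (conj (c k) * c l * (2 * Real.pi * Complex.I * δ) * gaussWeight δ (k - l)) * h2
  have h3 : -(2 * Real.pi * Complex.I * δ) * (X - conj X) = ((4 * Real.pi * δ * X.im : ℝ) : ℂ) := by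
    rw [Complex.sub_conj]; push_cast
    linear_combination (-4 * Real.pi * δ * X.im) * Complex.I_mul_I
  rw [h3] at hsum
  rw [Complex.ofReal_injective hsum]
  simp [Complex.mul_re, Complex.mul_im]
  field_simp
  ring

/-- Interpolation between `|e^{ix} - 1| ≤ 2` and `|e^{ix} - 1| ≤ |x|`: the increment of a character
is traded for a fractional power of `δ|k|`. -/
lemma norm_one_sub_mFourier_sq_le {a : ℝ} (ha : 0 ≤ a) (ha' : a ≤ 1) {δ : ℝ} (hδ : 0 < δ)
    (k : Fin 2 → ℤ) (y : Fin 2 → ℝ) :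
    ‖1 - conj (mFourier k (proj (δ • y)))‖ ^ 2
      ≤ 16 * Real.pi ^ 2 * (1 + |y 0| + |y 1|) ^ 2 * δ ^ (2 * a) * freqNorm k ^ (2 * a) := by
  set Y := 1 + |y 0| + |y 1| with hYdef
  have hY : 1 ≤ Y := by have := abs_nonneg (y 0); have := abs_nonneg (y 1); linarith
  have hk := freqNorm_nonneg k
  set z := mFourier k (proj (δ • y)) with hz
  have h0 : ‖1 - conj z‖ = ‖z - 1‖ := by
    rw [← RCLike.norm_conj, map_sub, map_one, Complex.conj_conj, norm_sub_rev]
  have h2 : ‖z - 1‖ ≤ 2 := by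
    refine (norm_sub_le _ _).trans ?_
    rw [hz, norm_mFourier_apply, norm_one]; norm_num
  set t := 2 * Real.pi * δ * freqNorm k * Y with ht
  have ht0 : 0 ≤ t := by positivity
  have h1 : ‖z - 1‖ ≤ t := by
    rw [hz, mFourier_proj]
    refine (Real.norm_exp_I_mul_ofReal_sub_one_le (x := 2 * Real.pi * (k 0 * (δ • y) 0 + k 1 * (δ • y) 1)) |>.trans' ?_).trans ?_
    · rw [mul_comm Complex.I]
    · simp only [Pi.smul_apply, smul_eq_mul, Real.norm_eq_abs]
      rw [show 2 * Real.pi * ((k 0 : ℝ) * (δ * y 0) + k 1 * (δ * y 1))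
        = 2 * Real.pi * δ * (k 0 * y 0 + k 1 * y 1) by ring, abs_mul,
        abs_of_pos (by positivity : 0 < 2 * Real.pi * δ), ht, mul_assoc (2 * Real.pi * δ)]
      refine mul_le_mul_of_nonneg_left ?_ (by positivity)
      calc |(k 0 : ℝ) * y 0 + k 1 * y 1| ≤ |(k 0 : ℝ)| * |y 0| + |(k 1 : ℝ)| * |y 1| := by
            rw [← abs_mul, ← abs_mul]; exact abs_add_le _ _
        _ ≤ freqNorm k * |y 0| + freqNorm k * |y 1| := by
            gcongr <;> exact abs_le_freqNorm k _
        _ ≤ freqNorm k * Y := by rw [hYdef]; nlinarith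
  have h3 : ‖z - 1‖ ^ 2 ≤ 4 * t ^ (2 * a) := by
    rcases le_or_gt 1 t with h | h
    · have : 1 ≤ t ^ (2 * a) := Real.one_le_rpow h (by linarith)
      nlinarith [norm_nonneg (z - 1)]
    · have e : t ^ (2 : ℕ) ≤ t ^ (2 * a) := by
        rw [← Real.rpow_natCast]
        exact Real.rpow_le_rpow_of_exponent_ge' ht0 h.le (by linarith) (by push_cast; linarith)
      have e0 : 0 ≤ t ^ (2 * a) := Real.rpow_nonneg ht0 _
      nlinarith [norm_nonneg (z - 1)]
  rw [h0]
  refine h3.trans ?_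
  have e1 : t ^ (2 * a) = (2 * Real.pi) ^ (2 * a) * δ ^ (2 * a) * freqNorm k ^ (2 * a)
      * Y ^ (2 * a) := by
    rw [ht, Real.mul_rpow (by positivity) (by linarith), Real.mul_rpow (by positivity) hk,
      Real.mul_rpow (by positivity) hδ.le]
  have e2 : (2 * Real.pi) ^ (2 * a) ≤ (2 * Real.pi) ^ 2 := by
    rw [← Real.rpow_natCast]
    exact Real.rpow_le_rpow_of_exponent_le (by nlinarith [Real.pi_gt_three])
      (by push_cast; linarith)
  have e3 : Y ^ (2 * a) ≤ Y ^ 2 := by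
    rw [← Real.rpow_natCast]
    exact Real.rpow_le_rpow_of_exponent_le hY (by push_cast; linarith)
  have p1 : 0 ≤ δ ^ (2 * a) := Real.rpow_nonneg hδ.le _
  have p2 : 0 ≤ freqNorm k ^ (2 * a) := Real.rpow_nonneg hk _
  rw [e1]
  calc 4 * ((2 * Real.pi) ^ (2 * a) * δ ^ (2 * a) * freqNorm k ^ (2 * a) * Y ^ (2 * a))
      ≤ 4 * ((2 * Real.pi) ^ 2 * δ ^ (2 * a) * freqNorm k ^ (2 * a) * Y ^ 2) := by gcongr
    _ = _ := by ring

/-- Increments at scale `δ` of a function in `H^α` have size `δ^{α-β}` in `H^β`. It is used with `β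
= 0` for the bounded part of the drift and with `β` slightly above `1/2` for the rest. -/
lemma sum_bracket_mul_diffCoeff_le {α β : ℝ} (hβ : 0 ≤ β) (hβα : β ≤ α) (hα : α ≤ 1)
    {δ : ℝ} (hδ : 0 < δ) (s : Finset (Fin 2 → ℤ)) (c : (Fin 2 → ℤ) → ℂ) (y : Fin 2 → ℝ) :
    ∑ k ∈ s, bracket k ^ β * ‖diffCoeff c (proj (δ • y)) k‖ ^ 2
      ≤ 16 * Real.pi ^ 2 * (1 + |y 0| + |y 1|) ^ 2 * δ ^ (2 * (α - β))
        * ∑ k ∈ s, bracket k ^ α * ‖c k‖ ^ 2 := by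
  rw [Finset.mul_sum]
  refine Finset.sum_le_sum fun k _ => ?_
  rw [diffCoeff, norm_mul, mul_pow]
  have h1 := norm_one_sub_mFourier_sq_le (a := α - β) (by linarith) (by linarith) hδ k y
  have h2 : freqNorm k ^ (2 * (α - β)) ≤ bracket k ^ (α - β) := by
    rw [Real.rpow_mul (freqNorm_nonneg k)]
    exact Real.rpow_le_rpow (Real.rpow_nonneg (freqNorm_nonneg k) _)
      (by exact_mod_cast freqNorm_sq_le_bracket k) (by linarith)
  have h3 : bracket k ^ β * bracket k ^ (α - β) = bracket k ^ α := by
    rw [← Real.rpow_add (bracket_pos k)]; congr 1; ring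
  have p1 : 0 ≤ bracket k ^ β := Real.rpow_nonneg (bracket_pos k).le _
  have p2 : 0 ≤ δ ^ (2 * (α - β)) := Real.rpow_nonneg hδ.le _
  rw [← h3]
  calc bracket k ^ β * (‖c k‖ ^ 2 * ‖1 - conj (mFourier k (proj (δ • y)))‖ ^ 2)
      ≤ bracket k ^ β * (‖c k‖ ^ 2 * (16 * Real.pi ^ 2 * (1 + |y 0| + |y 1|) ^ 2
          * δ ^ (2 * (α - β)) * bracket k ^ (α - β))) := by
        gcongr
        exact h1.trans (by gcongr)
    _ = _ := by ring

/-- The commutator estimate: the transport form of a divergence free field in `L^q`,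
`1/q < α - 1/2`, tends to zero with the regularisation parameter, uniformly for bounded `H^α`
norm. -/
lemma exists_transportForm_le {α q : ℝ} (hα : 1 / 2 < α) (hα' : α < 1) (hq : 0 < 1 / q)
    (hq' : 1 / q < α - 1 / 2) : ∃ κ C : ℝ, 0 < κ ∧ 0 ≤ C ∧ ∀ δ : ℝ, 0 < δ → δ ≤ 1 →
    ∀ u : Fin 2 → Torus → ℝ, (∀ i, MemLp (u i) (ENNReal.ofReal q) torusMeasure) →
    (∀ k : Fin 2 → ℤ, ∑ i, (k i : ℂ) * fourierCoeffR (u i) k = 0) →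
    ∀ (s : Finset (Fin 2 → ℤ)) (c : (Fin 2 → ℤ) → ℂ),
    |(2 * Real.pi * Complex.I * transportForm δ u s c).re|
      ≤ C * δ ^ κ * (1 + ∑ i, Real.sqrt (∫ x, |u i x| ^ q ∂torusMeasure))
        * ∑ k ∈ s, bracket k ^ α * ‖c k‖ ^ 2 := by
  have hq0 : 0 < q := by simpa using hq
  have hgap : 0 < (2 * α - 1) * (q / 2) - 1 := by
    rw [div_lt_iff₀ hq0] at hq'; linarith
  have hq2 : 2 ≤ q := by nlinarith
  set g := (2 * α - 1) * (q / 2) - 1 with hg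
  -- The number `g` is the power of `δ` gained in the limiting case `β = 1/2`, `μ = 2α - 1`; its
  -- positivity is the hypothesis `1/q < α - 1/2`. Moving both parameters by `τ` costs at most half
  -- of `g`, and `τ ≤ (2α - 1)/2` keeps `β ≤ α`.
  obtain ⟨τ, hτ0, hτ1, hτ2⟩ : ∃ τ : ℝ, 0 < τ ∧ τ * (q / 2 + 1) ≤ g / 2 ∧ τ ≤ (2 * α - 1) / 2 := by
    refine ⟨min (g / 2 / (q / 2 + 1)) ((2 * α - 1) / 2), by
      refine lt_min (by positivity) (by linarith), ?_, min_le_right _ _⟩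
    rw [← le_div_iff₀ (by positivity)]
    exact min_le_left _ _
  set β := 1 / 2 + τ with hβ
  set μ := 2 * α - 1 - τ with hμ
  set κ := min τ (g / 2) with hκ
  set S := Real.sqrt (∑' k, bracket k ^ (-(2 * β))) with hS
  set W := ∫ y : Fin 2 → ℝ, (1 + |y 0| + |y 1|) ^ 3 ∂gauss2 with hW
  have hW0 : 0 ≤ W := integral_nonneg fun y => by positivity
  have hS0 : 0 ≤ S := Real.sqrt_nonneg _
  refine ⟨κ, 8 * Real.pi ^ 2 * W * (2 + S), lt_min hτ0 (by linarith), by positivity, ?_⟩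
  intro δ hδ hδ1 u hu hdiv s c
  set N := ∑ k ∈ s, bracket k ^ α * ‖c k‖ ^ 2 with hN
  have hN0 : 0 ≤ N := Finset.sum_nonneg fun k _ =>
    mul_nonneg (Real.rpow_nonneg (bracket_pos k).le _) (sq_nonneg _)
  have hui : ∀ i, Integrable (u i) torusMeasure := fun i =>
    (hu i).integrable (by rw [ENNReal.one_le_ofReal]; linarith)
  set R : Fin 2 → ℝ := fun i => Real.sqrt (∫ x, |u i x| ^ q ∂torusMeasure) with hR
  have hR0 : ∀ i, 0 ≤ R i := fun i => Real.sqrt_nonneg _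
  have hpt : ∀ (i : Fin 2) (y : Fin 2 → ℝ), |∫ x, u i x *
      ‖trigPoly s (diffCoeff c (proj (δ • y))) x‖ ^ 2 ∂torusMeasure|
      ≤ 16 * Real.pi ^ 2 * δ ^ (1 + κ) * (1 + S * R i) * N * (1 + |y 0| + |y 1|) ^ 2 := by
    intro i y
    set b := diffCoeff c (proj (δ • y)) with hb
    have h1 : |∫ x, u i x * ‖trigPoly s b x‖ ^ 2 ∂torusMeasure|
        ≤ ∫ x, |u i x| * ‖trigPoly s b x‖ ^ 2 ∂torusMeasure := by
      refine (abs_integral_le_integral_abs).trans_eq (integral_congr_ae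
        (Filter.Eventually.of_forall fun x => ?_))
      simp only [abs_mul, abs_of_nonneg (sq_nonneg ‖trigPoly s b x‖)]
    -- The drift is split at height `δ^(-μ)`. The bounded part contributes the exponent `2α - μ = 1
    -- + τ` and the unbounded part `1 + g - τ(q/2 + 1) ≥ 1 + g/2`. Both are at least `1 + κ`, and
    -- the prefactor `1/(2δ)` uses up the `1`.
    have hM : 0 < δ ^ (-μ) := Real.rpow_pos_of_pos hδ _
    have h2 := integral_abs_mul_norm_sq_trigPoly_le (β := β) (q := q) (by linarith) hq2 hM (hu i) s b
    have h3 := sum_bracket_mul_diffCoeff_le (β := 0) le_rfl (by linarith) hα'.le hδ s c y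
    have h4 := sum_bracket_mul_diffCoeff_le (α := α) (β := β) (by linarith) (by linarith) hα'.le
      hδ s c y
    simp only [Real.rpow_zero, one_mul, sub_zero] at h3
    refine h1.trans (h2.trans ?_)
    set Y := (1 + |y 0| + |y 1|) ^ 2 with hYd
    have hY0 : 0 ≤ Y := sq_nonneg _
    have x1 : δ ^ (-μ) * δ ^ (2 * α) ≤ δ ^ (1 + κ) := by
      rw [← Real.rpow_add hδ]
      refine Real.rpow_le_rpow_of_exponent_ge hδ hδ1 ?_
      have := min_le_left τ (g / 2)
      rw [hμ]; linarith
    have x2 : (δ ^ (-μ)) ^ (1 - q / 2) * δ ^ (2 * (α - β)) ≤ δ ^ (1 + κ) := by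
      rw [← Real.rpow_mul hδ.le, ← Real.rpow_add hδ]
      refine Real.rpow_le_rpow_of_exponent_ge hδ hδ1 ?_
      have := min_le_right τ (g / 2)
      have e : -μ * (1 - q / 2) + 2 * (α - β) = 1 + (g - τ * (q / 2 + 1)) := by
        rw [hμ, hβ, hg]; ring
      rw [e]; linarith
    have y1 : δ ^ (-μ) * ∑ k ∈ s, ‖b k‖ ^ 2 ≤ 16 * Real.pi ^ 2 * Y * N * δ ^ (1 + κ) := by
      calc _ ≤ δ ^ (-μ) * (16 * Real.pi ^ 2 * Y * δ ^ (2 * α) * N) := by gcongr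
        _ = 16 * Real.pi ^ 2 * Y * N * (δ ^ (-μ) * δ ^ (2 * α)) := by ring
        _ ≤ _ := by gcongr
    have y2 : S * ((δ ^ (-μ)) ^ (1 - q / 2) * R i) * ∑ k ∈ s, bracket k ^ β * ‖b k‖ ^ 2
        ≤ S * R i * (16 * Real.pi ^ 2 * Y * N * δ ^ (1 + κ)) := by
      have p : 0 ≤ (δ ^ (-μ)) ^ (1 - q / 2) := Real.rpow_nonneg hM.le _
      have := hR0 i
      calc _ ≤ S * ((δ ^ (-μ)) ^ (1 - q / 2) * R i) *
            (16 * Real.pi ^ 2 * Y * δ ^ (2 * (α - β)) * N) := by gcongr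
        _ = S * R i * (16 * Real.pi ^ 2 * Y * N * ((δ ^ (-μ)) ^ (1 - q / 2) * δ ^ (2 * (α - β)))) := by
            ring
        _ ≤ _ := by gcongr
    refine (add_le_add y1 y2).trans_eq ?_
    ring
  have hint : ∀ i : Fin 2, |∫ y : Fin 2 → ℝ, y i *
        (∫ x, u i x * ‖trigPoly s (diffCoeff c (proj (δ • y))) x‖ ^ 2 ∂torusMeasure) ∂gauss2|
      ≤ 16 * Real.pi ^ 2 * δ ^ (1 + κ) * (1 + S * R i) * N * W := by
    intro i
    have hp := hR0 i
    rw [hW, ← integral_const_mul, ← Real.norm_eq_abs]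
    refine norm_integral_le_of_norm_le (integrable_gauss2_moment.const_mul _)
      (Filter.Eventually.of_forall fun y => ?_)
    rw [norm_mul, Real.norm_eq_abs, Real.norm_eq_abs]
    have hy : |y i| ≤ 1 + |y 0| + |y 1| := by
      have := abs_nonneg (y 0); have := abs_nonneg (y 1)
      obtain rfl | rfl : i = 0 ∨ i = 1 := by omega
      all_goals linarith
    calc _ ≤ (1 + |y 0| + |y 1|) * (16 * Real.pi ^ 2 * δ ^ (1 + κ) * (1 + S * R i) * N
          * (1 + |y 0| + |y 1|) ^ 2) := mul_le_mul hy (hpt i y) (abs_nonneg _) (by positivity)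
      _ = _ := by ring
  rw [re_transportForm_eq hδ hui hdiv, abs_mul, abs_neg, abs_of_pos (by positivity)]
  have hsum : |∑ i, ∫ y : Fin 2 → ℝ, y i *
        (∫ x, u i x * ‖trigPoly s (diffCoeff c (proj (δ • y))) x‖ ^ 2 ∂torusMeasure) ∂gauss2|
      ≤ 16 * Real.pi ^ 2 * δ ^ (1 + κ) * (2 + S * ∑ i, R i) * N * W := by
    refine (Finset.abs_sum_le_sum_abs _ _).trans ((Finset.sum_le_sum fun i _ => hint i).trans_eq ?_)
    simp only [Fin.sum_univ_two]; ring
  have hRs : 0 ≤ ∑ i, R i := Finset.sum_nonneg fun i _ => hR0 i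
  have hδκ : 0 ≤ δ ^ κ := Real.rpow_nonneg hδ.le _
  calc _ ≤ 1 / (2 * δ) * (16 * Real.pi ^ 2 * δ ^ (1 + κ) * (2 + S * ∑ i, R i) * N * W) := by gcongr
    _ = 8 * Real.pi ^ 2 * W * (2 + S * ∑ i, R i) * δ ^ κ * N := by
        rw [Real.rpow_add hδ, Real.rpow_one]; field_simp; ring
    _ ≤ 8 * Real.pi ^ 2 * W * ((2 + S) * (1 + ∑ i, R i)) * δ ^ κ * N := by
        gcongr; nlinarith
    _ = _ := by ring

end

section

open UnitAddTorus ComplexConjugate Filter Topology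

/-! ### The drift operator and the advection form on `L²` -/

section Drift

variable {K : Torus → ℝ} (hK : IsAdmissibleKernel K)

/-- The drift operator `ℛ` on `L²`. -/
def drift (θ : L2) : Fin 2 → L2 := (hK.exists_isDrift θ).choose

lemma isDrift_drift (θ : L2) : IsDrift K θ (fun i => drift hK θ i) :=
  (hK.exists_isDrift θ).choose_spec

lemma fourierCoeffR_drift (θ : L2) (i : Fin 2) (k : Fin 2 → ℤ) :
    fourierCoeffR (drift hK θ i) k = driftSymbol K i k * fourierCoeffR θ k :=
  (isDrift_drift hK θ).fourierCoeffR hK.integrable θ.integrable i k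

lemma IsDrift.eq_drift {θ : L2} {u : Fin 2 → L2} (h : IsDrift K θ (fun i => u i)) (i : Fin 2) :
    u i = drift hK θ i := by
  refine L2.ext_fourier fun k => ?_
  rw [fourierCoeffR_drift, h.fourierCoeffR hK.integrable θ.integrable i k]

lemma drift_add (a b : L2) (i : Fin 2) : drift hK (a + b) i = drift hK a i + drift hK b i := by
  refine L2.ext_fourier fun k => ?_
  simp only [L2.fourierCoeffR_add, fourierCoeffR_drift]; ring

lemma drift_smul (c : ℝ) (a : L2) (i : Fin 2) : drift hK (c • a) i = c • drift hK a i := by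
  refine L2.ext_fourier fun k => ?_
  simp only [L2.fourierCoeffR_smul, fourierCoeffR_drift]; ring

lemma drift_divergence (θ : L2) (k : Fin 2 → ℤ) :
    ∑ i, (k i : ℂ) * fourierCoeffR (drift hK θ i) k = 0 := by
  have := driftSymbol_divergence K k
  simp only [fourierCoeffR_drift, ← mul_assoc, ← Finset.sum_mul, this, zero_mul]

/-- A bound for the operator norm of `ℛ` on `L²`. -/
def driftBound : ℝ := hK.exists_driftSymbol_le.choose

lemma driftBound_nonneg : 0 ≤ driftBound hK := hK.exists_driftSymbol_le.choose_spec.1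

lemma norm_drift_le (θ : L2) (i : Fin 2) : ‖drift hK θ i‖ ≤ driftBound hK * ‖θ‖ := by
  have h0 := driftBound_nonneg hK
  have h1 := L2.hasSum_sq (drift hK θ i)
  have h2 := (L2.hasSum_sq θ).mul_left (driftBound hK ^ 2)
  refine le_of_sq_le_sq ?_ (mul_nonneg h0 (norm_nonneg _))
  rw [mul_pow]
  refine hasSum_le (fun k => ?_) h1 h2
  rw [fourierCoeffR_drift, norm_mul, mul_pow]
  gcongr
  exact hK.exists_driftSymbol_le.choose_spec.2 i k

/-- The Fourier coefficients of `ℛ a · ∇ b = div (b ℛ a)`. -/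
def adv (a b : L2) (k : Fin 2 → ℤ) : ℂ :=
  2 * Real.pi * Complex.I * ∑ i, (k i : ℂ) * fourierCoeffR (fun x => drift hK a i x * b x) k

lemma L2.fourierCoeffR_mul_add_left (u u' a : L2) (k : Fin 2 → ℤ) :
    fourierCoeffR (fun x => (u + u' : L2) x * a x) k
      = fourierCoeffR (fun x => u x * a x) k + fourierCoeffR (fun x => u' x * a x) k := by
  rw [← ActiveScalar.fourierCoeffR_add (u.integrable_mul a) (u'.integrable_mul a)]
  refine fourierCoeffR_congr_ae ?_ k
  filter_upwards [Lp.coeFn_add u u'] with x hx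
  rw [hx, Pi.add_apply, add_mul]

lemma L2.fourierCoeffR_mul_comm (u a : L2) (k : Fin 2 → ℤ) :
    fourierCoeffR (fun x => u x * a x) k = fourierCoeffR (fun x => a x * u x) k := by
  simp only [mul_comm]

lemma L2.fourierCoeffR_mul_add_right (u a a' : L2) (k : Fin 2 → ℤ) :
    fourierCoeffR (fun x => u x * (a + a' : L2) x) k
      = fourierCoeffR (fun x => u x * a x) k + fourierCoeffR (fun x => u x * a' x) k := by
  rw [L2.fourierCoeffR_mul_comm, L2.fourierCoeffR_mul_add_left, L2.fourierCoeffR_mul_comm a,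
    L2.fourierCoeffR_mul_comm a']

lemma L2.fourierCoeffR_mul_smul_left (c : ℝ) (u a : L2) (k : Fin 2 → ℤ) :
    fourierCoeffR (fun x => (c • u : L2) x * a x) k = c * fourierCoeffR (fun x => u x * a x) k := by
  rw [← fourierCoeffR_const_mul]
  refine fourierCoeffR_congr_ae ?_ k
  filter_upwards [Lp.coeFn_smul c u] with x hx
  rw [hx, Pi.smul_apply, smul_eq_mul, mul_assoc]

lemma L2.fourierCoeffR_mul_smul_right (c : ℝ) (u a : L2) (k : Fin 2 → ℤ) :
    fourierCoeffR (fun x => u x * (c • a : L2) x) k = c * fourierCoeffR (fun x => u x * a x) k := by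
  rw [L2.fourierCoeffR_mul_comm, L2.fourierCoeffR_mul_smul_left, L2.fourierCoeffR_mul_comm a]

lemma adv_add_left (a a' b : L2) (k : Fin 2 → ℤ) :
    adv hK (a + a') b k = adv hK a b k + adv hK a' b k := by
  simp only [adv, drift_add, L2.fourierCoeffR_mul_add_left, mul_add, Finset.sum_add_distrib]

lemma adv_add_right (a b b' : L2) (k : Fin 2 → ℤ) :
    adv hK a (b + b') k = adv hK a b k + adv hK a b' k := by
  simp only [adv, L2.fourierCoeffR_mul_add_right, mul_add, Finset.sum_add_distrib]

lemma adv_smul_left (c : ℝ) (a b : L2) (k : Fin 2 → ℤ) :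
    adv hK (c • a) b k = c * adv hK a b k := by
  simp only [adv, drift_smul, L2.fourierCoeffR_mul_smul_left, Fin.sum_univ_two]; ring

lemma adv_smul_right (c : ℝ) (a b : L2) (k : Fin 2 → ℤ) :
    adv hK a (c • b) k = c * adv hK a b k := by
  simp only [adv, L2.fourierCoeffR_mul_smul_right, Fin.sum_univ_two]; ring

lemma norm_two_pi_I : ‖(2 * Real.pi * Complex.I : ℂ)‖ = 2 * Real.pi := by
  simp [abs_of_pos Real.pi_pos]

lemma norm_adv_le (a b : L2) (k : Fin 2 → ℤ) :
    ‖adv hK a b k‖ ≤ 4 * Real.pi * driftBound hK * freqNorm k * (‖a‖ * ‖b‖) := by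
  have h0 := driftBound_nonneg hK
  have hk := freqNorm_nonneg k
  have h1 : ∀ i, ‖(k i : ℂ) * fourierCoeffR (fun x => drift hK a i x * b x) k‖
      ≤ freqNorm k * (driftBound hK * ‖a‖ * ‖b‖) := by
    intro i
    rw [norm_mul]
    refine mul_le_mul (by simpa using abs_le_freqNorm k i) ?_ (norm_nonneg _) hk
    exact (L2.norm_fourierCoeffR_mul_le _ _ k).trans (by gcongr; exact norm_drift_le hK a i)
  rw [adv, norm_mul, norm_two_pi_I]
  calc _ ≤ 2 * Real.pi * ∑ _i : Fin 2, freqNorm k * (driftBound hK * ‖a‖ * ‖b‖) := by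
        gcongr
        exact (norm_sum_le _ _).trans (Finset.sum_le_sum fun i _ => h1 i)
    _ = _ := by simp; ring

lemma adv_neg_freq (a b : L2) (k : Fin 2 → ℤ) : adv hK a b (-k) = conj (adv hK a b k) := by
  simp only [adv, map_mul, ← fourierCoeffR_neg, Complex.conj_I, Complex.conj_ofReal,
    map_intCast, Pi.neg_apply, Fin.sum_univ_two, map_ofNat, map_add]
  push_cast; ring

/-- The advection form with fixed frequency, as a continuous bilinear map. -/
def advCLM (k : Fin 2 → ℤ) : L2 →L[ℝ] L2 →L[ℝ] ℂ :=
  LinearMap.mkContinuous₂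
    (LinearMap.mk₂ ℝ (fun a b => adv hK a b k) (fun a a' b => adv_add_left hK a a' b k)
      (fun c a b => by simp [adv_smul_left]) (fun a b b' => adv_add_right hK a b b' k)
      (fun c a b => by simp [adv_smul_right]))
    (4 * Real.pi * driftBound hK * freqNorm k)
    (fun a b => by
      rw [mul_assoc]
      exact norm_adv_le hK a b k)

lemma aestronglyMeasurable_adv {X : Type*} [MeasurableSpace X] {ν : Measure X} {a b : X → L2}
    (ha : AEStronglyMeasurable a ν) (hb : AEStronglyMeasurable b ν) (k : Fin 2 → ℤ) :
    AEStronglyMeasurable (fun t => adv hK (a t) (b t) k) ν :=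
  (advCLM hK k).aestronglyMeasurable_comp₂ ha hb

/-- The Fourier coefficient as a continuous linear functional on `L²`. -/
def coeffCLM (k : Fin 2 → ℤ) : L2 →L[ℝ] ℂ :=
  LinearMap.mkContinuous
    { toFun := fun g => fourierCoeffR g k
      map_add' := fun g h => L2.fourierCoeffR_add g h k
      map_smul' := fun c g => by simp }
    1 (fun g => by rw [one_mul]; exact L2.norm_fourierCoeffR_le g k)

lemma aestronglyMeasurable_coeff {X : Type*} [MeasurableSpace X] {ν : Measure X} {a : X → L2}
    (ha : AEStronglyMeasurable a ν) (k : Fin 2 → ℤ) :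
    AEStronglyMeasurable (fun t => fourierCoeffR (a t) k) ν :=
  (coeffCLM k).continuous.comp_aestronglyMeasurable ha

/-- Advection of a field with absolutely summable gradient is bounded on `L²`. -/
lemma sum_sq_adv_le (a b : L2) {P : ℝ} (hb : Summable fun l => freqNorm l * ‖fourierCoeffR b l‖)
    (hP : ∑' l, freqNorm l * ‖fourierCoeffR b l‖ ≤ P) (F : Finset (Fin 2 → ℤ)) :
    ∑ k ∈ F, ‖adv hK a b k‖ ^ 2 ≤ (4 * Real.pi * driftBound hK * P * ‖a‖) ^ 2 := by
  have h0 := driftBound_nonneg hK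
  set p : (Fin 2 → ℤ) → ℝ := fun l => freqNorm l * ‖fourierCoeffR b l‖ with hp
  have hp0 : ∀ l, 0 ≤ p l := fun l => mul_nonneg (freqNorm_nonneg l) (norm_nonneg _)
  have hP0 : 0 ≤ P := (tsum_nonneg hp0).trans hP
  set V : (Fin 2 → ℤ) → ℝ := fun k => 2 * (driftBound hK * ‖fourierCoeffR a k‖) with hV
  have hsym : ∀ i k, ‖driftSymbol K i k‖ ≤ driftBound hK := hK.exists_driftSymbol_le.choose_spec.2
  -- The drift is divergence free, so in the convolution the factor `k` may be replaced by `l`: the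
  -- derivative falls on `b`.
  have hsum : ∀ k, HasSum (fun l => 2 * Real.pi * Complex.I * (fourierCoeffR b l *
      ∑ i, (l i : ℂ) * fourierCoeffR (drift hK a i) (k - l))) (adv hK a b k) := by
    intro k
    have h1 : ∀ i : Fin 2, HasSum (fun l => (k i : ℂ) * (fourierCoeffR (drift hK a i) (k - l)
        * fourierCoeffR b l)) ((k i : ℂ) * fourierCoeffR (fun x => drift hK a i x * b x) k) :=
      fun i => (hasSum_fourierCoeffR_mul (Lp.memLp _) (Lp.memLp b) k).mul_left _
    have h2 := (hasSum_sum fun (i : Fin 2) (_ : i ∈ Finset.univ) => h1 i).mul_left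
      (2 * Real.pi * Complex.I)
    refine h2.congr_fun fun l => ?_
    have h3 := drift_divergence hK a (k - l)
    simp only [Fin.sum_univ_two, Pi.sub_apply] at h3 ⊢
    push_cast at h3
    linear_combination (-2 * Real.pi * Complex.I * fourierCoeffR b l) * h3
  have hterm : ∀ k l, ‖2 * Real.pi * Complex.I * (fourierCoeffR b l *
      ∑ i, (l i : ℂ) * fourierCoeffR (drift hK a i) (k - l))‖ ≤ 2 * Real.pi * (p l * V (k - l)) := by
    intro k l
    rw [norm_mul, norm_two_pi_I, norm_mul]
    have h1 : ‖∑ i, (l i : ℂ) * fourierCoeffR (drift hK a i) (k - l)‖ ≤ freqNorm l * V (k - l) := by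
      refine (norm_sum_le _ _).trans ?_
      have : ∀ i : Fin 2, ‖(l i : ℂ) * fourierCoeffR (drift hK a i) (k - l)‖
          ≤ freqNorm l * (driftBound hK * ‖fourierCoeffR a (k - l)‖) := by
        intro i
        rw [norm_mul, fourierCoeffR_drift, norm_mul]
        have := abs_le_freqNorm l i
        have h5 : ‖(l i : ℂ)‖ ≤ freqNorm l := by simpa using this
        exact mul_le_mul h5 (mul_le_mul_of_nonneg_right (hsym i _) (norm_nonneg _))
          (by positivity) (freqNorm_nonneg l)
      refine (Finset.sum_le_sum fun i _ => this i).trans_eq ?_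
      simp [hV]; ring
    calc _ ≤ 2 * Real.pi * (‖fourierCoeffR b l‖ * (freqNorm l * V (k - l))) := by gcongr
      _ = _ := by simp only [hp]; ring
  -- Young's inequality `ℓ¹ * ℓ² ⊂ ℓ²` on finite sections: Cauchy–Schwarz in `l` with weights `p l`,
  -- then Parseval for `a` in `k`. The bound does not depend on `F` or `G`.
  have hfin : ∀ G : Finset (Fin 2 → ℤ), ∑ k ∈ F, ‖∑ l ∈ G, 2 * Real.pi * Complex.I *
      (fourierCoeffR b l * ∑ i, (l i : ℂ) * fourierCoeffR (drift hK a i) (k - l))‖ ^ 2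
      ≤ (4 * Real.pi * driftBound hK * P * ‖a‖) ^ 2 := by
    intro G
    have hG : ∑ l ∈ G, p l ≤ P := (hb.sum_le_tsum G fun l _ => hp0 l).trans hP
    have hVsum : ∀ l, ∑ k ∈ F, V (k - l) ^ 2 ≤ (2 * driftBound hK * ‖a‖) ^ 2 := by
      intro l
      have h := ((Equiv.subRight l).hasSum_iff.2 (L2.hasSum_sq a)).mul_left ((2 * driftBound hK) ^ 2)
      have h' := sum_le_hasSum F (fun k _ => mul_nonneg (sq_nonneg _) (sq_nonneg _)) h
      refine le_trans (Finset.sum_le_sum fun k _ => ?_) (h'.trans_eq (by ring))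
      simp only [hV, Equiv.subRight_apply]
      exact le_of_eq (by ring)
    have hk : ∀ k, ‖∑ l ∈ G, 2 * Real.pi * Complex.I * (fourierCoeffR b l *
        ∑ i, (l i : ℂ) * fourierCoeffR (drift hK a i) (k - l))‖ ^ 2
        ≤ (2 * Real.pi) ^ 2 * (P * ∑ l ∈ G, p l * V (k - l) ^ 2) := by
      intro k
      have h1 := (norm_sum_le G _).trans ((Finset.sum_le_sum fun l _ => hterm k l).trans_eq
        (Finset.mul_sum G (fun l => p l * V (k - l)) (2 * Real.pi)).symm)
      have h2 : (∑ l ∈ G, p l * V (k - l)) ^ 2 ≤ (∑ l ∈ G, p l) * ∑ l ∈ G, p l * V (k - l) ^ 2 :=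
        Finset.sum_sq_le_sum_mul_sum_of_sq_le_mul G (fun l _ => hp0 l)
          (fun l _ => mul_nonneg (hp0 l) (sq_nonneg _)) (fun l _ => le_of_eq (by ring))
      calc _ ≤ (2 * Real.pi * ∑ l ∈ G, p l * V (k - l)) ^ 2 :=
            pow_le_pow_left₀ (norm_nonneg _) h1 2
        _ = (2 * Real.pi) ^ 2 * (∑ l ∈ G, p l * V (k - l)) ^ 2 := by ring
        _ ≤ (2 * Real.pi) ^ 2 * ((∑ l ∈ G, p l) * ∑ l ∈ G, p l * V (k - l) ^ 2) := by gcongr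
        _ ≤ _ := by
          gcongr
          exact Finset.sum_nonneg fun l _ => mul_nonneg (hp0 l) (sq_nonneg _)
    calc _ ≤ ∑ k ∈ F, (2 * Real.pi) ^ 2 * (P * ∑ l ∈ G, p l * V (k - l) ^ 2) :=
          Finset.sum_le_sum fun k _ => hk k
      _ = (2 * Real.pi) ^ 2 * (P * ∑ l ∈ G, p l * ∑ k ∈ F, V (k - l) ^ 2) := by
          rw [← Finset.mul_sum, ← Finset.mul_sum, Finset.sum_comm]
          simp only [Finset.mul_sum]
      _ ≤ (2 * Real.pi) ^ 2 * (P * ∑ l ∈ G, p l * (2 * driftBound hK * ‖a‖) ^ 2) := by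
          gcongr with l _
          · exact hp0 l
          · exact hVsum l
      _ ≤ (2 * Real.pi) ^ 2 * (P * (P * (2 * driftBound hK * ‖a‖) ^ 2)) := by
          rw [← Finset.sum_mul]; gcongr
      _ = _ := by ring
  refine le_of_tendsto (tendsto_finsetSum F fun k _ => ((hsum k).norm.pow 2)) ?_
  exact Eventually.of_forall hfin

/-- The commutator estimate for the advection of `ρ ∈ H^α` by the drift of `θ ∈ L^q`. -/
lemma exists_regularised_adv_le {α q : ℝ} (hα : 1 / 2 < α) (hα' : α < 1) (hq : 0 < 1 / q)
    (hq' : 1 / q < α - 1 / 2) : ∃ κ C : ℝ, 0 < κ ∧ 0 ≤ C ∧ ∀ δ : ℝ, 0 < δ → δ ≤ 1 →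
    ∀ θ ρ : L2, (∀ i, MemLp (drift hK θ i) (ENNReal.ofReal q) torusMeasure) →
    Summable (fun k => bracket k ^ α * ‖fourierCoeffR ρ k‖ ^ 2) →
    |∑' k, gaussWeight δ k * (conj (fourierCoeffR ρ k) * adv hK θ ρ k).re|
      ≤ C * δ ^ κ * (1 + ∑ i, Real.sqrt (∫ x, |drift hK θ i x| ^ q ∂torusMeasure))
        * ∑' k, bracket k ^ α * ‖fourierCoeffR ρ k‖ ^ 2 := by
  obtain ⟨κ, C, hκ, hC, hmain⟩ := exists_transportForm_le hα hα' hq hq'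
  refine ⟨κ, C, hκ, hC, fun δ hδ hδ1 θ ρ hu hρ => ?_⟩
  set u : Fin 2 → Torus → ℝ := fun i => drift hK θ i with hudef
  set c : (Fin 2 → ℤ) → ℂ := fun k => fourierCoeffR ρ k with hc
  -- The inner convolution and the outer sum are cut to the same finite set `s`, so that the
  -- truncated quantity is exactly the transport form of a trigonometric polynomial.
  set b : Finset (Fin 2 → ℤ) → (Fin 2 → ℤ) → ℂ := fun s k =>
    2 * Real.pi * Complex.I * ∑ i, (k i : ℂ) * ∑ l ∈ s, fourierCoeffR (u i) (k - l) * c l with hb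
  have hb1 : ∀ k, Tendsto (fun s => b s k) atTop (𝓝 (adv hK θ ρ k)) := by
    intro k
    refine Tendsto.const_mul _ (tendsto_finsetSum _ fun i _ => Tendsto.const_mul _ ?_)
    exact hasSum_fourierCoeffR_mul (Lp.memLp _) (Lp.memLp ρ) k
  set Q : ℝ := ∑ i, ‖drift hK θ i‖ * ‖ρ‖ with hQ
  have hb2 : ∀ s k, ‖b s k‖ ≤ 2 * Real.pi * (freqNorm k * Q) := by
    intro s k
    rw [hb, norm_mul, norm_two_pi_I, hQ, Finset.mul_sum]
    refine mul_le_mul_of_nonneg_left ((norm_sum_le _ _).trans (Finset.sum_le_sum fun i _ => ?_))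
      (by positivity)
    rw [norm_mul]
    refine mul_le_mul (by simpa using abs_le_freqNorm k i) ?_ (norm_nonneg _) (freqNorm_nonneg k)
    have h1 : ∑ l ∈ s, ‖fourierCoeffR (u i) (k - l)‖ ^ 2 ≤ ‖drift hK θ i‖ ^ 2 := by
      rw [← L2.integral_sq]; exact sum_sq_fourierCoeffR_sub_le (Lp.memLp _) s k
    have h2 : ∑ l ∈ s, ‖c l‖ ^ 2 ≤ ‖ρ‖ ^ 2 :=
      sum_le_hasSum s (fun _ _ => sq_nonneg _) (L2.hasSum_sq ρ)
    have h3 := Finset.sum_mul_sq_le_sq_mul_sq s (fun l => ‖fourierCoeffR (u i) (k - l)‖)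
      (fun l => ‖c l‖)
    refine (norm_sum_le _ _).trans ?_
    simp only [norm_mul]
    refine le_of_sq_le_sq (h3.trans ?_) (by positivity)
    rw [mul_pow]
    exact mul_le_mul h1 h2 (Finset.sum_nonneg fun _ _ => sq_nonneg _) (sq_nonneg _)
  set f : Finset (Fin 2 → ℤ) → (Fin 2 → ℤ) → ℝ := fun s k =>
    (s : Set (Fin 2 → ℤ)).indicator (fun k => gaussWeight δ k * (conj (c k) * b s k).re) k with hf
  have hlim : Tendsto (fun s => ∑' k, f s k) atTop
      (𝓝 (∑' k, gaussWeight δ k * (conj (c k) * adv hK θ ρ k).re)) := by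
    -- The truncated coefficients are bounded by a multiple of `|k|` uniformly in `s`, and the
    -- Gaussian weight turns this into a summable majorant.
    have hbound := (summable_gaussWeight_mul_bracket hδ).mul_right (2 * Real.pi * Q * ‖ρ‖)
    have hQ0 : 0 ≤ Q := Finset.sum_nonneg fun i _ => by positivity
    refine tendsto_tsum_of_dominated_convergence hbound (fun k => ?_) (Eventually.of_forall ?_)
    · have h1 : Tendsto (fun s => gaussWeight δ k * (conj (c k) * b s k).re) atTop
          (𝓝 (gaussWeight δ k * (conj (c k) * adv hK θ ρ k).re)) :=
        ((Complex.continuous_re.tendsto _).comp ((hb1 k).const_mul _)).const_mul _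
      refine h1.congr' ?_
      filter_upwards [eventually_ge_atTop {k}] with s hs
      rw [hf]
      simp only
      rw [indicator_of_mem (by simpa using hs)]
    · intro s k
      have hw := gaussWeight_pos δ k
      have hbk := bracket_pos k
      refine (norm_indicator_le_norm_self _ _).trans ?_
      rw [Real.norm_eq_abs, abs_mul, abs_of_pos hw]
      have h1 : |(conj (c k) * b s k).re| ≤ ‖ρ‖ * (2 * Real.pi * (bracket k * Q)) := by
        refine (Complex.abs_re_le_norm _).trans ?_
        rw [norm_mul, RCLike.norm_conj]
        refine mul_le_mul (L2.norm_fourierCoeffR_le ρ k) ((hb2 s k).trans ?_) (norm_nonneg _)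
          (norm_nonneg _)
        gcongr
        exact freqNorm_le_bracket k
      calc _ ≤ gaussWeight δ k * (‖ρ‖ * (2 * Real.pi * (bracket k * Q))) := by gcongr
        _ = _ := by ring
  have hfs : ∀ s, ∑' k, f s k = (2 * Real.pi * Complex.I * transportForm δ u s c).re := by
    intro s
    rw [tsum_eq_sum (s := s) (fun k hk => by simp [hf, hk])]
    rw [transportForm, Finset.mul_sum, Complex.re_sum]
    refine Finset.sum_congr rfl fun k hk => ?_
    simp only [hf]
    rw [indicator_of_mem (by simpa using hk), ← Complex.re_ofReal_mul]
    congr 1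
    simp only [hb, Fin.sum_univ_two, Finset.mul_sum, ← Finset.sum_add_distrib]
    refine Finset.sum_congr rfl fun l _ => ?_
    ring
  refine le_of_tendsto hlim.abs (Eventually.of_forall fun s => ?_)
  rw [hfs]
  refine (hmain δ hδ hδ1 u hu (drift_divergence hK θ) s c).trans ?_
  have hR : 0 ≤ ∑ i, Real.sqrt (∫ x, |drift hK θ i x| ^ q ∂torusMeasure) :=
    Finset.sum_nonneg fun i _ => Real.sqrt_nonneg _
  have hδκ : 0 ≤ δ ^ κ := Real.rpow_nonneg hδ.le _
  refine mul_le_mul_of_nonneg_left ?_ (by positivity)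
  exact hρ.sum_le_tsum s fun k _ => mul_nonneg (Real.rpow_nonneg (bracket_pos k).le _) (sq_nonneg _)

end Drift

end

section

open ComplexConjugate Filter Topology

/-! ### The energy identity for a countable system of modes -/

/-- A violation at one time would persist on a nonempty open subset of `(0, T)`, which has positive
measure. -/
lemma ContinuousOn.le_of_ae_le {f : ℝ → ℝ} {T M : ℝ} (hT : 0 < T) (hf : ContinuousOn f (Icc 0 T))
    (h : ∀ᵐ t ∂(volume.restrict (Ioo 0 T)), f t ≤ M) : ∀ t ∈ Icc 0 T, f t ≤ M := by
  intro t ht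
  by_contra hlt
  rw [not_le] at hlt
  have hnhds : ∀ᶠ s in 𝓝[Icc 0 T] t, M < f s := (hf t ht).eventually (lt_mem_nhds hlt)
  obtain ⟨U, hU, htU, hsub⟩ := mem_nhdsWithin.1 hnhds
  have hcl : t ∈ closure (Ioo (0 : ℝ) T) := by rwa [closure_Ioo hT.ne]
  have hne : (U ∩ Ioo 0 T).Nonempty := mem_closure_iff.1 hcl U hU htU
  have hpos : 0 < volume (U ∩ Ioo 0 T) := (hU.inter isOpen_Ioo).measure_pos volume hne
  rw [ae_restrict_iff' measurableSet_Ioo] at h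
  refine hpos.ne' (measure_mono_null (fun s hs => ?_) h)
  simp only [mem_compl_iff, mem_ofPred_eq, not_forall, not_le]
  exact ⟨hs.2, hsub ⟨hs.1, Ioo_subset_Icc_self hs.2⟩⟩

lemma abs_re_conj_mul_le (x y : ℂ) : |(conj x * y).re| ≤ (‖x‖ ^ 2 + ‖y‖ ^ 2) / 2 := by
  refine (Complex.abs_re_le_norm _).trans ?_
  rw [norm_mul, RCLike.norm_conj]
  nlinarith [sq_nonneg (‖x‖ - ‖y‖)]

/-- Each mode has its own energy balance, but the nonlinear contributions `N` need not be summable.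
The weights `m n`, increasing to `1` only in the limit, make the sum over modes converge. As they
are removed, the part `N - B`, the transport, drops out by `hcomm`, while dissipation and `B`
converge by domination. Since the conclusion concerns the continuous representatives of the modes,
it holds at every time. -/
theorem energy_identity {ι : Type*} [Countable ι] {T R b₀ : ℝ} (hT : 0 < T) (hR0 : 0 ≤ R)
    {lam P : ι → ℝ} (hlam : ∀ k, 0 ≤ lam k) {h N B : ι → ℝ → ℂ} {m : ℕ → ι → ℝ} {w : ℕ → ℝ}
    {Φ : ℝ → ℝ}
    (hh : ∀ k, AEStronglyMeasurable (h k) (volume.restrict (Ioo 0 T)))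
    (hN : ∀ k, AEStronglyMeasurable (N k) (volume.restrict (Ioo 0 T)))
    (hmode : ∀ k, ∀ᵐ t ∂(volume.restrict (Ioo 0 T)),
      h k t = ∫ τ in (0 : ℝ)..t, (-(N k τ) - lam k * h k τ))
    (hR : ∀ᵐ t ∂(volume.restrict (Ioo 0 T)),
      Summable (fun k => ‖h k t‖ ^ 2) ∧ ∑' k, ‖h k t‖ ^ 2 ≤ R ^ 2)
    (hP : ∀ᵐ t ∂(volume.restrict (Ioo 0 T)), ∀ k, ‖N k t‖ ≤ P k)
    (hD : ∀ᵐ t ∂(volume.restrict (Ioo 0 T)), Summable fun k => lam k * ‖h k t‖ ^ 2)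
    (hDi : IntegrableOn (fun t => ∑' k, lam k * ‖h k t‖ ^ 2) (Ioo 0 T))
    (hB : ∀ᵐ t ∂(volume.restrict (Ioo 0 T)),
      Summable (fun k => ‖B k t‖ ^ 2) ∧ ∑' k, ‖B k t‖ ^ 2 ≤ b₀ ^ 2)
    (hm0 : ∀ n k, 0 ≤ m n k) (hm1 : ∀ n k, m n k ≤ 1)
    (hmlim : ∀ k, Tendsto (fun n => m n k) atTop (𝓝 1))
    (hmsum : ∀ n, Summable fun k => m n k * (lam k + P k))
    (hw : Tendsto w atTop (𝓝 0)) (hΦ : IntegrableOn Φ (Ioo 0 T))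
    (hcomm : ∀ n, ∀ᵐ t ∂(volume.restrict (Ioo 0 T)),
      |∑' k, m n k * (conj (h k t) * (N k t - B k t)).re| ≤ w n * Φ t) :
    ∀ t ∈ Icc 0 T, HasSum (fun k => ‖∫ τ in (0 : ℝ)..t, (-(N k τ) - lam k * h k τ)‖ ^ 2)
      (∫ τ in (0 : ℝ)..t, (-2 * (∑' k, lam k * ‖h k τ‖ ^ 2)
        - 2 * ∑' k, (conj (h k τ) * B k τ).re)) := by
  have hhR : ∀ᵐ t ∂(volume.restrict (Ioo 0 T)), ∀ k, ‖h k t‖ ≤ R := by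
    filter_upwards [hR] with t ht k
    exact le_of_sq_le_sq ((ht.1.le_tsum k fun _ _ => sq_nonneg _).trans ht.2) hR0
  have hfin : IsFiniteMeasure (volume.restrict (Ioo (0 : ℝ) T)) := by
    constructor; simp
  have hhi : ∀ k, IntegrableOn (h k) (Ioo 0 T) := fun k =>
    Integrable.of_bound (hh k) R (hhR.mono fun t ht => ht k)
  have hNi : ∀ k, IntegrableOn (N k) (Ioo 0 T) := fun k =>
    Integrable.of_bound (hN k) (P k) (hP.mono fun t ht => ht k)
  set g : ι → ℝ → ℂ := fun k τ => -(N k τ) - lam k * h k τ with hg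
  have hgi : ∀ k, IntegrableOn (g k) (Ioo 0 T) := fun k => (hNi k).neg.sub ((hhi k).const_mul _)
  have hgI : ∀ k, IntervalIntegrable (g k) volume 0 T := fun k => by
    rw [intervalIntegrable_iff_integrableOn_Ioo_of_le hT.le]; exact hgi k
  set c : ι → ℝ → ℂ := fun k t => ∫ τ in (0 : ℝ)..t, g k τ with hc
  have hcc : ∀ k, ContinuousOn (c k) (Icc 0 T) := fun k => by
    have := intervalIntegral.continuousOn_primitive_interval' (hgI k) (a := 0) (by simp)
    rwa [uIcc_of_le hT.le] at this
  have hce : ∀ᵐ t ∂(volume.restrict (Ioo 0 T)), ∀ k, h k t = c k t := ae_all_iff.2 hmode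
  -- The representatives agree with `h` only almost everywhere. Finite partial sums are continuous,
  -- so their bound extends to all times.
  have hcsum : ∀ t ∈ Icc 0 T, Summable fun k => ‖c k t‖ ^ 2 := by
    intro t ht
    refine summable_of_sum_le (c := R ^ 2) (fun k => sq_nonneg _) fun F => ?_
    refine ContinuousOn.le_of_ae_le (f := fun t => ∑ k ∈ F, ‖c k t‖ ^ 2) hT ?_ ?_ t ht
    · exact continuousOn_finsetSum _ fun k _ => (hcc k).norm.pow 2
    · filter_upwards [hce, hR] with s hs hs'
      simp only [← hs]
      exact (hs'.1.sum_le_tsum F fun _ _ => sq_nonneg _).trans hs'.2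
  intro t ht
  have hsub : Ioo 0 t ⊆ Ioo 0 T := Ioo_subset_Ioo_right ht.2
  have hmono : volume.restrict (Ioo 0 t) ≤ volume.restrict (Ioo 0 T) :=
    Measure.restrict_mono_set _ hsub
  set q : ι → ℝ → ℝ := fun k τ => -2 * (lam k * ‖h k τ‖ ^ 2) - 2 * (conj (h k τ) * N k τ).re with hq
  have hqm : ∀ k, AEStronglyMeasurable (q k) (volume.restrict (Ioo 0 t)) := by
    intro k
    have h1 := (hh k).mono_measure hmono
    have h2 := (hN k).mono_measure hmono
    refine (((h1.norm.pow 2).const_mul _).const_mul _).sub (AEStronglyMeasurable.const_mul ?_ _)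
    exact Complex.continuous_re.comp_aestronglyMeasurable
      ((Complex.continuous_conj.comp_aestronglyMeasurable h1).mul h2)
  have hqb : ∀ᵐ τ ∂(volume.restrict (Ioo 0 t)), ∀ k, ‖q k τ‖ ≤ (2 * R ^ 2 + 2 * R) * (lam k + P k) := by
    filter_upwards [ae_mono hmono hhR, ae_mono hmono hP] with τ h1 h2 k
    have e1 := h1 k
    have e2 := h2 k
    have e3 := norm_nonneg (h k τ)
    have e4 := hlam k
    have e5 : 0 ≤ P k := (norm_nonneg _).trans e2
    have a1 : |-2 * (lam k * ‖h k τ‖ ^ 2)| ≤ 2 * (lam k * R ^ 2) := by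
      rw [abs_mul, abs_of_nonneg (mul_nonneg e4 (sq_nonneg _))]
      norm_num
      gcongr
    have a2 : |2 * (conj (h k τ) * N k τ).re| ≤ 2 * (R * P k) := by
      rw [abs_mul, abs_two]
      refine mul_le_mul_of_nonneg_left ?_ two_pos.le
      refine (Complex.abs_re_le_norm _).trans ?_
      rw [norm_mul, RCLike.norm_conj]
      gcongr
    refine (abs_sub _ _).trans ?_
    nlinarith [mul_nonneg e4 hR0, mul_nonneg e5 (sq_nonneg R)]
  have hqc : ∀ k, ‖c k t‖ ^ 2 = ∫ τ in Ioo 0 t, q k τ := by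
    intro k
    have h1 := sq_norm_primitive ((hgI k).mono_set (uIcc_subset_uIcc (by simp)
      (by rw [uIcc_of_le hT.le]; exact ht)))
    rw [hc]
    simp only
    rw [h1, intervalIntegral.integral_of_le ht.1, integral_Ioc_eq_integral_Ioo]
    refine integral_congr_ae ?_
    filter_upwards [ae_mono hmono hce] with τ hτ
    have := hτ k
    simp only [hc] at this
    rw [← this]
    simp only [hq, hg, mul_sub, mul_neg]
    have e : conj (h k τ) * (lam k * h k τ) = ((lam k * ‖h k τ‖ ^ 2 : ℝ) : ℂ) := by
      rw [mul_left_comm, mul_comm (conj (h k τ)), Complex.mul_conj, Complex.normSq_eq_norm_sq]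
      push_cast; ring
    rw [e, Complex.sub_re, Complex.neg_re, Complex.ofReal_re]
    ring
  -- For fixed `n` the weights give a majorant that is summable in `k` and constant in time, so sum
  -- and integral may be exchanged.
  have hstep : ∀ n, HasSum (fun k => m n k * ‖c k t‖ ^ 2)
      (∫ τ in Ioo 0 t, ∑' k, m n k * q k τ) := by
    intro n
    simp only [hqc, ← integral_const_mul]
    refine hasSum_integral_of_dominated_convergence
      (fun k _ => (2 * R ^ 2 + 2 * R) * (m n k * (lam k + P k)))
      (fun k => (hqm k).const_mul _) (fun k => ?_) (Eventually.of_forall fun τ => ?_) ?_ ?_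
    · filter_upwards [hqb] with τ hτ
      rw [norm_mul, Real.norm_of_nonneg (hm0 n k)]
      calc m n k * ‖q k τ‖ ≤ m n k * ((2 * R ^ 2 + 2 * R) * (lam k + P k)) :=
            mul_le_mul_of_nonneg_left (hτ k) (hm0 n k)
        _ = _ := by ring
    · exact (hmsum n).mul_left _
    · exact integrable_const _
    · filter_upwards [hqb] with τ hτ
      refine Summable.hasSum (Summable.of_norm_bounded ((hmsum n).mul_left (2 * R ^ 2 + 2 * R))
        fun k => ?_)
      rw [norm_mul, Real.norm_of_nonneg (hm0 n k)]
      calc m n k * ‖q k τ‖ ≤ m n k * ((2 * R ^ 2 + 2 * R) * (lam k + P k)) :=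
            mul_le_mul_of_nonneg_left (hτ k) (hm0 n k)
        _ = _ := by ring
  have hlhs : Tendsto (fun n => ∑' k, m n k * ‖c k t‖ ^ 2) atTop (𝓝 (∑' k, ‖c k t‖ ^ 2)) := by
    refine tendsto_tsum_of_dominated_convergence (hcsum t ht) (fun k => ?_)
      (Eventually.of_forall fun n k => ?_)
    · simpa using (hmlim k).mul_const (‖c k t‖ ^ 2)
    · rw [norm_mul, Real.norm_of_nonneg (hm0 n k), Real.norm_of_nonneg (sq_nonneg _)]
      exact mul_le_of_le_one_left (sq_nonneg _) (hm1 n k)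
  obtain ⟨w₀, hw₀⟩ : ∃ w₀, ∀ n, |w n| ≤ w₀ := by
    obtain ⟨w₀, h₀⟩ := hw.abs.bddAbove_range
    exact ⟨w₀, fun n => h₀ ⟨n, rfl⟩⟩
  have hweight : ∀ {x : ι → ℝ}, Summable (fun k => ‖x k‖) → ∀ n,
      Summable (fun k => m n k * x k) ∧ |∑' k, m n k * x k| ≤ ∑' k, ‖x k‖ := by
    intro x hx n
    have hb : ∀ k, ‖m n k * x k‖ ≤ ‖x k‖ := fun k => by
      rw [norm_mul, Real.norm_of_nonneg (hm0 n k)]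
      exact mul_le_of_le_one_left (norm_nonneg _) (hm1 n k)
    exact ⟨Summable.of_norm_bounded hx hb, tsum_of_norm_bounded hx.hasSum hb⟩
  have hweight_lim : ∀ {x : ι → ℝ}, Summable (fun k => ‖x k‖) →
      Tendsto (fun n => ∑' k, m n k * x k) atTop (𝓝 (∑' k, x k)) := by
    intro x hx
    refine tendsto_tsum_of_dominated_convergence hx (fun k => ?_)
      (Eventually.of_forall fun n k => ?_)
    · simpa using (hmlim k).mul_const (x k)
    · rw [norm_mul, Real.norm_of_nonneg (hm0 n k)]
      exact mul_le_of_le_one_left (norm_nonneg _) (hm1 n k)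
  have hDn : ∀ᵐ τ ∂(volume.restrict (Ioo 0 t)), Summable fun k => ‖lam k * ‖h k τ‖ ^ 2‖ := by
    filter_upwards [ae_mono hmono hD] with τ hτ
    exact hτ.norm
  have hBn : ∀ᵐ τ ∂(volume.restrict (Ioo 0 t)), Summable (fun k => ‖(conj (h k τ) * B k τ).re‖) ∧
      ∑' k, ‖(conj (h k τ) * B k τ).re‖ ≤ (R ^ 2 + b₀ ^ 2) / 2 := by
    filter_upwards [ae_mono hmono hR, ae_mono hmono hB] with τ h1 h2
    have hs : Summable fun k => (‖h k τ‖ ^ 2 + ‖B k τ‖ ^ 2) / 2 := (h1.1.add h2.1).div_const 2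
    have hle : ∀ k, ‖(conj (h k τ) * B k τ).re‖ ≤ (‖h k τ‖ ^ 2 + ‖B k τ‖ ^ 2) / 2 :=
      fun k => abs_re_conj_mul_le _ _
    have hs' := Summable.of_nonneg_of_le (fun k => norm_nonneg _) hle hs
    refine ⟨hs', (hs'.tsum_le_tsum hle hs).trans ?_⟩
    rw [tsum_div_const, h1.1.tsum_add h2.1]
    linarith [h1.2, h2.2]
  -- Dissipation and `B` are absolutely summable even without weights. The third sum is controlled
  -- only through the commutator hypothesis.
  have hsplit : ∀ n, ∀ᵐ τ ∂(volume.restrict (Ioo 0 t)), ∑' k, m n k * q k τ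
      = -2 * (∑' k, m n k * (lam k * ‖h k τ‖ ^ 2)) - 2 * (∑' k, m n k * (conj (h k τ) * B k τ).re)
        - 2 * ∑' k, m n k * (conj (h k τ) * (N k τ - B k τ)).re := by
    intro n
    filter_upwards [hDn, hBn, hqb] with τ h1 h2 h3
    have s1 := (hweight h1 n).1
    have s2 := (hweight h2.1 n).1
    have s4 : Summable fun k => m n k * q k τ := by
      refine Summable.of_norm_bounded ((hmsum n).mul_left (2 * R ^ 2 + 2 * R)) fun k => ?_
      rw [norm_mul, Real.norm_of_nonneg (hm0 n k)]
      calc m n k * ‖q k τ‖ ≤ m n k * ((2 * R ^ 2 + 2 * R) * (lam k + P k)) :=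
            mul_le_mul_of_nonneg_left (h3 k) (hm0 n k)
        _ = _ := by ring
    have s3 : Summable fun k => m n k * (conj (h k τ) * (N k τ - B k τ)).re := by
      have := ((s4.mul_left (-1 / 2)).sub s1).sub s2
      refine this.congr fun k => ?_
      simp only [hq, mul_sub (conj (h k τ)), Complex.sub_re]
      ring
    rw [← tsum_mul_left, ← tsum_mul_left, ← tsum_mul_left,
      ← (s1.mul_left (-2)).tsum_sub (s2.mul_left 2),
      ← ((s1.mul_left (-2)).sub (s2.mul_left 2)).tsum_sub (s3.mul_left 2)]
    refine tsum_congr fun k => ?_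
    simp only [hq, mul_sub (conj (h k τ)), Complex.sub_re]
    ring
  have hrhs : Tendsto (fun n => ∫ τ in Ioo 0 t, ∑' k, m n k * q k τ) atTop
      (𝓝 (∫ τ in Ioo 0 t, (-2 * (∑' k, lam k * ‖h k τ‖ ^ 2)
        - 2 * ∑' k, (conj (h k τ) * B k τ).re))) := by
    refine tendsto_integral_of_dominated_convergence
      (fun τ => 2 * (∑' k, lam k * ‖h k τ‖ ^ 2) + (R ^ 2 + b₀ ^ 2) + 2 * (w₀ * |Φ τ|)) ?_ ?_ ?_ ?_
    · intro n
      refine aestronglyMeasurable_of_tendsto_ae (atTop : Filter (Finset ι))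
        (f := fun F τ => ∑ k ∈ F, m n k * q k τ) (fun F => ?_) ?_
      · exact Finset.aestronglyMeasurable_fun_sum _ fun k _ => (hqm k).const_mul _
      · filter_upwards [hqb] with τ h3
        refine Summable.hasSum (Summable.of_norm_bounded
          ((hmsum n).mul_left (2 * R ^ 2 + 2 * R)) fun k => ?_)
        rw [norm_mul, Real.norm_of_nonneg (hm0 n k)]
        calc m n k * ‖q k τ‖ ≤ m n k * ((2 * R ^ 2 + 2 * R) * (lam k + P k)) :=
              mul_le_mul_of_nonneg_left (h3 k) (hm0 n k)
          _ = _ := by ring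
    · have h1 := (hDi.mono_set hsub).const_mul 2
      have h2 := ((hΦ.mono_set hsub).abs.const_mul w₀).const_mul 2
      have : IsFiniteMeasure (volume.restrict (Ioo (0 : ℝ) t)) := by constructor; simp
      exact (h1.add (integrable_const _)).add h2
    · intro n
      filter_upwards [hsplit n, hDn, hBn, ae_mono hmono (hcomm n)] with τ h1 h2 h3 h4
      rw [h1, Real.norm_eq_abs]
      have a1 := (hweight h2 n).2
      have a2 := (hweight h3.1 n).2.trans h3.2
      have a3 : w n * Φ τ ≤ w₀ * |Φ τ| := by
        refine (le_abs_self _).trans ?_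
        rw [abs_mul]
        exact mul_le_mul_of_nonneg_right (hw₀ n) (abs_nonneg _)
      have a4 : ∑' k, ‖lam k * ‖h k τ‖ ^ 2‖ = ∑' k, lam k * ‖h k τ‖ ^ 2 :=
        tsum_congr fun k => Real.norm_of_nonneg (mul_nonneg (hlam k) (sq_nonneg _))
      rw [a4] at a1
      have b1 := abs_le.1 a1
      have b2 := abs_le.1 a2
      have b3 := abs_le.1 (h4.trans a3)
      rw [abs_le]
      constructor <;> linarith [b1.1, b1.2, b2.1, b2.2, b3.1, b3.2]
    · filter_upwards [ae_all_iff.2 hsplit, hDn, hBn, ae_mono hmono (ae_all_iff.2 hcomm)]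
        with τ h1 h2 h3 h4
      simp only [h1]
      have l3 : Tendsto (fun n => ∑' k, m n k * (conj (h k τ) * (N k τ - B k τ)).re) atTop (𝓝 0) := by
        refine squeeze_zero_norm h4 ?_
        simpa using hw.mul_const (Φ τ)
      have := (((hweight_lim h2).const_mul (-2)).sub ((hweight_lim h3.1).const_mul 2)).sub
        (l3.const_mul 2)
      simpa using this
  rw [intervalIntegral.integral_of_le ht.1, integral_Ioc_eq_integral_Ioo]
  have heq := tendsto_nhds_unique hlhs (hrhs.congr fun n => (hstep n).tsum_eq.symm)
  rw [← heq]
  exact (hcsum t ht).hasSum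

/-- A curve in `L²` with continuous modes and continuous norm is continuous. -/
lemma L2.continuousOn_of_modes {r : ℝ → L2} {s : Set ℝ}
    (hk : ∀ k, ContinuousOn (fun t => fourierCoeffR (r t) k) s)
    (hn : ContinuousOn (fun t => ‖r t‖ ^ 2) s) : ContinuousOn r s := by
  intro t₀ ht₀
  rw [ContinuousWithinAt, Metric.tendsto_nhds]
  intro η hη
  -- Finitely many modes carry all but `η²/4` of the squared norm at `t₀`. The tail at time `t` is
  -- the squared norm minus these modes, hence continuous. The bound below thus tends to four times
  -- the tail at `t₀`, which is less than `η²`.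
  obtain ⟨F, hF⟩ : ∃ F : Finset (Fin 2 → ℤ),
      ‖r t₀‖ ^ 2 - ∑ k ∈ F, ‖fourierCoeffR (r t₀) k‖ ^ 2 < η ^ 2 / 4 := by
    have h := (L2.hasSum_sq (r t₀)).eventually (lt_mem_nhds
      (show ‖r t₀‖ ^ 2 - η ^ 2 / 4 < ‖r t₀‖ ^ 2 by have := pow_pos hη 2; linarith))
    obtain ⟨F, hF⟩ := h.exists
    exact ⟨F, by linarith⟩
  have hbound : ∀ t, ‖r t - r t₀‖ ^ 2 ≤ (∑ k ∈ F, ‖fourierCoeffR (r t) k - fourierCoeffR (r t₀) k‖ ^ 2)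
      + 2 * (‖r t‖ ^ 2 - ∑ k ∈ F, ‖fourierCoeffR (r t) k‖ ^ 2)
      + 2 * (‖r t₀‖ ^ 2 - ∑ k ∈ F, ‖fourierCoeffR (r t₀) k‖ ^ 2) := by
    intro t
    have h1 := L2.hasSum_sq (r t - r t₀)
    have h2 := ((L2.hasSum_sq (r t)).mul_left 2).add ((L2.hasSum_sq (r t₀)).mul_left 2)
    simp only [L2.fourierCoeffR_sub] at h1
    have h3 := h2.sub h1
    have h4 := sum_le_hasSum F (fun k _ => ?_) h3
    · rw [Finset.sum_sub_distrib, Finset.sum_add_distrib, ← Finset.mul_sum, ← Finset.mul_sum] at h4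
      linarith
    · have := norm_sub_le (fourierCoeffR (r t) k) (fourierCoeffR (r t₀) k)
      nlinarith [norm_nonneg (fourierCoeffR (r t) k - fourierCoeffR (r t₀) k),
        sq_nonneg (‖fourierCoeffR (r t) k‖ - ‖fourierCoeffR (r t₀) k‖)]
  have hlim : Tendsto (fun t => (∑ k ∈ F, ‖fourierCoeffR (r t) k - fourierCoeffR (r t₀) k‖ ^ 2)
      + 2 * (‖r t‖ ^ 2 - ∑ k ∈ F, ‖fourierCoeffR (r t) k‖ ^ 2)
      + 2 * (‖r t₀‖ ^ 2 - ∑ k ∈ F, ‖fourierCoeffR (r t₀) k‖ ^ 2)) (𝓝[s] t₀)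
      (𝓝 ((∑ k ∈ F, ‖fourierCoeffR (r t₀) k - fourierCoeffR (r t₀) k‖ ^ 2)
      + 2 * (‖r t₀‖ ^ 2 - ∑ k ∈ F, ‖fourierCoeffR (r t₀) k‖ ^ 2)
      + 2 * (‖r t₀‖ ^ 2 - ∑ k ∈ F, ‖fourierCoeffR (r t₀) k‖ ^ 2))) := by
    have hk' := fun k => (hk k t₀ ht₀).tendsto
    have hn' := (hn t₀ ht₀).tendsto
    refine Tendsto.add (Tendsto.add ?_ (Tendsto.const_mul _ (hn'.sub ?_))) tendsto_const_nhds
    · exact tendsto_finsetSum _ fun k _ => (((hk' k).sub tendsto_const_nhds).norm.pow 2)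
    · exact tendsto_finsetSum _ fun k _ => (hk' k).norm.pow 2
  have hlt : (∑ k ∈ F, ‖fourierCoeffR (r t₀) k - fourierCoeffR (r t₀) k‖ ^ 2)
      + 2 * (‖r t₀‖ ^ 2 - ∑ k ∈ F, ‖fourierCoeffR (r t₀) k‖ ^ 2)
      + 2 * (‖r t₀‖ ^ 2 - ∑ k ∈ F, ‖fourierCoeffR (r t₀) k‖ ^ 2) < η ^ 2 := by
    simp only [sub_self, norm_zero, ne_eq, OfNat.ofNat_ne_zero, not_false_eq_true, zero_pow,
      Finset.sum_const_zero]
    linarith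
  filter_upwards [hlim.eventually (gt_mem_nhds hlt)] with t ht
  rw [dist_eq_norm]
  exact lt_of_pow_lt_pow_left₀ 2 hη.le ((hbound t).trans_lt ht)

end

section

open UnitAddTorus ComplexConjugate Filter Topology

/-! ### Decay of the Fourier coefficients of smooth functions -/

/-- Smoothness is expressed through lifts to `ℝ²`; the open quotient map brings continuity back to
the torus. -/
lemma isOpenQuotientMap_proj : IsOpenQuotientMap proj :=
  IsOpenQuotientMap.piMap fun _ => QuotientAddGroup.isOpenQuotientMap_mk

lemma proj_add_single (y : Fin 2 → ℝ) (i : Fin 2) (r : ℝ) :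
    proj y + Pi.single i (r : UnitAddCircle) = proj (y + Pi.single i r) := by
  ext j
  by_cases h : j = i
  · subst h; simp [proj]
  · simp [proj, h]

lemma IsSmoothST.continuous {E : Type} [NormedAddCommGroup E] [NormedSpace ℝ E]
    {φ : ℝ × Torus → E} (h : IsSmoothST φ) : Continuous φ := by
  have hq : IsOpenQuotientMap (Prod.map id proj : ℝ × (Fin 2 → ℝ) → ℝ × Torus) :=
    IsOpenQuotientMap.id.prodMap isOpenQuotientMap_proj
  exact hq.continuous_comp_iff.1 (ContDiff.continuous h)

lemma IsSmooth.continuous {φ : Torus → ℂ} (h : IsSmooth φ) : Continuous φ :=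
  isOpenQuotientMap_proj.continuous_comp_iff.1 (ContDiff.continuous h)

lemma hasDerivAt_line {Φ : (Fin 2 → ℝ) → ℂ} (h : Differentiable ℝ Φ) (i : Fin 2) (y : Fin 2 → ℝ)
    (r : ℝ) : HasDerivAt (fun r : ℝ => Φ (y + Pi.single i r))
      (fderiv ℝ Φ (y + Pi.single i r) (Pi.single i 1)) r := by
  have h1 : HasDerivAt (fun r : ℝ => y + Pi.single i r) (Pi.single i 1) r := by
    have h2 : HasDerivAt (fun r : ℝ => y + r • (Pi.single i 1 : Fin 2 → ℝ))
        ((1 : ℝ) • (Pi.single i 1 : Fin 2 → ℝ)) r := ((hasDerivAt_id r).smul_const _).const_add y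
    have h3 : ∀ r : ℝ, r • (Pi.single i 1 : Fin 2 → ℝ) = Pi.single i r := by
      intro r; rw [← Pi.single_smul]; simp
    simpa only [h3, one_smul] using h2
  exact (h _).hasFDerivAt.comp_hasDerivAt r h1

lemma partialX_proj {φ : Torus → ℂ} (h : IsSmooth φ) (i : Fin 2) (y : Fin 2 → ℝ) :
    partialX i φ (proj y) = fderiv ℝ (fun y => φ (proj y)) y (Pi.single i 1) := by
  unfold partialX
  simp only [proj_add_single]
  have := (hasDerivAt_line (ContDiff.differentiable h (by simp)) i y 0).deriv
  simpa using this

lemma hasDerivAt_add_single {φ : Torus → ℂ} (h : IsSmooth φ) (i : Fin 2) (x : Torus) (r : ℝ) :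
    HasDerivAt (fun r : ℝ => φ (x + Pi.single i (r : UnitAddCircle)))
      (partialX i φ (x + Pi.single i (r : UnitAddCircle))) r := by
  obtain ⟨y, rfl⟩ := isOpenQuotientMap_proj.surjective x
  simp only [proj_add_single, partialX_proj h]
  exact hasDerivAt_line (ContDiff.differentiable h (by simp)) i y r

lemma IsSmooth.partialX {φ : Torus → ℂ} (h : IsSmooth φ) (i : Fin 2) : IsSmooth (partialX i φ) := by
  unfold IsSmooth
  simp only [partialX_proj h]
  exact (ContDiff.fderiv_right (m := ∞) h (by simp)).clm_apply contDiff_const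

lemma integrable_of_continuous {φ : Torus → ℂ} (h : Continuous φ) : Integrable φ torusMeasure := by
  obtain ⟨C, hC⟩ := isCompact_univ.exists_bound_of_continuousOn h.continuousOn
  exact Integrable.of_bound h.aestronglyMeasurable C
    (Eventually.of_forall fun x => hC x (mem_univ x))

/-- Integration by parts through translations: `F r = ∫ e_{-k}(x) φ(x + r eᵢ) dx` is differentiated
at `0` once under the integral, and once after the translation has been moved onto the character. -/
lemma mFourierCoeff_partialX {φ : Torus → ℂ} (h : IsSmooth φ) (i : Fin 2) (k : Fin 2 → ℤ) :
    mFourierCoeff (partialX i φ) k = 2 * Real.pi * Complex.I * k i * mFourierCoeff φ k := by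
  set F : ℝ → ℂ := fun r => ∫ x, mFourier (-k) x * φ (x + Pi.single i (r : UnitAddCircle))
    ∂torusMeasure with hF
  have hcont := h.continuous
  have hcont' := (h.partialX i).continuous
  obtain ⟨C, hC⟩ := isCompact_univ.exists_bound_of_continuousOn hcont'.continuousOn
  have h1 : HasDerivAt F (∫ x, mFourier (-k) x * partialX i φ x ∂torusMeasure) 0 := by
    have := (hasDerivAt_integral_of_dominated_loc_of_deriv_le (𝕜 := ℝ) (μ := torusMeasure) (x₀ := (0 : ℝ))
      (F := fun (r : ℝ) (x : Torus) => mFourier (-k) x * φ (x + Pi.single i (r : UnitAddCircle)))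
      (F' := fun (r : ℝ) (x : Torus) => mFourier (-k) x * partialX i φ (x + Pi.single i (r : UnitAddCircle)))
      (bound := fun _ => C) (s := univ) univ_mem ?_ ?_ ?_ ?_ ?_ ?_).2
    · simpa using this
    · exact Eventually.of_forall fun r => Continuous.aestronglyMeasurable
        ((mFourier (-k)).continuous.mul (hcont.comp (continuous_id.add continuous_const)))
    · exact integrable_of_continuous
        ((mFourier (-k)).continuous.mul (hcont.comp (continuous_id.add continuous_const)))
    · exact Continuous.aestronglyMeasurable
        ((mFourier (-k)).continuous.mul (hcont'.comp (continuous_id.add continuous_const)))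
    · refine Eventually.of_forall fun x r _ => ?_
      rw [norm_mul, norm_mFourier_apply, one_mul]
      exact hC _ (mem_univ _)
    · exact integrable_const _
    · exact Eventually.of_forall fun x r _ => (hasDerivAt_add_single h i x r).const_mul _
  have h2 : ∀ r : ℝ, F r = mFourier k (Pi.single i (r : UnitAddCircle)) * mFourierCoeff φ k := by
    intro r
    set s : Torus := Pi.single i (r : UnitAddCircle)
    have e1 : F r = ∫ x, mFourier (-k) (x - s) * φ x ∂torusMeasure := by
      rw [← integral_add_right_eq_self (μ := torusMeasure)
        (fun x => mFourier (-k) (x - s) * φ x) s]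
      simp only [add_sub_cancel_right, hF, s]
    rw [e1]
    change _ = _ * ∫ x, mFourier (-k) x • φ x ∂torusMeasure
    rw [← integral_const_mul]
    refine integral_congr_ae (Eventually.of_forall fun x => ?_)
    simp only [mFourier_apply_sub, ← mFourier_neg, neg_neg, smul_eq_mul]
    ring
  have h3 : HasDerivAt F (2 * Real.pi * Complex.I * k i * mFourierCoeff φ k) 0 := by
    have e : F = fun r : ℝ => mFourier k ((0 : Torus) + Pi.single i (r : UnitAddCircle))
        * mFourierCoeff φ k := by
      ext r; rw [h2, zero_add]
    rw [e]
    have h4 := (hasDerivAt_add_single (isSmooth_mFourier k) i 0 0).mul_const (mFourierCoeff φ k)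
    rw [partialX_mFourier] at h4
    simpa [mFourier] using h4
  exact h1.unique h3

lemma IsSmoothST.slice {φ : ℝ × Torus → ℂ} (h : IsSmoothST φ) (t : ℝ) :
    IsSmooth fun x => φ (t, x) := by
  have h' : ContDiff ℝ ∞ fun p : ℝ × (Fin 2 → ℝ) => φ (p.1, proj p.2) := h
  exact h'.comp (contDiff_const.prodMk contDiff_id : ContDiff ℝ ∞ fun y : Fin 2 → ℝ => (t, y))

lemma IsSmoothST.partialX {φ : ℝ × Torus → ℂ} (h : IsSmoothST φ) (i : Fin 2) :
    IsSmoothST fun p : ℝ × Torus => partialX i (fun x => φ (p.1, x)) p.2 := by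
  set Φ : ℝ × (Fin 2 → ℝ) → ℂ := fun p => φ (p.1, proj p.2) with hΦ
  have hs : ContDiff ℝ ∞ Φ := h
  unfold IsSmoothST
  have e : (fun p : ℝ × (Fin 2 → ℝ) => ActiveScalar.partialX i (fun x => φ (p.1, x)) (proj p.2))
      = fun p => fderiv ℝ Φ p (0, Pi.single i 1) := by
    ext p
    rw [partialX_proj (h.slice p.1)]
    have h1 : HasFDerivAt (fun y : Fin 2 → ℝ => (p.1, y))
        (ContinuousLinearMap.inr ℝ ℝ (Fin 2 → ℝ)) p.2 := hasFDerivAt_prodMk_right p.1 p.2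
    have h2 : HasFDerivAt (fun y => φ (p.1, proj y)) _ p.2 :=
      ((hs.differentiable (by simp)) (p.1, p.2)).hasFDerivAt.comp p.2 h1
    rw [h2.fderiv]
    simp
  rw [e]
  exact (ContDiff.fderiv_right (m := ∞) hs (by simp)).clm_apply contDiff_const

lemma IsSmoothST.exists_pow_mul_coeff_le {φ : ℝ × Torus → ℂ} (h : IsSmoothST φ) (T : ℝ)
    (i : Fin 2) (n : ℕ) : ∃ C : ℝ, ∀ t ∈ Icc 0 T, ∀ k : Fin 2 → ℤ,
      |(k i : ℝ)| ^ n * ‖mFourierCoeff (fun x => φ (t, x)) k‖ ≤ C := by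
  induction n generalizing φ with
  | zero =>
    obtain ⟨C, hC⟩ := (isCompact_Icc.prod isCompact_univ).exists_bound_of_continuousOn
      (s := Icc 0 T ×ˢ (univ : Set Torus)) h.continuous.continuousOn
    refine ⟨C, fun t ht k => ?_⟩
    rw [pow_zero, one_mul]
    change ‖∫ x, mFourier (-k) x • φ (t, x) ∂torusMeasure‖ ≤ C
    refine (norm_integral_le_of_norm_le_const (C := C) (Eventually.of_forall fun x => ?_)).trans ?_
    · rw [norm_smul, norm_mFourier_apply, one_mul]
      exact hC (t, x) ⟨ht, mem_univ _⟩
    · simp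
  | succ n ih =>
    obtain ⟨C, hC⟩ := ih (h.partialX i)
    refine ⟨C / (2 * Real.pi), fun t ht k => ?_⟩
    have h1 := hC t ht k
    simp only [] at h1
    rw [mFourierCoeff_partialX (h.slice t), norm_mul, norm_mul, norm_two_pi_I] at h1
    rw [le_div_iff₀ (by positivity)]
    refine le_trans (le_of_eq ?_) h1
    simp only [Complex.norm_intCast]
    ring

/-- Six derivatives in each coordinate control `(1 + |k|²)³`. The exponent `-3` is chosen because,
after the weight `3/2` required of first order profiles, it leaves `-3/2`, which is still summable.
-/
lemma IsSource.exists_coeff_le {T : ℝ} {f : ℝ × Torus → ℝ} (hf : IsSource T f) :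
    ∃ C : ℝ, 0 ≤ C ∧ ∀ t ∈ Icc 0 T, ∀ k,
      ‖fourierCoeffR (fun x => f (t, x)) k‖ ≤ C * bracket k ^ (-3 : ℝ) := by
  have hs : IsSmoothST fun p : ℝ × Torus => (f p : ℂ) :=
    Complex.ofRealCLM.contDiff.comp (hf.1 : ContDiff ℝ ∞ _)
  obtain ⟨A, hA⟩ := hs.exists_pow_mul_coeff_le T 0 0
  obtain ⟨B, hB⟩ := hs.exists_pow_mul_coeff_le T 0 6
  obtain ⟨D, hD⟩ := hs.exists_pow_mul_coeff_le T 1 6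
  refine ⟨9 * (|A| + |B| + |D|), by positivity, fun t ht k => ?_⟩
  have hb := bracket_pos k
  have e : bracket k ^ (-3 : ℝ) = (bracket k ^ 3)⁻¹ := by
    rw [Real.rpow_neg hb.le]; norm_cast
  rw [e, ← div_eq_mul_inv, le_div_iff₀ (by positivity)]
  set z := ‖fourierCoeffR (fun x => f (t, x)) k‖ with hz
  have h0 : z ≤ A := by
    have := hA t ht k
    rwa [pow_zero, one_mul] at this
  have h1 : |(k 0 : ℝ)| ^ 6 * z ≤ B := hB t ht k
  have h2 : |(k 1 : ℝ)| ^ 6 * z ≤ D := hD t ht k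
  have hz0 : 0 ≤ z := norm_nonneg _
  have h3 : bracket k ^ 3 ≤ 9 * (1 + |(k 0 : ℝ)| ^ 6 + |(k 1 : ℝ)| ^ 6) := by
    have e1 : |(k 0 : ℝ)| ^ 6 = ((k 0 : ℝ) ^ 2) ^ 3 := by rw [← sq_abs (k 0 : ℝ)]; ring
    have e2 : |(k 1 : ℝ)| ^ 6 = ((k 1 : ℝ) ^ 2) ^ 3 := by rw [← sq_abs (k 1 : ℝ)]; ring
    rw [e1, e2, bracket, freqNorm_sq]
    have p := sq_nonneg (k 0 : ℝ)
    have q := sq_nonneg (k 1 : ℝ)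
    generalize (k 0 : ℝ) ^ 2 = a at *
    generalize (k 1 : ℝ) ^ 2 = b at *
    nlinarith [mul_nonneg (add_nonneg p q) (sq_nonneg (a - b)),
      mul_nonneg (add_nonneg p zero_le_one) (sq_nonneg (a - 1)),
      mul_nonneg (add_nonneg q zero_le_one) (sq_nonneg (b - 1)),
      mul_nonneg p (sq_nonneg (b - 1)), mul_nonneg q (sq_nonneg (a - 1)), sq_nonneg (a - b)]
  calc z * bracket k ^ 3 ≤ z * (9 * (1 + |(k 0 : ℝ)| ^ 6 + |(k 1 : ℝ)| ^ 6)) := by gcongr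
    _ = 9 * (z + |(k 0 : ℝ)| ^ 6 * z + |(k 1 : ℝ)| ^ 6 * z) := by ring
    _ ≤ 9 * (A + B + D) := by linarith
    _ ≤ _ := by linarith [le_abs_self A, le_abs_self B, le_abs_self D]

lemma IsSource.stronglyMeasurable_coeff {T : ℝ} {f : ℝ × Torus → ℝ} (hf : IsSource T f)
    (k : Fin 2 → ℤ) : StronglyMeasurable fun t => fourierCoeffR (fun x => f (t, x)) k := by
  have hc : Continuous fun p : ℝ × Torus => mFourier (-k) p.2 * (f p : ℂ) :=
    ((mFourier (-k)).continuous.comp continuous_snd).mul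
      (Complex.continuous_ofReal.comp hf.1.continuous)
  exact hc.stronglyMeasurable.integral_prod_right' (ν := torusMeasure)

lemma IsSource.integrableOn_coeff {T : ℝ} {f : ℝ × Torus → ℝ} (hf : IsSource T f)
    (k : Fin 2 → ℤ) : IntegrableOn (fun t => fourierCoeffR (fun x => f (t, x)) k) (Ioo 0 T) := by
  obtain ⟨C, _, hC⟩ := hf.exists_coeff_le
  refine Measure.integrableOn_of_bounded (M := C * bracket k ^ (-3 : ℝ)) (by simp)
    (hf.stronglyMeasurable_coeff k).aestronglyMeasurable ?_
  filter_upwards [ae_restrict_mem measurableSet_Ioo] with t ht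
  exact hC t (Ioo_subset_Icc_self ht) k

lemma IsSource.slice_integrable {T : ℝ} {f : ℝ × Torus → ℝ} (hf : IsSource T f) (t : ℝ) :
    Integrable (fun x => f (t, x)) torusMeasure := by
  have hc : Continuous fun x => f (t, x) := hf.1.continuous.comp (by fun_prop)
  obtain ⟨C, hC⟩ := isCompact_univ.exists_bound_of_continuousOn hc.continuousOn
  exact Integrable.of_bound hc.aestronglyMeasurable C
    (Eventually.of_forall fun x => hC x (mem_univ x))

end

section

open UnitAddTorus ComplexConjugate Filter Topology

/-! ### The profiles of first and second order -/

lemma summable_of_bracket_mul {r : ℝ} (hr : 0 ≤ r) {a : (Fin 2 → ℤ) → ℝ} (h0 : ∀ k, 0 ≤ a k)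
    (h : Summable fun k => bracket k ^ r * a k) : Summable a :=
  Summable.of_nonneg_of_le h0 (fun k =>
    le_mul_of_one_le_left (h0 k) (Real.one_le_rpow (one_le_bracket k) hr)) h

/-- Peetre's inequality, used to distribute a weight over the two factors of a convolution. -/
lemma bracket_le_two_mul (k l : Fin 2 → ℤ) : bracket k ≤ 2 * (bracket (k - l) * bracket l) := by
  simp only [bracket, freqNorm_sq, Pi.sub_apply]
  push_cast
  nlinarith [sq_nonneg ((k 0 : ℝ) - l 0 - l 0), sq_nonneg ((k 1 : ℝ) - l 1 - l 1),
    mul_nonneg (add_nonneg (sq_nonneg ((k 0 : ℝ) - l 0)) (sq_nonneg ((k 1 : ℝ) - l 1)))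
      (add_nonneg (sq_nonneg (l 0 : ℝ)) (sq_nonneg (l 1 : ℝ)))]

lemma freqNorm_mul_bracket_le (k : Fin 2 → ℤ) : bracket k * freqNorm k ≤ bracket k ^ (3 / 2 : ℝ) := by
  have hb := bracket_pos k
  rw [show (3 / 2 : ℝ) = 1 + 1 / 2 by norm_num, Real.rpow_add hb, Real.rpow_one,
    ← Real.sqrt_eq_rpow]
  gcongr
  exact Real.le_sqrt_of_sq_le (freqNorm_sq_le_bracket k)

/-- The source of the second order profile loses a factor `|k|`, and the profile itself must carry
the weight `1 + |k|²`. Together these cost the power `3/2` of `1 + |k|²`, which the first order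
profile has to supply; the rest is `ℓ¹ * ℓ¹ ⊂ ℓ¹`. -/
lemma summable_bracket_mul_conv {a : (Fin 2 → ℤ) → ℝ} (h0 : ∀ k, 0 ≤ a k)
    (h : Summable fun k => bracket k ^ (3 / 2 : ℝ) * a k) :
    Summable fun k => bracket k * (freqNorm k * ∑' l, a (k - l) * a l) := by
  set b : (Fin 2 → ℤ) → ℝ := fun k => bracket k ^ (3 / 2 : ℝ) * a k with hb
  have hb0 : ∀ k, 0 ≤ b k := fun k => mul_nonneg (Real.rpow_nonneg (bracket_pos k).le _) (h0 k)
  let e : (Fin 2 → ℤ) × (Fin 2 → ℤ) ≃ (Fin 2 → ℤ) × (Fin 2 → ℤ) :=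
    { toFun := fun p => (p.1 - p.2, p.2)
      invFun := fun p => (p.1 + p.2, p.2)
      left_inv := fun p => by simp
      right_inv := fun p => by simp }
  have h1 : Summable fun p : (Fin 2 → ℤ) × (Fin 2 → ℤ) => b (p.1 - p.2) * b p.2 :=
    e.summable_iff.2 (h.mul_of_nonneg h hb0 hb0)
  have ha := summable_of_bracket_mul (by norm_num) h0 h
  have h2 : Summable fun p : (Fin 2 → ℤ) × (Fin 2 → ℤ) => a (p.1 - p.2) * a p.2 :=
    e.summable_iff.2 (ha.mul_of_nonneg ha h0 h0)
  refine Summable.of_nonneg_of_le (fun k => ?_) (fun k => ?_)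
    (h1.prod.mul_left (2 ^ (3 / 2 : ℝ)))
  · exact mul_nonneg (bracket_pos k).le (mul_nonneg (freqNorm_nonneg k)
      (tsum_nonneg fun l => mul_nonneg (h0 _) (h0 _)))
  · rw [← mul_assoc, ← tsum_mul_left, ← tsum_mul_left]
    refine Summable.tsum_le_tsum (fun l => ?_) ((h2.prod_factor k).mul_left _)
      ((h1.prod_factor k).mul_left _)
    have hk : bracket k * freqNorm k ≤ 2 ^ (3 / 2 : ℝ) *
        (bracket (k - l) ^ (3 / 2 : ℝ) * bracket l ^ (3 / 2 : ℝ)) := by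
      refine (freqNorm_mul_bracket_le k).trans ?_
      rw [← Real.mul_rpow (bracket_pos _).le (bracket_pos _).le, ← Real.mul_rpow two_pos.le
        (mul_nonneg (bracket_pos _).le (bracket_pos _).le)]
      exact Real.rpow_le_rpow (bracket_pos k).le (bracket_le_two_mul k l) (by norm_num)
    calc bracket k * freqNorm k * (a (k - l) * a l)
        ≤ 2 ^ (3 / 2 : ℝ) * (bracket (k - l) ^ (3 / 2 : ℝ) * bracket l ^ (3 / 2 : ℝ))
          * (a (k - l) * a l) := mul_le_mul_of_nonneg_right hk (mul_nonneg (h0 _) (h0 _))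
      _ = _ := by simp only [hb]; ring

lemma norm_adv_le_conv {K : Torus → ℝ} (hK : IsAdmissibleKernel K) {u v : L2}
    {a : (Fin 2 → ℤ) → ℝ} (ha : Summable a)
    (hu : ∀ k, ‖fourierCoeffR u k‖ ≤ a k) (hv : ∀ k, ‖fourierCoeffR v k‖ ≤ a k)
    (k : Fin 2 → ℤ) :
    ‖adv hK u v k‖ ≤ 4 * Real.pi * driftBound hK * (freqNorm k * ∑' l, a (k - l) * a l) := by
  have h0 := driftBound_nonneg hK
  have ha0 : ∀ k, 0 ≤ a k := fun k => (norm_nonneg _).trans (hu k)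
  have hsym : ∀ i k, ‖driftSymbol K i k‖ ≤ driftBound hK := hK.exists_driftSymbol_le.choose_spec.2
  have hs : Summable fun l => a (k - l) * a l := by
    have hbd : ∀ l, a (k - l) ≤ ∑' m, a m := fun l => ha.le_tsum _ fun _ _ => ha0 _
    exact Summable.of_nonneg_of_le (fun l => mul_nonneg (ha0 _) (ha0 _))
      (fun l => mul_le_mul_of_nonneg_right (hbd l) (ha0 l)) (ha.mul_left _)
  have h1 : ∀ i, ‖fourierCoeffR (fun x => drift hK u i x * v x) k‖
      ≤ driftBound hK * ∑' l, a (k - l) * a l := by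
    intro i
    rw [← (hasSum_fourierCoeffR_mul (Lp.memLp (drift hK u i)) (Lp.memLp v) k).tsum_eq,
      ← tsum_mul_left]
    refine tsum_of_norm_bounded (hs.mul_left _).hasSum fun l => ?_
    rw [fourierCoeffR_drift, norm_mul, norm_mul, mul_assoc]
    exact mul_le_mul (hsym i _) (mul_le_mul (hu _) (hv _) (norm_nonneg _) (ha0 _))
      (by positivity) h0
  have hS : 0 ≤ ∑' l, a (k - l) * a l := tsum_nonneg fun l => mul_nonneg (ha0 _) (ha0 _)
  rw [adv, norm_mul, norm_two_pi_I]
  have h2 : ‖∑ i, (k i : ℂ) * fourierCoeffR (fun x => drift hK u i x * v x) k‖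
      ≤ ∑ _i : Fin 2, freqNorm k * (driftBound hK * ∑' l, a (k - l) * a l) := by
    refine (norm_sum_le _ _).trans (Finset.sum_le_sum fun i _ => ?_)
    rw [norm_mul]
    exact mul_le_mul (by simpa using abs_le_freqNorm k i) (h1 i) (norm_nonneg _)
      (freqNorm_nonneg k)
  calc _ ≤ 2 * Real.pi * ∑ _i : Fin 2, freqNorm k * (driftBound hK * ∑' l, a (k - l) * a l) := by
        gcongr
    _ = _ := by simp; ring

/-- A field with rapidly decaying Fourier coefficients, uniformly in time. -/
structure IsProfile (T : ℝ) (a : (Fin 2 → ℤ) → ℝ) (w : ℝ → L2) : Prop where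
  meas : AEStronglyMeasurable w (volume.restrict (Ioo 0 T))
  bound : ∀ᵐ t ∂(volume.restrict (Ioo 0 T)), ∀ k, ‖fourierCoeffR (w t) k‖ ≤ a k

lemma IsProfile.add {T : ℝ} {a b : (Fin 2 → ℤ) → ℝ} {w z : ℝ → L2} (hw : IsProfile T a w)
    (hz : IsProfile T b z) : IsProfile T (fun k => a k + b k) (fun t => w t + z t) := by
  refine ⟨hw.meas.add hz.meas, ?_⟩
  filter_upwards [hw.bound, hz.bound] with t h1 h2 k
  rw [L2.fourierCoeffR_add]
  exact (norm_add_le _ _).trans (add_le_add (h1 k) (h2 k))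

/-- The integrated equation `ŵ(t, k) = ∫₀ᵗ (g(τ, k) - |2πk|^{2α} ŵ(τ, k)) dτ` of all modes. -/
def SolvesModes (α T : ℝ) (w : ℝ → L2) (g : ℝ → (Fin 2 → ℤ) → ℂ) : Prop :=
  ∀ k, ∀ᵐ t ∂(volume.restrict (Ioo 0 T)), fourierCoeffR (w t) k
    = ∫ τ in (0 : ℝ)..t, (g τ k - eig α k * fourierCoeffR (w τ) k)

lemma norm_exp_mul_le {lam t τ : ℝ} (hlam : 0 ≤ lam) (hτ : τ ≤ t) (z : ℂ) :
    ‖(Real.exp (-(lam * (t - τ))) : ℂ) * z‖ ≤ ‖z‖ := by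
  rw [norm_mul, Complex.norm_of_nonneg (Real.exp_pos _).le]
  refine mul_le_of_le_one_left (norm_nonneg _) (Real.exp_le_one_iff.2 ?_)
  have := mul_nonneg hlam (sub_nonneg.2 hτ)
  linarith

lemma norm_duhamel_le {lam t T M : ℝ} (hlam : 0 ≤ lam) (ht : t ∈ Icc 0 T) {g : ℝ → ℂ}
    (hM : 0 ≤ M) (hg : ∀ᵐ τ ∂(volume.restrict (Ioo 0 T)), ‖g τ‖ ≤ M) :
    ‖∫ τ in (0 : ℝ)..t, (Real.exp (-(lam * (t - τ))) : ℂ) * g τ‖ ≤ T * M := by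
  have h1 : ‖∫ τ in (0 : ℝ)..t, (Real.exp (-(lam * (t - τ))) : ℂ) * g τ‖ ≤ M * |t - 0| := by
    refine intervalIntegral.norm_integral_le_of_norm_le_const_ae ?_
    rw [ae_restrict_iff' measurableSet_Ioo] at hg
    filter_upwards [hg, measure_eq_zero_iff_ae_notMem.1 (measure_singleton (μ := (volume : Measure ℝ)) T)] with τ h1 h2 h3
    rw [uIoc_of_le ht.1] at h3
    refine (norm_exp_mul_le hlam h3.2 _).trans (h1 ⟨h3.1, ?_⟩)
    exact lt_of_le_of_ne (h3.2.trans ht.2) h2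
  refine h1.trans ?_
  rw [sub_zero, abs_of_nonneg ht.1, mul_comm]
  exact mul_le_mul_of_nonneg_right ht.2 hM

lemma intervalIntegrable_of_Ioo {T t : ℝ} {g : ℝ → ℂ} (hg : IntegrableOn g (Ioo 0 T))
    (ht : t ∈ Icc 0 T) : IntervalIntegrable g volume 0 t := by
  rw [intervalIntegrable_iff_integrableOn_Ioo_of_le ht.1]
  exact hg.mono_set (Ioo_subset_Ioo_right ht.2)

lemma SolvesModes.eq_duhamel {α T : ℝ} {w : ℝ → L2} {g : ℝ → (Fin 2 → ℤ) → ℂ}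
    (h : SolvesModes α T w g) (k : Fin 2 → ℤ)
    (hw : IntegrableOn (fun t => fourierCoeffR (w t) k) (Ioo 0 T))
    (hg : IntegrableOn (fun t => g t k) (Ioo 0 T)) :
    ∀ᵐ t ∂(volume.restrict (Ioo 0 T)), fourierCoeffR (w t) k
      = ∫ τ in (0 : ℝ)..t, (Real.exp (-(eig α k * (t - τ))) : ℂ) * g τ k := by
  filter_upwards [h k, ae_restrict_mem measurableSet_Ioo] with t h1 ht
  rw [h1]
  have ht' := Ioo_subset_Icc_self ht
  refine ActiveScalar.eq_duhamel ht.1.le (intervalIntegrable_of_Ioo hg ht')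
    (intervalIntegrable_of_Ioo hw ht') ?_
  exact ae_mono (Measure.restrict_mono_set _ (Ioo_subset_Ioo_right ht.2.le)) (h k)

lemma integrableOn_coeff_of_continuousOn {T : ℝ} {w : ℝ → L2} (hw : ContinuousOn w (Icc 0 T))
    (k : Fin 2 → ℤ) : IntegrableOn (fun t => fourierCoeffR (w t) k) (Ioo 0 T) :=
  (((coeffCLM k).continuous.comp_continuousOn hw).integrableOn_Icc).mono_set Ioo_subset_Icc_self

lemma fourierCoeffR_zero_fun (k : Fin 2 → ℤ) : fourierCoeffR (fun _ => 0) k = 0 := by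
  rw [fourierCoeffR_eq]; simp

/-- The solution of the linear equation with a smooth source is a smooth profile. -/
lemma IsHeatSolution.exists_profile {α T : ℝ} (hT : 0 < T) {f : ℝ × Torus → ℝ} {w : ℝ → L2}
    (hf : IsSource T f) (hw : IsHeatSolution α T f w) :
    SolvesModes α T w (fun t k => fourierCoeffR (fun x => f (t, x)) k) ∧
    ∃ a : (Fin 2 → ℤ) → ℝ, (∀ k, 0 ≤ a k) ∧ (Summable fun k => bracket k ^ (3 / 2 : ℝ) * a k) ∧
      IsProfile T a w := by
  have hwi := integrableOn_coeff_of_continuousOn hw.continuousOn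
  have hmode : SolvesModes α T w (fun t k => fourierCoeffR (fun x => f (t, x)) k) := by
    intro k
    have := hw.equation.mode hT k (hwi k) (Eventually.of_forall fun t i => integrable_zero _ _ _)
      (fun i => by simp only [fourierCoeffR_zero_fun]; exact integrableOn_zero)
      (hf.integrableOn_coeff k)
    simpa only [fourierCoeffR_zero_fun, mul_zero, Finset.sum_const_zero, sub_zero] using this
  obtain ⟨C, hC, hfC⟩ := hf.exists_coeff_le
  refine ⟨hmode, fun k => T * (C * bracket k ^ (-3 : ℝ)), fun k => ?_, ?_,
    hw.memL2H.1, ?_⟩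
  · have := Real.rpow_nonneg (bracket_pos k).le (-3 : ℝ)
    positivity
  · refine ((summable_bracket_rpow (r := 3 / 2) (by norm_num)).mul_left (T * C)).congr fun k => ?_
    rw [show (-(3 / 2) : ℝ) = 3 / 2 + (-3) by norm_num, Real.rpow_add (bracket_pos k)]
    ring
  · refine ae_all_iff.2 fun k => ?_
    filter_upwards [hmode.eq_duhamel k (hwi k) (hf.integrableOn_coeff k),
      ae_restrict_mem measurableSet_Ioo] with t h1 ht
    rw [h1]
    refine norm_duhamel_le (eig_nonneg α k) (Ioo_subset_Icc_self ht)
      (mul_nonneg hC (Real.rpow_nonneg (bracket_pos k).le _)) ?_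
    filter_upwards [ae_restrict_mem measurableSet_Ioo] with τ hτ
    exact hfC τ (Ioo_subset_Icc_self hτ) k

lemma continuousOn_duhamel {lam T : ℝ} (hT : 0 < T) {g : ℝ → ℂ} (hg : IntegrableOn g (Ioo 0 T)) :
    ContinuousOn (fun t => ∫ τ in (0 : ℝ)..t, (Real.exp (-(lam * (t - τ))) : ℂ) * g τ)
      (Icc 0 T) := by
  have e : ∀ t : ℝ, ∫ τ in (0 : ℝ)..t, (Real.exp (-(lam * (t - τ))) : ℂ) * g τ
      = (Real.exp (-(lam * t)) : ℂ) * ∫ τ in (0 : ℝ)..t, (Real.exp (lam * τ) : ℂ) * g τ := by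
    intro t
    rw [← intervalIntegral.integral_const_mul]
    refine intervalIntegral.integral_congr fun τ _ => ?_
    rw [← mul_assoc, ← Complex.ofReal_mul, ← Real.exp_add]
    congr 3; ring
  simp only [e]
  have hi : IntervalIntegrable (fun τ => (Real.exp (lam * τ) : ℂ) * g τ) volume 0 T :=
    (intervalIntegrable_of_Ioo hg ⟨hT.le, le_rfl⟩).continuousOn_mul (by fun_prop)
  have h2 := intervalIntegral.continuousOn_primitive_interval' hi (a := 0) (by simp)
  rw [uIcc_of_le hT.le] at h2
  exact ContinuousOn.mul (by fun_prop) h2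

/-- The second order profile generated by `w`. -/
lemma IsProfile.exists_second {K : Torus → ℝ} (hK : IsAdmissibleKernel K) {α T : ℝ} (hT : 0 < T)
    {a : (Fin 2 → ℤ) → ℝ} {w : ℝ → L2} (ha0 : ∀ k, 0 ≤ a k)
    (ha : Summable fun k => bracket k ^ (3 / 2 : ℝ) * a k) (hw : IsProfile T a w) :
    ∃ (z : ℝ → L2) (n : (Fin 2 → ℤ) → ℝ), (∀ k, 0 ≤ n k) ∧ (Summable fun k => bracket k * n k) ∧
      IsProfile T n z ∧ ContinuousOn z (Icc 0 T) ∧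
      SolvesModes α T z (fun t k => -adv hK (w t) (w t) k) := by
  have h0 := driftBound_nonneg hK
  have hasum := summable_of_bracket_mul (by norm_num) ha0 ha
  set M : (Fin 2 → ℤ) → ℝ := fun k =>
    4 * Real.pi * driftBound hK * (freqNorm k * ∑' l, a (k - l) * a l) with hM
  have hM0 : ∀ k, 0 ≤ M k := fun k => by
    have := freqNorm_nonneg k
    have : 0 ≤ ∑' l, a (k - l) * a l := tsum_nonneg fun l => mul_nonneg (ha0 _) (ha0 _)
    positivity
  have hMs : Summable fun k => bracket k * (T * M k) :=
    ((summable_bracket_mul_conv ha0 ha).mul_left (T * (4 * Real.pi * driftBound hK))).congr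
      fun k => by simp only [hM]; ring
  have hn0 : ∀ k, 0 ≤ T * M k := fun k => mul_nonneg hT.le (hM0 k)
  have hns : Summable fun k => T * M k :=
    Summable.of_nonneg_of_le hn0 (fun k => le_mul_of_one_le_left (hn0 k) (one_le_bracket k)) hMs
  have hns2 : Summable fun k => (T * M k) ^ 2 := by
    refine Summable.of_nonneg_of_le (fun k => sq_nonneg _) (fun k => ?_)
      (hns.mul_left (∑' l, T * M l))
    rw [sq]
    exact mul_le_mul_of_nonneg_right (hns.le_tsum k fun _ _ => hn0 _) (hn0 k)
  set g : (Fin 2 → ℤ) → ℝ → ℂ := fun k τ => -adv hK (w τ) (w τ) k with hg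
  have hgb : ∀ k, ∀ᵐ τ ∂(volume.restrict (Ioo 0 T)), ‖g k τ‖ ≤ M k := fun k => by
    filter_upwards [hw.bound] with τ h1
    rw [hg, norm_neg]
    exact norm_adv_le_conv hK hasum h1 h1 k
  have hgi : ∀ k, IntegrableOn (g k) (Ioo 0 T) := fun k =>
    Integrable.of_bound (aestronglyMeasurable_adv hK hw.meas hw.meas k).neg (M k) (hgb k)
  set c : (Fin 2 → ℤ) → ℝ → ℂ := fun k t =>
    ∫ τ in (0 : ℝ)..t, (Real.exp (-(eig α k * (t - τ))) : ℂ) * g k τ with hc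
  have hcb : ∀ k, ∀ t ∈ Icc 0 T, ‖c k t‖ ≤ T * M k := fun k t ht =>
    norm_duhamel_le (eig_nonneg α k) ht (hM0 k) (hgb k)
  have hsymm : ∀ k t, c (-k) t = conj (c k t) := by
    intro k t
    have he : eig α (-k) = eig α k := by rw [eig, eig, freqNorm_neg]
    simp only [hc, hg, he, adv_neg_freq]
    rw [← intervalIntegral.intervalIntegral_conj]
    refine intervalIntegral.integral_congr fun τ _ => ?_
    simp only [map_mul, map_neg, Complex.conj_ofReal]
  -- The conjugation symmetry of the Duhamel modes makes the resulting function real. Outside `[0,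
  -- T]` the value is irrelevant and set to zero.
  have hex : ∀ t, ∃ z : L2, t ∈ Icc 0 T → ∀ k, fourierCoeffR z k = c k t := by
    intro t
    by_cases ht : t ∈ Icc 0 T
    · obtain ⟨z, hz⟩ := exists_L2_of_summable (c := fun k => c k t)
        (Summable.of_nonneg_of_le (fun k => sq_nonneg _)
          (fun k => pow_le_pow_left₀ (norm_nonneg _) (hcb k t ht) 2) hns2) (fun k => hsymm k t)
      exact ⟨z, fun _ => hz⟩
    · exact ⟨0, fun h => absurd h ht⟩
  choose z hz using hex
  have hcc : ∀ k, ContinuousOn (c k) (Icc 0 T) := fun k => continuousOn_duhamel hT (hgi k)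
  have hzc : ContinuousOn z (Icc 0 T) := by
    refine L2.continuousOn_of_modes (fun k => (hcc k).congr fun t ht => hz t ht k) ?_
    have : ContinuousOn (fun t => ∑' k, ‖c k t‖ ^ 2) (Icc 0 T) := by
      refine continuousOn_tsum (fun k => (hcc k).norm.pow 2) hns2 fun k t ht => ?_
      rw [norm_pow, norm_norm]
      exact pow_le_pow_left₀ (norm_nonneg _) (hcb k t ht) 2
    refine this.congr fun t ht => ?_
    rw [← (L2.hasSum_sq (z t)).tsum_eq]
    simp only [hz t ht]
  refine ⟨z, fun k => T * M k, hn0, hMs, ⟨?_, ?_⟩, hzc, fun k => ?_⟩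
  · exact (hzc.mono Ioo_subset_Icc_self).aestronglyMeasurable measurableSet_Ioo
  · filter_upwards [ae_restrict_mem measurableSet_Ioo] with t ht k
    rw [hz t (Ioo_subset_Icc_self ht)]
    exact hcb k t (Ioo_subset_Icc_self ht)
  · filter_upwards [ae_restrict_mem measurableSet_Ioo] with t ht
    have ht' := Ioo_subset_Icc_self ht
    rw [hz t ht', hc]
    simp only
    rw [duhamel_eq (intervalIntegrable_of_Ioo (hgi k) ht')]
    refine intervalIntegral.integral_congr fun σ hσ => ?_
    rw [uIcc_of_le ht.1.le] at hσ
    rw [hz σ ⟨hσ.1, hσ.2.trans ht'.2⟩ k]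

end

section

open UnitAddTorus ComplexConjugate Filter Topology

/-! ### Sobolev norms and the a priori properties of solutions -/

/-- The square of the `H^r` norm. -/
def sobolevSq (r : ℝ) (g : Torus → ℝ) : ℝ≥0∞ :=
  ∑' k, ENNReal.ofReal (bracket k ^ r) * ‖fourierCoeffR g k‖ₑ ^ 2

lemma sobolevNorm_sq (r : ℝ) (g : Torus → ℝ) : sobolevNorm r g ^ 2 = sobolevSq r g := by
  rw [sobolevNorm, ← ENNReal.rpow_natCast, ← ENNReal.rpow_mul]
  simp [sobolevSq, bracket]

lemma sobolevSq_mono {r r' : ℝ} (h : r ≤ r') (g : Torus → ℝ) : sobolevSq r g ≤ sobolevSq r' g := by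
  refine ENNReal.tsum_le_tsum fun k => ?_
  gcongr
  exact one_le_bracket k

lemma enorm_add_sq_le (x y : ℂ) : ‖x + y‖ₑ ^ 2 ≤ 2 * ‖x‖ₑ ^ 2 + 2 * ‖y‖ₑ ^ 2 := by
  have h : ‖x + y‖ ^ 2 ≤ 2 * ‖x‖ ^ 2 + 2 * ‖y‖ ^ 2 := by
    have := norm_add_le x y
    nlinarith [norm_nonneg (x + y), sq_nonneg (‖x‖ - ‖y‖), norm_nonneg x, norm_nonneg y]
  have e : ∀ z : ℂ, ‖z‖ₑ ^ 2 = ENNReal.ofReal (‖z‖ ^ 2) := fun z => by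
    rw [← ofReal_norm, ENNReal.ofReal_pow (norm_nonneg z)]
  rw [e, e, e, ← ENNReal.ofReal_ofNat 2, ← ENNReal.ofReal_mul two_pos.le,
    ← ENNReal.ofReal_mul two_pos.le, ← ENNReal.ofReal_add (by positivity) (by positivity)]
  exact ENNReal.ofReal_le_ofReal h

lemma sobolevSq_add_le (r : ℝ) (a b : L2) :
    sobolevSq r (a + b : L2) ≤ 2 * sobolevSq r a + 2 * sobolevSq r b := by
  simp only [sobolevSq]
  rw [← ENNReal.tsum_mul_left, ← ENNReal.tsum_mul_left, ← ENNReal.tsum_add]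
  refine ENNReal.tsum_le_tsum fun k => ?_
  rw [L2.fourierCoeffR_add]
  refine (mul_le_mul_right (enorm_add_sq_le _ _) _).trans_eq ?_
  ring

lemma sobolevSq_smul (r c : ℝ) (a : L2) :
    sobolevSq r (c • a : L2) = ENNReal.ofReal (c ^ 2) * sobolevSq r a := by
  simp only [sobolevSq]
  rw [← ENNReal.tsum_mul_left]
  refine tsum_congr fun k => ?_
  have e : ‖(c : ℂ)‖ₑ ^ 2 = ENNReal.ofReal (c ^ 2) := by
    rw [← ofReal_norm, ← ENNReal.ofReal_pow (norm_nonneg _), Complex.norm_real, Real.norm_eq_abs,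
      sq_abs]
  rw [L2.fourierCoeffR_smul, enorm_mul, mul_pow, e]
  ring

lemma sobolevSq_sub_le (r : ℝ) (a b : L2) :
    sobolevSq r (a - b : L2) ≤ 2 * sobolevSq r a + 2 * sobolevSq r b := by
  have h := sobolevSq_add_le r a ((-1 : ℝ) • b)
  rw [sobolevSq_smul] at h
  simpa [sub_eq_add_neg] using h

lemma normL2H_lt_top_iff {T r : ℝ} {h : ℝ → L2} :
    normL2H T r h < ⊤ ↔ ∫⁻ t in Ioo 0 T, sobolevSq r (h t) < ⊤ := by
  simp only [normL2H, sobolevNorm_sq]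
  exact ENNReal.rpow_lt_top_iff_of_pos (by norm_num)

lemma aemeasurable_weighted {X : Type*} [MeasurableSpace X] {ν : Measure X} {h : X → L2}
    (hh : AEStronglyMeasurable h ν) (c : (Fin 2 → ℤ) → ℝ) :
    AEMeasurable (fun t => ∑' k, ENNReal.ofReal (c k) * ‖fourierCoeffR (h t) k‖ₑ ^ 2) ν :=
  AEMeasurable.tsum fun k =>
    (((aestronglyMeasurable_coeff hh k).enorm).pow_const 2).const_mul _

lemma aemeasurable_sobolevSq {X : Type*} [MeasurableSpace X] {ν : Measure X} {h : X → L2}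
    (hh : AEStronglyMeasurable h ν) (r : ℝ) : AEMeasurable (fun t => sobolevSq r (h t)) ν :=
  aemeasurable_weighted hh _

/-- The bridge from extended-valued Sobolev integrals to real series and Bochner integrals. It
serves both for the `H^α` norm and for the dissipation. -/
lemma weighted_integrable {X : Type*} [MeasurableSpace X] {ν : Measure X} {h : X → L2}
    (hh : AEStronglyMeasurable h ν) {c : (Fin 2 → ℤ) → ℝ} (hc : ∀ k, 0 ≤ c k)
    (hfin : ∫⁻ t, ∑' k, ENNReal.ofReal (c k) * ‖fourierCoeffR (h t) k‖ₑ ^ 2 ∂ν ≠ ⊤) :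
    (∀ᵐ t ∂ν, Summable fun k => c k * ‖fourierCoeffR (h t) k‖ ^ 2) ∧
    Integrable (fun t => ∑' k, c k * ‖fourierCoeffR (h t) k‖ ^ 2) ν ∧
    ∫⁻ t, ∑' k, ENNReal.ofReal (c k) * ‖fourierCoeffR (h t) k‖ₑ ^ 2 ∂ν
      = ENNReal.ofReal (∫ t, ∑' k, c k * ‖fourierCoeffR (h t) k‖ ^ 2 ∂ν) := by
  set G : X → ℝ≥0∞ := fun t => ∑' k, ENNReal.ofReal (c k) * ‖fourierCoeffR (h t) k‖ₑ ^ 2 with hG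
  have hGm : AEMeasurable G ν := aemeasurable_weighted hh c
  have e : ∀ t k, (ENNReal.ofReal (c k) * ‖fourierCoeffR (h t) k‖ₑ ^ 2)
      = ENNReal.ofReal (c k * ‖fourierCoeffR (h t) k‖ ^ 2) := fun t k => by
    rw [ENNReal.ofReal_mul (hc k), ENNReal.ofReal_pow (norm_nonneg _), ofReal_norm]
  have hnn : ∀ t k, 0 ≤ c k * ‖fourierCoeffR (h t) k‖ ^ 2 := fun t k =>
    mul_nonneg (hc k) (sq_nonneg _)
  have hlt : ∀ᵐ t ∂ν, G t < ⊤ := ae_lt_top' hGm hfin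
  have hsum : ∀ᵐ t ∂ν, Summable fun k => c k * ‖fourierCoeffR (h t) k‖ ^ 2 := by
    filter_upwards [hlt] with t ht
    have h1 := ENNReal.summable_toReal ht.ne
    refine h1.congr fun k => ?_
    rw [e, ENNReal.toReal_ofReal (hnn t k)]
  have heq : (fun t => (G t).toReal) =ᵐ[ν] fun t => ∑' k, c k * ‖fourierCoeffR (h t) k‖ ^ 2 := by
    filter_upwards [hsum] with t ht
    simp only [hG, e]
    rw [← ENNReal.ofReal_tsum_of_nonneg (hnn t) ht, ENNReal.toReal_ofReal (tsum_nonneg (hnn t))]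
  have hint := integrable_toReal_of_lintegral_ne_top hGm hfin
  refine ⟨hsum, hint.congr heq, ?_⟩
  rw [← integral_congr_ae heq, integral_toReal hGm hlt, ENNReal.ofReal_toReal hfin]

/-- The constant `40` dominates `(2π)²`. -/
lemma eig_le_bracket {α : ℝ} (hα : 0 ≤ α) (hα' : α ≤ 1) (k : Fin 2 → ℤ) :
    eig α k ≤ 40 * bracket k ^ α := by
  have hk := freqNorm_nonneg k
  have hpi := Real.pi_gt_three
  have hpi' := Real.pi_lt_d2
  rw [eig, Real.mul_rpow (by positivity) hk]
  have h1 : (2 * Real.pi) ^ (2 * α) ≤ 40 := by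
    calc (2 * Real.pi) ^ (2 * α) ≤ (2 * Real.pi) ^ (2 : ℝ) :=
          Real.rpow_le_rpow_of_exponent_le (by linarith) (by linarith)
      _ = (2 * Real.pi) ^ 2 := Real.rpow_two _
      _ ≤ 40 := by nlinarith
  have h2 : freqNorm k ^ (2 * α) ≤ bracket k ^ α := by
    rw [Real.rpow_mul hk, Real.rpow_two]
    exact Real.rpow_le_rpow (sq_nonneg _) (freqNorm_sq_le_bracket k) hα
  exact mul_le_mul h1 h2 (Real.rpow_nonneg hk _) (by norm_num)

/-- Subadditivity of `x ↦ x^α` together with `2π ≥ 1`. It recovers the `H^α` norm from the `L²` norm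
and the dissipation. -/
lemma bracket_rpow_le {α : ℝ} (hα : 0 ≤ α) (hα' : α ≤ 1) (k : Fin 2 → ℤ) :
    bracket k ^ α ≤ 1 + eig α k := by
  have hk := freqNorm_nonneg k
  have hpi := Real.pi_gt_three
  have h1 : bracket k ^ α ≤ 1 ^ α + (freqNorm k ^ 2) ^ α :=
    Real.rpow_add_le_add_rpow zero_le_one (sq_nonneg _) hα hα'
  have h2 : (freqNorm k ^ 2) ^ α ≤ eig α k := by
    rw [eig, Real.rpow_mul (by positivity), Real.rpow_two]
    refine Real.rpow_le_rpow (sq_nonneg _) ?_ hα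
    rw [mul_pow]
    exact le_mul_of_one_le_left (sq_nonneg _) (by nlinarith)
  rw [Real.one_rpow] at h1
  linarith

lemma bracket_rpow_le_self {α : ℝ} (hα' : α ≤ 1) (k : Fin 2 → ℤ) : bracket k ^ α ≤ bracket k := by
  have := Real.rpow_le_rpow_of_exponent_le (one_le_bracket k) hα'
  rwa [Real.rpow_one] at this

lemma summable_of_bracket_mul_one {a : (Fin 2 → ℤ) → ℝ} (h0 : ∀ k, 0 ≤ a k)
    (h : Summable fun k => bracket k * a k) : Summable a :=
  Summable.of_nonneg_of_le h0 (fun k => le_mul_of_one_le_left (h0 k) (one_le_bracket k)) h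

lemma tsum_le_tsum_bracket_mul {a : (Fin 2 → ℤ) → ℝ} (h0 : ∀ k, 0 ≤ a k)
    (h : Summable fun k => bracket k * a k) : ∑' k, a k ≤ ∑' k, bracket k * a k :=
  (summable_of_bracket_mul_one h0 h).tsum_le_tsum
    (fun k => le_mul_of_one_le_left (h0 k) (one_le_bracket k)) h

/-- A weighted form of `ℓ¹ ⊂ ℓ²`: one factor `a k` is bounded by the whole sum, the weights being at
least `1`. -/
lemma hasSum_le_sq_tsum {a b c : (Fin 2 → ℤ) → ℝ} {s : ℝ} (h0 : ∀ k, 0 ≤ a k)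
    (hc : ∀ k, 1 ≤ c k) (h : Summable fun k => c k * a k) (hb0 : ∀ k, 0 ≤ b k)
    (hb : ∀ k, b k ≤ a k) (hs : HasSum (fun k => c k * b k ^ 2) s) :
    s ≤ (∑' k, c k * a k) ^ 2 := by
  have hca : ∀ k, 0 ≤ c k * a k := fun k => mul_nonneg (zero_le_one.trans (hc k)) (h0 k)
  rw [sq, ← tsum_mul_left]
  refine hasSum_le (fun k => ?_) hs (h.mul_left _).hasSum
  have h1 : a k ≤ ∑' k, c k * a k :=
    (le_mul_of_one_le_left (h0 k) (hc k)).trans (h.le_tsum k fun _ _ => hca _)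
  calc c k * b k ^ 2 ≤ c k * (a k * a k) := by
        have := hc k
        rw [sq]
        exact mul_le_mul_of_nonneg_left (mul_self_le_mul_self (hb0 k) (hb k)) (by linarith)
    _ = a k * (c k * a k) := by ring
    _ ≤ _ := mul_le_mul_of_nonneg_right h1 (hca k)

lemma L2.norm_le_tsum {g : L2} {a : (Fin 2 → ℤ) → ℝ} (h0 : ∀ k, 0 ≤ a k)
    (h : Summable fun k => bracket k * a k) (hg : ∀ k, ‖fourierCoeffR g k‖ ≤ a k) :
    ‖g‖ ≤ ∑' k, bracket k * a k := by
  refine le_trans ?_ (tsum_le_tsum_bracket_mul h0 h)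
  refine le_of_sq_le_sq ?_ (tsum_nonneg h0)
  have := hasSum_le_sq_tsum (c := fun _ => 1) (a := a) (b := fun k => ‖fourierCoeffR g k‖) h0
    (fun _ => le_rfl) (by simpa using summable_of_bracket_mul_one h0 h) (fun _ => norm_nonneg _) hg
    (by simpa using L2.hasSum_sq g)
  simpa using this

lemma summable_freqNorm_mul_coeff {g : L2} {a : (Fin 2 → ℤ) → ℝ}
    (h : Summable fun k => bracket k * a k) (hg : ∀ k, ‖fourierCoeffR g k‖ ≤ a k) :
    (Summable fun k => freqNorm k * ‖fourierCoeffR g k‖) ∧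
      ∑' k, freqNorm k * ‖fourierCoeffR g k‖ ≤ ∑' k, bracket k * a k := by
  have hle : ∀ k, freqNorm k * ‖fourierCoeffR g k‖ ≤ bracket k * a k := fun k =>
    mul_le_mul (freqNorm_le_bracket k) (hg k) (norm_nonneg _) (bracket_pos k).le
  have hs : Summable fun k => freqNorm k * ‖fourierCoeffR g k‖ :=
    Summable.of_nonneg_of_le (fun k => mul_nonneg (freqNorm_nonneg k) (norm_nonneg _)) hle h
  exact ⟨hs, hs.tsum_le_tsum hle h⟩

lemma sobolevSq_le_of_coeff_le {α : ℝ} (hα' : α ≤ 1) {g : L2} {a : (Fin 2 → ℤ) → ℝ}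
    (h0 : ∀ k, 0 ≤ a k) (h : Summable fun k => bracket k * a k)
    (hg : ∀ k, ‖fourierCoeffR g k‖ ≤ a k) :
    sobolevSq α g ≤ ENNReal.ofReal ((∑' k, bracket k * a k) ^ 2) := by
  have e : ∀ k, (ENNReal.ofReal (bracket k ^ α) * ‖fourierCoeffR g k‖ₑ ^ 2)
      = ENNReal.ofReal (bracket k ^ α * ‖fourierCoeffR g k‖ ^ 2) := fun k => by
    rw [ENNReal.ofReal_mul (Real.rpow_nonneg (bracket_pos k).le _),
      ENNReal.ofReal_pow (norm_nonneg _), ofReal_norm]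
  have hba : ∀ k, 0 ≤ bracket k * a k := fun k => mul_nonneg (bracket_pos k).le (h0 k)
  have hs : Summable fun k => bracket k * ‖fourierCoeffR g k‖ ^ 2 := by
    refine Summable.of_nonneg_of_le (fun k => mul_nonneg (bracket_pos k).le (sq_nonneg _))
      (fun k => ?_) (h.mul_right ‖g‖)
    rw [sq, ← mul_assoc]
    exact mul_le_mul (mul_le_mul_of_nonneg_left (hg k) (bracket_pos k).le)
      (L2.norm_fourierCoeffR_le g k) (norm_nonneg _) (hba k)
  simp only [sobolevSq, e]
  have hle : ∀ k, bracket k ^ α * ‖fourierCoeffR g k‖ ^ 2 ≤ bracket k * ‖fourierCoeffR g k‖ ^ 2 :=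
    fun k => mul_le_mul_of_nonneg_right (bracket_rpow_le_self hα' k) (sq_nonneg _)
  have hnn : ∀ k, 0 ≤ bracket k ^ α * ‖fourierCoeffR g k‖ ^ 2 := fun k =>
    mul_nonneg (Real.rpow_nonneg (bracket_pos k).le _) (sq_nonneg _)
  have hs' := Summable.of_nonneg_of_le hnn hle hs
  rw [← ENNReal.ofReal_tsum_of_nonneg hnn hs']
  refine ENNReal.ofReal_le_ofReal ((hs'.tsum_le_tsum hle hs).trans ?_)
  exact hasSum_le_sq_tsum h0 one_le_bracket h (fun _ => norm_nonneg _) hg hs.hasSum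

lemma IsProfile.lintegral_sobolevSq_lt_top {α T : ℝ} (hα' : α ≤ 1) {a : (Fin 2 → ℤ) → ℝ}
    {w : ℝ → L2} (hw : IsProfile T a w) (h0 : ∀ k, 0 ≤ a k)
    (h : Summable fun k => bracket k * a k) :
    ∫⁻ t in Ioo 0 T, sobolevSq α (w t) < ⊤ := by
  refine lt_of_le_of_lt (lintegral_mono_ae (g := fun _ =>
    ENNReal.ofReal ((∑' k, bracket k * a k) ^ 2)) ?_) ?_
  · filter_upwards [hw.bound] with t ht
    exact sobolevSq_le_of_coeff_le hα' h0 h ht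
  · rw [lintegral_const]
    exact ENNReal.mul_lt_top ENNReal.ofReal_lt_top (by simp)

section Solution

variable {K : Torus → ℝ} (hK : IsAdmissibleKernel K)

/-- The coefficient of the product is a pointwise limit of finite convolution sums, each measurable
in `t`. -/
lemma aestronglyMeasurable_coeff_drift_mul {X : Type*} [MeasurableSpace X] {ν : Measure X}
    {a b : X → L2} (ha : AEStronglyMeasurable a ν) (hb : AEStronglyMeasurable b ν) (i : Fin 2)
    (k : Fin 2 → ℤ) :
    AEStronglyMeasurable (fun t => fourierCoeffR (fun x => drift hK (a t) i x * b t x) k) ν := by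
  refine aestronglyMeasurable_of_tendsto_ae (atTop : Filter (Finset (Fin 2 → ℤ)))
    (f := fun s t => ∑ l ∈ s, driftSymbol K i (k - l) * fourierCoeffR (a t) (k - l)
      * fourierCoeffR (b t) l) (fun s => ?_) (Eventually.of_forall fun t => ?_)
  · exact Finset.aestronglyMeasurable_fun_sum s fun l _ =>
      ((aestronglyMeasurable_coeff ha _).const_mul _).mul (aestronglyMeasurable_coeff hb _)
  · have := hasSum_fourierCoeffR_mul (Lp.memLp (drift hK (a t) i)) (Lp.memLp (b t)) k
    simp only [fourierCoeffR_drift] at this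
    exact this

lemma two_lt_of_inv {α q : ℝ} (hα' : α < 1) (hq : 0 < 1 / q) (hq' : 1 / q < α - 1 / 2) : 2 < q := by
  have hq0 : 0 < q := by simpa using hq
  have h : 1 / q < 1 / 2 := by linarith
  rwa [one_div_lt_one_div hq0 two_pos] at h

lemma MemLinftyLq.exists_norm_le {T q : ℝ} (hq : 2 ≤ q) {θ : ℝ → L2} (h : MemLinftyLq T q θ) :
    ∃ R : ℝ, 0 ≤ R ∧ ∀ᵐ t ∂(volume.restrict (Ioo 0 T)), ‖θ t‖ ≤ R := by
  refine ⟨(essSup (fun t => eLpNorm (θ t) (ENNReal.ofReal q) torusMeasure)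
    (volume.restrict (Ioo 0 T))).toReal, ENNReal.toReal_nonneg, ?_⟩
  filter_upwards [ae_le_essSup (f := fun t => eLpNorm (θ t) (ENNReal.ofReal q) torusMeasure)
    (μ := volume.restrict (Ioo 0 T))] with t ht
  rw [Lp.norm_def]
  refine ENNReal.toReal_mono h.2.ne (le_trans ?_ ht)
  refine eLpNorm_le_eLpNorm_of_exponent_le ?_ (Lp.aestronglyMeasurable _)
  rw [← ENNReal.ofReal_ofNat 2]
  exact ENNReal.ofReal_le_ofReal hq

lemma MemLinftyLq.exists_drift_le {T q : ℝ} (hq : 2 ≤ q) {θ : ℝ → L2} (h : MemLinftyLq T q θ) :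
    ∃ U : ℝ, ∀ᵐ t ∂(volume.restrict (Ioo 0 T)), ∀ i,
      MemLp (drift hK (θ t) i) (ENNReal.ofReal q) torusMeasure ∧
      ∫ x, |drift hK (θ t) i x| ^ q ∂torusMeasure ≤ U := by
  obtain ⟨C, hC⟩ := hK.exists_eLpNorm_drift_le hq
  set S := essSup (fun t => eLpNorm (θ t) (ENNReal.ofReal q) torusMeasure)
    (volume.restrict (Ioo 0 T)) with hS
  have hq0 : 0 < q := by linarith
  refine ⟨(ENNReal.ofReal C * S).toReal ^ q, ?_⟩
  filter_upwards [ae_le_essSup (f := fun t => eLpNorm (θ t) (ENNReal.ofReal q) torusMeasure)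
    (μ := volume.restrict (Ioo 0 T))] with t ht i
  have hmem : MemLp (θ t) (ENNReal.ofReal q) torusMeasure :=
    ⟨Lp.aestronglyMeasurable _, ht.trans_lt h.2⟩
  obtain ⟨h1, h2⟩ := hC (θ t) (drift hK (θ t)) (isDrift_drift hK (θ t)) hmem i
  refine ⟨h1, ?_⟩
  have h3 : eLpNorm (drift hK (θ t) i) (ENNReal.ofReal q) torusMeasure ≤ ENNReal.ofReal C * S :=
    h2.trans (by gcongr)
  rw [h1.eLpNorm_eq_integral_rpow_norm (by simpa using hq0) (by simp),
    ENNReal.toReal_ofReal hq0.le] at h3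
  have hI : 0 ≤ ∫ x, ‖drift hK (θ t) i x‖ ^ q ∂torusMeasure :=
    integral_nonneg fun x => Real.rpow_nonneg (norm_nonneg _) _
  have h4 := ENNReal.toReal_mono (ENNReal.mul_ne_top ENNReal.ofReal_ne_top h.2.ne) h3
  rw [ENNReal.toReal_ofReal (Real.rpow_nonneg hI _)] at h4
  have h5 := Real.rpow_le_rpow (Real.rpow_nonneg hI _) h4 hq0.le
  rwa [← Real.rpow_mul hI, inv_mul_cancel₀ hq0.ne', Real.rpow_one] at h5

lemma integrableOn_of_ae_norm_le {T R : ℝ} {h : ℝ → ℂ}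
    (hm : AEStronglyMeasurable h (volume.restrict (Ioo 0 T)))
    (hR : ∀ᵐ t ∂(volume.restrict (Ioo 0 T)), ‖h t‖ ≤ R) : IntegrableOn h (Ioo 0 T) :=
  Integrable.of_bound hm R hR

lemma integrableOn_coeff {T R : ℝ} {θ : ℝ → L2}
    (hm : AEStronglyMeasurable θ (volume.restrict (Ioo 0 T)))
    (hR : ∀ᵐ t ∂(volume.restrict (Ioo 0 T)), ‖θ t‖ ≤ R) (k : Fin 2 → ℤ) :
    IntegrableOn (fun t => fourierCoeffR (θ t) k) (Ioo 0 T) :=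
  integrableOn_of_ae_norm_le (aestronglyMeasurable_coeff hm k)
    (hR.mono fun _ ht => (L2.norm_fourierCoeffR_le _ k).trans ht)

lemma integrableOn_adv {T R S : ℝ} {a b : ℝ → L2}
    (ha : AEStronglyMeasurable a (volume.restrict (Ioo 0 T)))
    (hb : AEStronglyMeasurable b (volume.restrict (Ioo 0 T)))
    (hR : ∀ᵐ t ∂(volume.restrict (Ioo 0 T)), ‖a t‖ ≤ R)
    (hS : ∀ᵐ t ∂(volume.restrict (Ioo 0 T)), ‖b t‖ ≤ S) (k : Fin 2 → ℤ) :
    IntegrableOn (fun t => adv hK (a t) (b t) k) (Ioo 0 T) := by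
  have h0 := driftBound_nonneg hK
  have hk := freqNorm_nonneg k
  refine integrableOn_of_ae_norm_le (R := 4 * Real.pi * driftBound hK * freqNorm k * (R * S))
    (aestronglyMeasurable_adv hK ha hb k) ?_
  filter_upwards [hR, hS] with t h1 h2
  refine (norm_adv_le hK _ _ k).trans ?_
  have := mul_le_mul h1 h2 (norm_nonneg _) ((norm_nonneg _).trans h1)
  gcongr

lemma integrableOn_coeff_drift_mul {T R S : ℝ} {a b : ℝ → L2}
    (ha : AEStronglyMeasurable a (volume.restrict (Ioo 0 T)))
    (hb : AEStronglyMeasurable b (volume.restrict (Ioo 0 T)))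
    (hR : ∀ᵐ t ∂(volume.restrict (Ioo 0 T)), ‖a t‖ ≤ R)
    (hS : ∀ᵐ t ∂(volume.restrict (Ioo 0 T)), ‖b t‖ ≤ S) (i : Fin 2) (k : Fin 2 → ℤ) :
    IntegrableOn (fun t => fourierCoeffR (fun x => drift hK (a t) i x * b t x) k) (Ioo 0 T) := by
  have h0 := driftBound_nonneg hK
  refine integrableOn_of_ae_norm_le (R := driftBound hK * R * S)
    (aestronglyMeasurable_coeff_drift_mul hK ha hb i k) ?_
  filter_upwards [hR, hS] with t h1 h2
  refine (L2.norm_fourierCoeffR_mul_le _ _ k).trans ?_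
  have h3 := norm_drift_le hK (a t) i
  have h4 : 0 ≤ R := (norm_nonneg _).trans h1
  exact mul_le_mul (h3.trans (by gcongr)) h2 (norm_nonneg _) (by positivity)

lemma intervalIntegral_congr_ae_Ioo {T t : ℝ} {g h : ℝ → ℂ} (ht : t ∈ Icc 0 T)
    (e : ∀ᵐ τ ∂(volume.restrict (Ioo 0 T)), g τ = h τ) :
    ∫ τ in (0 : ℝ)..t, g τ = ∫ τ in (0 : ℝ)..t, h τ := by
  rw [intervalIntegral.integral_of_le ht.1, intervalIntegral.integral_of_le ht.1,
    integral_Ioc_eq_integral_Ioo, integral_Ioc_eq_integral_Ioo]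
  exact integral_congr_ae (ae_mono (Measure.restrict_mono_set _ (Ioo_subset_Ioo_right ht.2)) e)

lemma SolvesModes.congr {α T : ℝ} {w : ℝ → L2} {g g' : ℝ → (Fin 2 → ℤ) → ℂ}
    (h : SolvesModes α T w g)
    (e : ∀ᵐ t ∂(volume.restrict (Ioo 0 T)), ∀ k, g t k = g' t k) : SolvesModes α T w g' := by
  intro k
  filter_upwards [h k, ae_restrict_mem measurableSet_Ioo] with t h1 ht
  rw [h1]
  refine intervalIntegral_congr_ae_Ioo (Ioo_subset_Icc_self ht) ?_
  filter_upwards [e] with τ hτ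
  rw [hτ]

lemma WeakIVP.solvesModes {α T : ℝ} (hT : 0 < T) {θ : ℝ → L2} {F : ℝ → Fin 2 → Torus → ℝ}
    {f : ℝ × Torus → ℝ} (h : WeakIVP α T θ F f)
    (hθ : ∀ k, IntegrableOn (fun t => fourierCoeffR (θ t) k) (Ioo 0 T))
    (hFi : ∀ᵐ t ∂(volume.restrict (Ioo 0 T)), ∀ i, Integrable (F t i) torusMeasure)
    {G : ℝ → Fin 2 → (Fin 2 → ℤ) → ℂ} (hG : ∀ i k, IntegrableOn (fun t => G t i k) (Ioo 0 T))
    (hFG : ∀ᵐ t ∂(volume.restrict (Ioo 0 T)), ∀ i k, fourierCoeffR (F t i) k = G t i k)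
    (hf : ∀ k, IntegrableOn (fun t => fourierCoeffR (fun x => f (t, x)) k) (Ioo 0 T)) :
    SolvesModes α T θ (fun t k => fourierCoeffR (fun x => f (t, x)) k
      - 2 * Real.pi * Complex.I * ∑ i, (k i : ℂ) * G t i k) := by
  refine SolvesModes.congr (g := fun t k => fourierCoeffR (fun x => f (t, x)) k
      - 2 * Real.pi * Complex.I * ∑ i, (k i : ℂ) * fourierCoeffR (F t i) k)
    (fun k => h.mode hT k (hθ k) hFi (fun i => (hG i k).congr ?_) (hf k)) ?_
  · filter_upwards [hFG] with t ht
    exact (ht i k).symm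
  · filter_upwards [hFG] with t ht k
    simp only [ht]

lemma IsASESolution.lintegral_sobolevSq_lt_top {α s q T : ℝ} {f : ℝ × Torus → ℝ} {θ : ℝ → L2}
    (hs : 0 < s) (h : IsASESolution α s q T K f θ) : ∫⁻ t in Ioo 0 T, sobolevSq α (θ t) < ⊤ :=
  (lintegral_mono fun t => sobolevSq_mono (by linarith) _).trans_lt
    (normL2H_lt_top_iff.1 h.memL2H.2)

lemma IsASESolution.solvesModes {α s q T : ℝ} (hT : 0 < T) (hq : 2 ≤ q) {f : ℝ × Torus → ℝ}
    {θ : ℝ → L2} (h : IsASESolution α s q T K f θ)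
    (hf : ∀ k, IntegrableOn (fun t => fourierCoeffR (fun x => f (t, x)) k) (Ioo 0 T)) :
    SolvesModes α T θ (fun t k => fourierCoeffR (fun x => f (t, x)) k - adv hK (θ t) (θ t) k) := by
  obtain ⟨u, hu, heq⟩ := h.equation
  obtain ⟨R, -, hR⟩ := h.memLinftyLq.exists_norm_le hq
  have hm := h.memL2H.1
  refine heq.solvesModes hT (integrableOn_coeff hm hR)
    (Eventually.of_forall fun t i => (u t i).integrable_mul (θ t))
    (G := fun t i k => fourierCoeffR (fun x => drift hK (θ t) i x * θ t x) k)
    (fun i k => integrableOn_coeff_drift_mul hK hm hm hR hR i k) ?_ hf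
  filter_upwards [hu] with t ht i k
  rw [ht.eq_drift hK i]

lemma exists_norm_le_of_continuousOn {T : ℝ} {w : ℝ → L2} (h : ContinuousOn w (Icc 0 T)) :
    ∃ R : ℝ, ∀ᵐ t ∂(volume.restrict (Ioo 0 T)), ‖w t‖ ≤ R := by
  obtain ⟨R, hR⟩ := isCompact_Icc.exists_bound_of_continuousOn h
  refine ⟨R, ?_⟩
  filter_upwards [ae_restrict_mem measurableSet_Ioo] with t ht
  exact hR t (Ioo_subset_Icc_self ht)

lemma IsSecondLinearization.solvesModes {α T : ℝ} (hT : 0 < T) {w₁ w₂ v : ℝ → L2}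
    (hw₁ : ContinuousOn w₁ (Icc 0 T)) (hw₂ : ContinuousOn w₂ (Icc 0 T))
    (h : IsSecondLinearization α T K w₁ w₂ v) :
    SolvesModes α T v (fun t k => -(adv hK (w₁ t) (w₂ t) k + adv hK (w₂ t) (w₁ t) k)) := by
  obtain ⟨u₁, u₂, hu₁, hu₂, heq⟩ := h.equation
  obtain ⟨R₁, hR₁⟩ := exists_norm_le_of_continuousOn hw₁
  obtain ⟨R₂, hR₂⟩ := exists_norm_le_of_continuousOn hw₂
  have hm₁ := (hw₁.mono Ioo_subset_Icc_self).aestronglyMeasurable (μ := volume) measurableSet_Ioo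
  have hm₂ := (hw₂.mono Ioo_subset_Icc_self).aestronglyMeasurable (μ := volume) measurableSet_Ioo
  have hm := heq.solvesModes hT (integrableOn_coeff_of_continuousOn h.continuousOn)
    (Eventually.of_forall fun t i =>
      ((u₁ t i).integrable_mul (w₂ t)).add ((u₂ t i).integrable_mul (w₁ t)))
    (G := fun t i k => fourierCoeffR (fun x => drift hK (w₁ t) i x * w₂ t x) k
      + fourierCoeffR (fun x => drift hK (w₂ t) i x * w₁ t x) k)
    (fun i k => (integrableOn_coeff_drift_mul hK hm₁ hm₂ hR₁ hR₂ i k).add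
      (integrableOn_coeff_drift_mul hK hm₂ hm₁ hR₂ hR₁ i k)) ?_
    (fun k => by simp only [fourierCoeffR_zero_fun]; exact integrableOn_zero)
  · refine hm.congr (Eventually.of_forall fun t k => ?_)
    simp only [fourierCoeffR_zero_fun, adv, mul_add, Finset.sum_add_distrib, zero_sub]
  · filter_upwards [hu₁, hu₂] with t h1 h2 i k
    rw [h1.eq_drift hK i, h2.eq_drift hK i, ← ActiveScalar.fourierCoeffR_add
      ((drift hK (w₁ t) i).integrable_mul (w₂ t)) ((drift hK (w₂ t) i).integrable_mul (w₁ t))]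

end Solution

end

section

open UnitAddTorus ComplexConjugate Filter Topology

/-! ### The remainder estimate -/

/-- An absorption argument for the energy balance. -/
lemma energy_absorption {T e₁ e₃ : ℝ} (hT : 0 < T) {y D G : ℝ → ℝ}
    (he₁ : 4 * T ^ 2 * e₁ ≤ 1 / 4) (he₁0 : 0 ≤ e₁)
    (hD0 : ∀ t, 0 ≤ D t) (hD : IntegrableOn D (Ioo 0 T)) (hG : IntegrableOn G (Ioo 0 T))
    (hy0 : ∀ t ∈ Icc 0 T, 0 ≤ y t)
    (hy : ∀ t ∈ Icc 0 T, y t = ∫ τ in (0 : ℝ)..t, (-2 * D τ - 2 * G τ))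
    (hGy : ∀ᵐ t ∂(volume.restrict (Ioo 0 T)),
      -2 * G t ≤ 1 / (4 * T) * y t + 4 * T * (e₁ * y t + e₃)) :
    ContinuousOn y (Icc 0 T) ∧ (∀ t ∈ Icc 0 T, y t ≤ 8 * T ^ 2 * e₃) ∧
      ∫ t in Ioo 0 T, D t ≤ 4 * T ^ 2 * e₃ := by
  have hint : IntervalIntegrable (fun τ => -2 * D τ - 2 * G τ) volume 0 T := by
    rw [intervalIntegrable_iff_integrableOn_Ioo_of_le hT.le]
    exact (hD.const_mul _).sub (hG.const_mul _)
  have hcont : ContinuousOn y (Icc 0 T) := by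
    have := intervalIntegral.continuousOn_primitive_interval' hint (a := 0) (by simp)
    rw [uIcc_of_le hT.le] at this
    exact this.congr hy
  -- At the maximum `Y` of `y`, the time integral of the source is at most `Y/2 + 4T²e₃`: one
  -- quarter of `Y` comes from the term `y/(4T)`, the other from `he₁`. Half of `Y` is thus
  -- absorbed.
  obtain ⟨t₀, ht₀, hmax⟩ := isCompact_Icc.exists_isMaxOn (nonempty_Icc.2 hT.le) hcont
  set Y := y t₀ with hY
  have hY0 : 0 ≤ Y := hy0 t₀ ht₀
  set Q : ℝ := 1 / (4 * T) * Y + 4 * T * (e₁ * Y + e₃) with hQ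
  have hGQ : ∀ᵐ t ∂(volume.restrict (Ioo 0 T)), -2 * G t ≤ Q := by
    filter_upwards [hGy, ae_restrict_mem measurableSet_Ioo] with t h1 ht
    have h2 : y t ≤ Y := hmax (Ioo_subset_Icc_self ht)
    refine h1.trans ?_
    simp only [hQ]
    gcongr
  have hDG : ∀ t ∈ Icc 0 T, y t + 2 * ∫ τ in Ioo 0 t, D τ ≤ t * Q := by
    intro t ht
    have hsub : Ioo 0 t ⊆ Ioo 0 T := Ioo_subset_Ioo_right ht.2
    have hD' := hD.mono_set hsub
    have hG' := hG.mono_set hsub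
    have hA : IntegrableOn (fun τ => -2 * D τ - 2 * G τ) (Ioo 0 t) :=
      (hD'.const_mul _).sub (hG'.const_mul _)
    rw [hy t ht, intervalIntegral.integral_of_le ht.1, integral_Ioc_eq_integral_Ioo,
      ← integral_const_mul, ← integral_add hA (hD'.const_mul _)]
    have e : ∀ τ, -2 * D τ - 2 * G τ + 2 * D τ = -2 * G τ := fun τ => by ring
    simp only [e]
    have h1 : ∫ τ in Ioo 0 t, -2 * G τ ≤ ∫ _τ in Ioo 0 t, Q :=
      integral_mono_ae (hG'.const_mul _) (integrable_const _)
        (ae_mono (Measure.restrict_mono_set _ hsub) hGQ)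
    refine h1.trans_eq ?_
    simp [ht.1]
  have hD0' : ∀ t, 0 ≤ ∫ τ in Ioo 0 t, D τ := fun t => integral_nonneg fun τ => hD0 τ
  have hTQ : T * Q = Y / 4 + 4 * T ^ 2 * e₁ * Y + 4 * T ^ 2 * e₃ := by
    rw [hQ]; field_simp; ring
  have hTQ' : T * Q ≤ Y / 2 + 4 * T ^ 2 * e₃ := by
    have := mul_le_mul_of_nonneg_right he₁ hY0
    linarith
  have hQ0 : 0 ≤ Q ∨ Q < 0 := le_or_gt 0 Q
  have hYle : Y ≤ 8 * T ^ 2 * e₃ := by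
    have h1 := hDG t₀ ht₀
    have h2 := hD0' t₀
    rcases hQ0 with h | h
    · have h3 : t₀ * Q ≤ T * Q := mul_le_mul_of_nonneg_right ht₀.2 h
      linarith
    · have h3 : T * Q < 0 := mul_neg_of_pos_of_neg hT h
      have h4 : t₀ * Q ≤ 0 := mul_nonpos_of_nonneg_of_nonpos ht₀.1 h.le
      have h5 := hDG T ⟨hT.le, le_rfl⟩
      have h6 := hD0' T
      have h7 := hy0 T ⟨hT.le, le_rfl⟩
      linarith
  refine ⟨hcont, fun t ht => (hmax ht : y t ≤ Y).trans hYle, ?_⟩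
  have h5 := hDG T ⟨hT.le, le_rfl⟩
  have h7 := hy0 T ⟨hT.le, le_rfl⟩
  linarith

lemma integrableOn_tsum_re {T R b₀ : ℝ} {h B : (Fin 2 → ℤ) → ℝ → ℂ}
    (hh : ∀ k, AEStronglyMeasurable (h k) (volume.restrict (Ioo 0 T)))
    (hBm : ∀ k, AEStronglyMeasurable (B k) (volume.restrict (Ioo 0 T)))
    (hR : ∀ᵐ t ∂(volume.restrict (Ioo 0 T)),
      Summable (fun k => ‖h k t‖ ^ 2) ∧ ∑' k, ‖h k t‖ ^ 2 ≤ R)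
    (hB : ∀ᵐ t ∂(volume.restrict (Ioo 0 T)),
      Summable (fun k => ‖B k t‖ ^ 2) ∧ ∑' k, ‖B k t‖ ^ 2 ≤ b₀) :
    IntegrableOn (fun t => ∑' k, (conj (h k t) * B k t).re) (Ioo 0 T) := by
  have hbd : ∀ᵐ t ∂(volume.restrict (Ioo 0 T)),
      Summable (fun k => (conj (h k t) * B k t).re) ∧
        ‖∑' k, (conj (h k t) * B k t).re‖ ≤ (R + b₀) / 2 := by
    filter_upwards [hR, hB] with t h1 h2
    have hs := (h1.1.add h2.1).div_const 2
    have hle : ∀ k, ‖(conj (h k t) * B k t).re‖ ≤ (‖h k t‖ ^ 2 + ‖B k t‖ ^ 2) / 2 := fun k =>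
      abs_re_conj_mul_le _ _
    refine ⟨hs.of_norm_bounded hle, (tsum_of_norm_bounded hs.hasSum hle).trans ?_⟩
    rw [tsum_div_const, h1.1.tsum_add h2.1]
    linarith [h1.2, h2.2]
  refine Integrable.of_bound ?_ _ (hbd.mono fun t ht => ht.2)
  refine aestronglyMeasurable_of_tendsto_ae (atTop : Filter (Finset (Fin 2 → ℤ)))
    (f := fun s t => ∑ k ∈ s, (conj (h k t) * B k t).re) (fun s => ?_) ?_
  · refine Finset.aestronglyMeasurable_fun_sum s fun k _ => ?_
    exact Complex.continuous_re.comp_aestronglyMeasurable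
      ((Complex.continuous_conj.comp_aestronglyMeasurable (hh k)).mul (hBm k))
  · filter_upwards [hbd] with t ht
    exact ht.1.hasSum

section Remainder

variable {K : Torus → ℝ} (hK : IsAdmissibleKernel K)

/-- The part of the nonlinearity that is not a transport of the remainder. -/
def forcing (ε : ℝ) (ρ w z : L2) (k : Fin 2 → ℤ) : ℂ :=
  ε * adv hK ρ (w + ε • z) k + ε ^ 3 * (adv hK w z k + adv hK z (w + ε • z) k)

/-- Bilinear expansion of the advection of `θ = ρ + ε(w + εz)`. Once the part accounted for by `z`
and the transport of `ρ` by the full drift of `θ` are removed, no derivative of `ρ` remains. -/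
lemma adv_sub_adv_eq (ε : ℝ) (ρ w z : L2) (k : Fin 2 → ℤ) :
    adv hK (ρ + ε • (w + ε • z)) (ρ + ε • (w + ε • z)) k - ε ^ 2 * adv hK w w k
      - adv hK (ρ + ε • (w + ε • z)) ρ k = forcing hK ε ρ w z k := by
  simp only [forcing, adv_add_left, adv_add_right, adv_smul_left, adv_smul_right]
  ring

/-- Every term of the forcing differentiates only `w` or `z`, whose gradients have summable
coefficients, so `sum_sq_adv_le` applies three times. The factor `3` is from `(p + q + r)² ≤ 3(p² +
q² + r²)`, and `6` counts the two terms of order `ε³`. -/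
lemma sum_sq_forcing_le {ε S : ℝ} {ρ w z : L2} (hε : |ε| ≤ 1) {a n : (Fin 2 → ℤ) → ℝ}
    (ha0 : ∀ k, 0 ≤ a k) (ha : Summable fun k => bracket k * a k)
    (hn0 : ∀ k, 0 ≤ n k) (hn : Summable fun k => bracket k * n k)
    (hS : S = ∑' k, bracket k * a k + ∑' k, bracket k * n k)
    (hw : ∀ k, ‖fourierCoeffR w k‖ ≤ a k) (hz : ∀ k, ‖fourierCoeffR z k‖ ≤ n k)
    (F : Finset (Fin 2 → ℤ)) :
    ∑ k ∈ F, ‖forcing hK ε ρ w z k‖ ^ 2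
      ≤ 3 * ε ^ 2 * (4 * Real.pi * driftBound hK * S) ^ 2 * ‖ρ‖ ^ 2
        + 6 * ε ^ 6 * (4 * Real.pi * driftBound hK * S ^ 2) ^ 2 := by
  have hy : ∀ k, ‖fourierCoeffR (w + ε • z : L2) k‖ ≤ a k + n k := by
    intro k
    rw [L2.fourierCoeffR_add, L2.fourierCoeffR_smul]
    refine (norm_add_le _ _).trans (add_le_add (hw k) ?_)
    rw [norm_mul, Complex.norm_real, Real.norm_eq_abs]
    exact (mul_le_of_le_one_left (norm_nonneg _) hε).trans (hz k)
  have hA0 : 0 ≤ ∑' k, bracket k * a k := tsum_nonneg fun k => mul_nonneg (bracket_pos k).le (ha0 k)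
  have hN0 : 0 ≤ ∑' k, bracket k * n k := tsum_nonneg fun k => mul_nonneg (bracket_pos k).le (hn0 k)
  have hsum : Summable fun k => bracket k * (a k + n k) := by
    simpa only [mul_add] using ha.add hn
  have hsum' : ∑' k, bracket k * (a k + n k) = S := by
    simp only [mul_add]; rw [ha.tsum_add hn, hS]
  have hyS := summable_freqNorm_mul_coeff hsum hy
  rw [hsum'] at hyS
  have hzS := summable_freqNorm_mul_coeff hn hz
  have hwn : ‖w‖ ≤ S := (L2.norm_le_tsum ha0 ha hw).trans (by linarith)
  have hzn : ‖z‖ ≤ S := (L2.norm_le_tsum hn0 hn hz).trans (by linarith)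
  have hS0 : 0 ≤ S := by linarith
  have h0 := driftBound_nonneg hK
  set c := 4 * Real.pi * driftBound hK with hc
  have hc0 : 0 ≤ c := by positivity
  have h1 := sum_sq_adv_le hK ρ (w + ε • z) hyS.1 hyS.2 F
  have h2 := sum_sq_adv_le hK w z hzS.1 (hzS.2.trans (by linarith : _ ≤ S)) F
  have h3 := sum_sq_adv_le hK z (w + ε • z) hyS.1 hyS.2 F
  rw [← hc] at h1 h2 h3
  have h2' : (c * S * ‖w‖) ^ 2 ≤ (c * S ^ 2) ^ 2 := by
    rw [sq S, ← mul_assoc]; gcongr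
  have h3' : (c * S * ‖z‖) ^ 2 ≤ (c * S ^ 2) ^ 2 := by
    rw [sq S, ← mul_assoc]; gcongr
  have hp : ∀ k, ‖forcing hK ε ρ w z k‖ ^ 2 ≤ 3 * ε ^ 2 * ‖adv hK ρ (w + ε • z) k‖ ^ 2
      + 3 * ε ^ 6 * ‖adv hK w z k‖ ^ 2 + 3 * ε ^ 6 * ‖adv hK z (w + ε • z) k‖ ^ 2 := by
    intro k
    have e : ‖forcing hK ε ρ w z k‖ ≤ |ε| * ‖adv hK ρ (w + ε • z) k‖
        + |ε| ^ 3 * (‖adv hK w z k‖ + ‖adv hK z (w + ε • z) k‖) := by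
      refine (norm_add_le _ _).trans (add_le_add ?_ ?_)
      · rw [norm_mul, Complex.norm_real, Real.norm_eq_abs]
      · rw [norm_mul, norm_pow, Complex.norm_real, Real.norm_eq_abs]
        gcongr
        exact norm_add_le _ _
    have e2 := pow_le_pow_left₀ (norm_nonneg _) e 2
    refine e2.trans ?_
    have a2 : ε ^ 2 = |ε| ^ 2 := (sq_abs ε).symm
    have a6 : ε ^ 6 = (|ε| ^ 3) ^ 2 := by rw [← pow_mul, ← abs_pow]; exact (abs_of_nonneg (by positivity)).symm
    rw [a2, a6]
    set p := |ε| * ‖adv hK ρ (w + ε • z) k‖ with hp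
    set q := |ε| ^ 3 * ‖adv hK w z k‖ with hq
    set r := |ε| ^ 3 * ‖adv hK z (w + ε • z) k‖ with hr
    calc _ = (p + q + r) ^ 2 := by rw [hp, hq, hr]; ring
      _ ≤ 3 * p ^ 2 + 3 * q ^ 2 + 3 * r ^ 2 := by
        nlinarith [sq_nonneg (p - q), sq_nonneg (q - r), sq_nonneg (p - r)]
      _ = _ := by rw [hp, hq, hr]; ring
  refine (Finset.sum_le_sum fun k _ => hp k).trans ?_
  rw [Finset.sum_add_distrib, Finset.sum_add_distrib, ← Finset.mul_sum, ← Finset.mul_sum,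
    ← Finset.mul_sum]
  have i1 := mul_le_mul_of_nonneg_left h1 (by positivity : 0 ≤ 3 * ε ^ 2)
  have i2 := mul_le_mul_of_nonneg_left (h2.trans h2') (by positivity : 0 ≤ 3 * ε ^ 6)
  have i3 := mul_le_mul_of_nonneg_left (h3.trans h3') (by positivity : 0 ≤ 3 * ε ^ 6)
  calc _ ≤ _ := add_le_add (add_le_add i1 i2) i3
    _ = _ := by ring

end Remainder

end

/-! ### The remainder of the second order expansion is cubic in `ε` -/

section

open UnitAddTorus ComplexConjugate Filter Topology

lemma SolvesModes.add_smul {α T : ℝ} {w z : ℝ → L2} {g g' : ℝ → (Fin 2 → ℤ) → ℂ}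
    (hw : SolvesModes α T w g) (hz : SolvesModes α T z g')
    (hwi : ∀ k, IntegrableOn (fun t => fourierCoeffR (w t) k) (Ioo 0 T))
    (hzi : ∀ k, IntegrableOn (fun t => fourierCoeffR (z t) k) (Ioo 0 T))
    (hg : ∀ k, IntegrableOn (fun t => g t k) (Ioo 0 T))
    (hg' : ∀ k, IntegrableOn (fun t => g' t k) (Ioo 0 T)) (c : ℝ) :
    SolvesModes α T (fun t => w t + c • z t) (fun t k => g t k + c * g' t k) := by
  intro k
  filter_upwards [hw k, hz k, ae_restrict_mem measurableSet_Ioo] with t h1 h2 ht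
  have ht' := Ioo_subset_Icc_self ht
  have i1 : IntervalIntegrable (fun τ => g τ k - eig α k * fourierCoeffR (w τ) k) volume 0 t :=
    intervalIntegrable_of_Ioo ((hg k).sub ((hwi k).const_mul _)) ht'
  have i2 : IntervalIntegrable (fun τ => g' τ k - eig α k * fourierCoeffR (z τ) k) volume 0 t :=
    intervalIntegrable_of_Ioo ((hg' k).sub ((hzi k).const_mul _)) ht'
  rw [L2.fourierCoeffR_add, L2.fourierCoeffR_smul, h1, h2, ← intervalIntegral.integral_const_mul,
    ← intervalIntegral.integral_add i1 (i2.const_mul _)]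
  refine intervalIntegral.integral_congr fun τ _ => ?_
  simp only [L2.fourierCoeffR_add, L2.fourierCoeffR_smul]
  ring

lemma lintegral_sobolevSq_add_smul_lt_top {r T : ℝ} {a b : ℝ → L2}
    (ha : AEStronglyMeasurable a (volume.restrict (Ioo 0 T)))
    (hfa : ∫⁻ t in Ioo 0 T, sobolevSq r (a t) < ⊤)
    (hfb : ∫⁻ t in Ioo 0 T, sobolevSq r (b t) < ⊤) (c : ℝ) :
    ∫⁻ t in Ioo 0 T, sobolevSq r (a t + c • b t : L2) < ⊤ := by
  refine (lintegral_mono fun t => sobolevSq_add_le r (a t) (c • b t)).trans_lt ?_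
  rw [lintegral_add_left' ((aemeasurable_sobolevSq ha r).const_mul _), lintegral_const_mul' _ _ (by simp),
    lintegral_const_mul' _ _ (by simp)]
  simp only [sobolevSq_smul]
  rw [lintegral_const_mul' _ _ (by simp)]
  exact ENNReal.add_lt_top.2 ⟨ENNReal.mul_lt_top (by simp) hfa,
    ENNReal.mul_lt_top (by simp) (ENNReal.mul_lt_top (by simp) hfb)⟩

section Remainder

variable {K : Torus → ℝ} (hK : IsAdmissibleKernel K)

/-- Young's inequality mode by mode. The weight `4T` is chosen so that the quadratic term,
integrated over `[0, T]`, costs only a quarter of the maximal energy. -/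
lemma neg_two_tsum_re_le {T e₁ e₃ : ℝ} (hT : 0 < T) {x B : (Fin 2 → ℤ) → ℂ} {s : ℝ}
    (hx : HasSum (fun k => ‖x k‖ ^ 2) s)
    (hB : ∀ F : Finset (Fin 2 → ℤ), ∑ k ∈ F, ‖B k‖ ^ 2 ≤ e₁ * s + e₃) :
    -2 * ∑' k, (conj (x k) * B k).re ≤ 1 / (4 * T) * s + 4 * T * (e₁ * s + e₃) := by
  have hBs : Summable fun k => ‖B k‖ ^ 2 := summable_of_sum_le (fun k => sq_nonneg _) hB
  have hBle : ∑' k, ‖B k‖ ^ 2 ≤ e₁ * s + e₃ := hBs.tsum_le_of_sum_le hB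
  have hle : ∀ k, -2 * (conj (x k) * B k).re ≤ 1 / (4 * T) * ‖x k‖ ^ 2 + 4 * T * ‖B k‖ ^ 2 := by
    intro k
    have h1 : -(conj (x k) * B k).re ≤ ‖x k‖ * ‖B k‖ := by
      refine (neg_le_abs _).trans ((Complex.abs_re_le_norm _).trans_eq ?_)
      rw [norm_mul, RCLike.norm_conj]
    have h2 : 2 * (‖x k‖ * ‖B k‖) ≤ 1 / (4 * T) * ‖x k‖ ^ 2 + 4 * T * ‖B k‖ ^ 2 := by
      have h3 : 0 ≤ 1 / (4 * T) * (‖x k‖ - 4 * T * ‖B k‖) ^ 2 := by positivity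
      have h4 : 1 / (4 * T) * (‖x k‖ - 4 * T * ‖B k‖) ^ 2
          = 1 / (4 * T) * ‖x k‖ ^ 2 + 4 * T * ‖B k‖ ^ 2 - 2 * (‖x k‖ * ‖B k‖) := by
        field_simp; ring
      linarith
    linarith
  have hre : Summable fun k => (conj (x k) * B k).re :=
    ((hx.summable.add hBs).div_const 2).of_norm_bounded fun k => abs_re_conj_mul_le _ _
  rw [← tsum_mul_left]
  have hs := (hx.summable.mul_left (1 / (4 * T))).add (hBs.mul_left (4 * T))
  refine ((hre.mul_left (-2)).tsum_le_tsum hle hs).trans ?_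
  rw [(hx.summable.mul_left _).tsum_add (hBs.mul_left _), tsum_mul_left, tsum_mul_left, hx.tsum_eq]
  gcongr

set_option maxHeartbeats 1000000 in
/-- A solution with source `ε f` is `ε w + ε² z` up to an error of order `ε³` in the energy
space. -/
theorem exists_remainder {α s q T : ℝ} (hα : 1 / 2 < α) (hα' : α < 1) (hs : 0 < s)
    (hq : 0 < 1 / q) (hq' : 1 / q < α - 1 / 2) (hT : 0 < T) {f : ℝ × Torus → ℝ}
    (hfi : ∀ k, IntegrableOn (fun t => fourierCoeffR (fun x => f (t, x)) k) (Ioo 0 T))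
    {w z : ℝ → L2} {a n : (Fin 2 → ℤ) → ℝ}
    (ha0 : ∀ k, 0 ≤ a k) (ha : Summable fun k => bracket k * a k)
    (hn0 : ∀ k, 0 ≤ n k) (hn : Summable fun k => bracket k * n k)
    (hw : IsProfile T a w) (hz : IsProfile T n z)
    (hwm : SolvesModes α T w fun t k => fourierCoeffR (fun x => f (t, x)) k)
    (hzm : SolvesModes α T z fun t k => -adv hK (w t) (w t) k) :
    ∃ C δ : ℝ, 0 ≤ C ∧ 0 < δ ∧ ∀ ε : ℝ, |ε| < δ → ∀ θ : ℝ → L2,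
      IsASESolution α s q T K (fun p => ε * f p) θ →
      ∃ r : ℝ → L2, ContinuousOn r (Icc 0 T) ∧
        (∀ᵐ t ∂(volume.restrict (Ioo 0 T)), θ t = r t + ε • (w t + ε • z t)) ∧
        (∀ t ∈ Icc 0 T, ‖r t‖ ≤ C * |ε| ^ 3) ∧
        ∫⁻ t in Ioo 0 T, sobolevSq α (r t) ≤ ENNReal.ofReal (C * ε ^ 6) := by
  have hα0 : 0 ≤ α := by linarith
  have hq2 : 2 ≤ q := (two_lt_of_inv hα' hq hq').le
  have h0 := driftBound_nonneg hK
  obtain ⟨κ, C₀, hκ, hC₀, hcommutator⟩ := exists_regularised_adv_le hK hα hα' hq hq'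
  obtain ⟨S, hS⟩ : ∃ S : ℝ, S = ∑' k, bracket k * a k + ∑' k, bracket k * n k := ⟨_, rfl⟩
  have hA0 : 0 ≤ ∑' k, bracket k * a k := tsum_nonneg fun k => mul_nonneg (bracket_pos k).le (ha0 k)
  have hN0 : 0 ≤ ∑' k, bracket k * n k := tsum_nonneg fun k => mul_nonneg (bracket_pos k).le (hn0 k)
  have hS0 : 0 ≤ S := by linarith
  obtain ⟨c, hc⟩ : ∃ c : ℝ, c = 4 * Real.pi * driftBound hK := ⟨_, rfl⟩
  have hc0 : 0 ≤ c := by rw [hc]; positivity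
  -- Absorption yields `‖r‖² ≤ 8T²e₃ = 48 T² ε⁶ (cS²)²`, and `48 ≤ 7²` explains the `7`. The second
  -- summand is `8T³e₃ + 4T²e₃` divided by `ε⁶`. The bound on `|ε|` gives `4T²e₁ ≤ 12/49 ≤ 1/4`.
  refine ⟨7 * (T * (c * S ^ 2)) + (48 * T ^ 3 + 24 * T ^ 2) * (c * S ^ 2) ^ 2,
    min 1 (1 / (7 * (T * c * S + 1))), by positivity, by positivity, fun ε hε θ hθ => ?_⟩
  have hε1 : |ε| ≤ 1 := (hε.trans_le (min_le_left _ _)).le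
  have hε2 : |ε| < 1 / (7 * (T * c * S + 1)) := hε.trans_le (min_le_right _ _)
  obtain ⟨e₁, he₁⟩ : ∃ e₁ : ℝ, e₁ = 3 * ε ^ 2 * (c * S) ^ 2 := ⟨_, rfl⟩
  obtain ⟨e₃, he₃⟩ : ∃ e₃ : ℝ, e₃ = 6 * ε ^ 6 * (c * S ^ 2) ^ 2 := ⟨_, rfl⟩
  have he₁0 : 0 ≤ e₁ := by rw [he₁]; positivity
  have he₃0 : 0 ≤ e₃ := by rw [he₃]; positivity
  have he₁' : 4 * T ^ 2 * e₁ ≤ 1 / 4 := by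
    rw [lt_div_iff₀ (by positivity)] at hε2
    have h1 : 7 * (|ε| * (T * c * S)) ≤ 1 := by
      have := abs_nonneg ε
      nlinarith
    have h2 : (7 * (|ε| * (T * c * S))) ^ 2 ≤ 1 := pow_le_one₀ (by positivity) h1
    have h3 : 4 * T ^ 2 * e₁ = 12 / 49 * (7 * (|ε| * (T * c * S))) ^ 2 := by
      rw [he₁, ← sq_abs ε]; ring
    linarith
  -- the remainder
  obtain ⟨R, hR0, hR⟩ := hθ.memLinftyLq.exists_norm_le hq2
  obtain ⟨U, hU⟩ := hθ.memLinftyLq.exists_drift_le hK hq2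
  have hθmeas := hθ.memL2H.1
  obtain ⟨ρ, hρdef⟩ : ∃ ρ : ℝ → L2, ρ = fun t => θ t + (-ε) • (w t + ε • z t) := ⟨_, rfl⟩
  have hρθ : ∀ t, ρ t + ε • (w t + ε • z t) = θ t := fun t => by
    rw [hρdef]; simp only [neg_smul, neg_add_cancel_right]
  have hwS : ∀ᵐ t ∂(volume.restrict (Ioo 0 T)), ‖w t‖ ≤ S := by
    filter_upwards [hw.bound] with t ht
    exact (L2.norm_le_tsum ha0 ha ht).trans (by linarith)
  have hzS : ∀ᵐ t ∂(volume.restrict (Ioo 0 T)), ‖z t‖ ≤ S := by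
    filter_upwards [hz.bound] with t ht
    exact (L2.norm_le_tsum hn0 hn ht).trans (by linarith)
  have hymeas : AEStronglyMeasurable (fun t => w t + ε • z t) (volume.restrict (Ioo 0 T)) :=
    hw.meas.add (hz.meas.const_smul ε)
  have hρmeas : AEStronglyMeasurable ρ (volume.restrict (Ioo 0 T)) := by
    rw [hρdef]; exact hθmeas.add (hymeas.const_smul (-ε))
  have hyS : ∀ᵐ t ∂(volume.restrict (Ioo 0 T)), ‖w t + ε • z t‖ ≤ 2 * S := by
    filter_upwards [hwS, hzS] with t h1 h2
    refine (norm_add_le _ _).trans ?_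
    rw [norm_smul, Real.norm_eq_abs]
    have := mul_le_of_le_one_left (norm_nonneg (z t)) hε1
    linarith
  have hρR : ∀ᵐ t ∂(volume.restrict (Ioo 0 T)), ‖ρ t‖ ≤ R + 2 * S := by
    filter_upwards [hR, hyS] with t h1 h2
    rw [hρdef]
    refine (norm_add_le _ _).trans ?_
    rw [norm_smul, Real.norm_eq_abs, abs_neg]
    have := mul_le_of_le_one_left (norm_nonneg (w t + ε • z t)) hε1
    linarith
  -- The nonlinearity in the equation of the remainder: the source `εf` has cancelled against `w`,
  -- and `z` accounts for the `ε²` term. It equals the transport of `ρ` by the drift of `θ` plus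
  -- `forcing`.
  obtain ⟨N, hNdef⟩ : ∃ N : (Fin 2 → ℤ) → ℝ → ℂ, N = fun k t =>
    adv hK (θ t) (θ t) k - ε ^ 2 * adv hK (w t) (w t) k := ⟨_, rfl⟩
  have hNB : ∀ k t, N k t - forcing hK ε (ρ t) (w t) (z t) k = adv hK (θ t) (ρ t) k := by
    intro k t
    rw [← adv_sub_adv_eq, hρθ, hNdef]; ring
  have hfε : ∀ t k, fourierCoeffR (fun x => ε * f (t, x)) k
      = ε * fourierCoeffR (fun x => f (t, x)) k := fun t k => fourierCoeffR_const_mul _ _ _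
  have hmode : SolvesModes α T ρ fun t k => -N k t := by
    have h1 := hθ.solvesModes hK hT hq2
      (fun k => by simp only [hfε]; exact (hfi k).const_mul _)
    have hadvw := integrableOn_adv hK hw.meas hw.meas hwS hwS
    have h2 := hwm.add_smul hzm (integrableOn_coeff hw.meas hwS) (integrableOn_coeff hz.meas hzS)
      hfi (fun k => (hadvw k).neg) ε
    have h3 := h1.add_smul h2 (integrableOn_coeff hθmeas hR) (integrableOn_coeff hymeas hyS)
      (fun k => by
        simp only [hfε]
        exact ((hfi k).const_mul _).sub (integrableOn_adv hK hθmeas hθmeas hR hR k))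
      (fun k => (hfi k).add ((hadvw k).neg.const_mul _)) (-ε)
    rw [hρdef]
    refine h3.congr (Eventually.of_forall fun t k => ?_)
    simp only [hfε, hNdef]
    push_cast
    ring
  have hNm : ∀ k, AEStronglyMeasurable (N k) (volume.restrict (Ioo 0 T)) := fun k => by
    rw [hNdef]
    exact (aestronglyMeasurable_adv hK hθmeas hθmeas k).sub
      ((aestronglyMeasurable_adv hK hw.meas hw.meas k).const_mul _)
  have hhm := fun k => aestronglyMeasurable_coeff hρmeas k
  have hBm : ∀ k, AEStronglyMeasurable (fun t => forcing hK ε (ρ t) (w t) (z t) k)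
      (volume.restrict (Ioo 0 T)) := fun k => by
    have e : (fun t => forcing hK ε (ρ t) (w t) (z t) k)
        = fun t => N k t - adv hK (θ t) (ρ t) k := by
      ext t; rw [← hNB]; ring
    rw [e]
    exact (hNm k).sub (aestronglyMeasurable_adv hK hθmeas hρmeas k)
  have hforce : ∀ᵐ t ∂(volume.restrict (Ioo 0 T)), ∀ F : Finset (Fin 2 → ℤ),
      ∑ k ∈ F, ‖forcing hK ε (ρ t) (w t) (z t) k‖ ^ 2 ≤ e₁ * ‖ρ t‖ ^ 2 + e₃ := by
    filter_upwards [hw.bound, hz.bound] with t h1 h2 F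
    rw [he₁, he₃, hc]
    exact sum_sq_forcing_le hK hε1 ha0 ha hn0 hn hS h1 h2 F
  -- the Sobolev regularity of the remainder
  have hfin : ∫⁻ t in Ioo 0 T, sobolevSq α (ρ t) < ⊤ := by
    rw [hρdef]
    exact lintegral_sobolevSq_add_smul_lt_top hθmeas (hθ.lintegral_sobolevSq_lt_top hs)
      (lintegral_sobolevSq_add_smul_lt_top hw.meas (hw.lintegral_sobolevSq_lt_top hα'.le ha0 ha)
        (hz.lintegral_sobolevSq_lt_top hα'.le hn0 hn) ε) (-ε)
  obtain ⟨hEs, hEi, hEeq⟩ := weighted_integrable hρmeas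
    (fun k => Real.rpow_nonneg (bracket_pos k).le α) hfin.ne
  have hDfin : ∫⁻ t in Ioo 0 T, ∑' k, ENNReal.ofReal (eig α k) * ‖fourierCoeffR (ρ t) k‖ₑ ^ 2
      ≠ ⊤ := by
    refine ((lintegral_mono (g := fun t => ENNReal.ofReal 40 * sobolevSq α (ρ t))
      fun t => ?_).trans_lt ?_).ne
    · simp only [sobolevSq]
      rw [← ENNReal.tsum_mul_left]
      refine ENNReal.tsum_le_tsum fun k => ?_
      rw [← mul_assoc, ← ENNReal.ofReal_mul (by norm_num)]
      gcongr
      exact eig_le_bracket hα0 hα'.le k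
    · rw [lintegral_const_mul' _ _ (by simp)]
      exact ENNReal.mul_lt_top (by simp) hfin
  obtain ⟨hDs, hDi, -⟩ := weighted_integrable hρmeas (eig_nonneg α) hDfin
  set D : ℝ → ℝ := fun t => ∑' k, eig α k * ‖fourierCoeffR (ρ t) k‖ ^ 2 with hD
  have hρsum := fun t => L2.hasSum_sq (ρ t)
  have hRbound : ∀ᵐ t ∂(volume.restrict (Ioo 0 T)),
      Summable (fun k => ‖fourierCoeffR (ρ t) k‖ ^ 2) ∧
        ∑' k, ‖fourierCoeffR (ρ t) k‖ ^ 2 ≤ (R + 2 * S) ^ 2 := by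
    filter_upwards [hρR] with t ht
    refine ⟨(hρsum t).summable, ?_⟩
    rw [(hρsum t).tsum_eq]
    exact pow_le_pow_left₀ (norm_nonneg _) ht 2
  have hBbound : ∀ᵐ t ∂(volume.restrict (Ioo 0 T)),
      Summable (fun k => ‖forcing hK ε (ρ t) (w t) (z t) k‖ ^ 2) ∧
        ∑' k, ‖forcing hK ε (ρ t) (w t) (z t) k‖ ^ 2
          ≤ (Real.sqrt (e₁ * (R + 2 * S) ^ 2 + e₃)) ^ 2 := by
    filter_upwards [hforce, hρR] with t h1 h2
    have hs := summable_of_sum_le (fun k => sq_nonneg _) h1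
    refine ⟨hs, (hs.tsum_le_of_sum_le h1).trans ?_⟩
    rw [Real.sq_sqrt (by positivity)]
    gcongr
  -- The weights are Gaussians of width `1/(m+1)`, and the commutator estimate provides the decay
  -- `(1/(m+1))^κ`. The time factor `Φ` is integrable because `ρ` lies in `L²H^α` and the drift is
  -- bounded in `L^q`.
  have hident := energy_identity (T := T) (R := R + 2 * S)
    (b₀ := Real.sqrt (e₁ * (R + 2 * S) ^ 2 + e₃)) hT (by positivity)
    (lam := eig α) (P := fun k => c * (R * R + S * S) * bracket k) (eig_nonneg α)
    (h := fun k t => fourierCoeffR (ρ t) k) (N := N)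
    (B := fun k t => forcing hK ε (ρ t) (w t) (z t) k)
    (m := fun m k => gaussWeight (1 / ((m : ℝ) + 1)) k)
    (w := fun m => (1 / ((m : ℝ) + 1)) ^ κ)
    (Φ := fun t => C₀ * (1 + 2 * Real.sqrt U) * ∑' k, bracket k ^ α * ‖fourierCoeffR (ρ t) k‖ ^ 2)
    hhm hNm hmode hRbound ?hP hDs hDi hBbound
    (fun m k => (gaussWeight_pos _ k).le) (fun m k => gaussWeight_le_one _ k)
    (fun k => (tendsto_gaussWeight k le_rfl).comp tendsto_one_div_add_atTop_nhds_zero_nat)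
    ?hmsum ?hw (hEi.const_mul _) ?hcomm
  case hP =>
    filter_upwards [hR, hwS] with t h1 h2 k
    have hk := freqNorm_nonneg k
    have a1 : ‖adv hK (θ t) (θ t) k‖ ≤ c * freqNorm k * (R * R) := by
      refine (norm_adv_le hK _ _ k).trans ?_
      rw [← hc]; gcongr
    have a2 : ‖adv hK (w t) (w t) k‖ ≤ c * freqNorm k * (S * S) := by
      refine (norm_adv_le hK _ _ k).trans ?_
      rw [← hc]; gcongr
    have a3 : ‖(ε : ℂ) ^ 2 * adv hK (w t) (w t) k‖ ≤ ‖adv hK (w t) (w t) k‖ := by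
      rw [norm_mul, norm_pow, Complex.norm_real, Real.norm_eq_abs]
      exact mul_le_of_le_one_left (norm_nonneg _) (pow_le_one₀ (abs_nonneg _) hε1)
    rw [hNdef]
    calc _ ≤ c * freqNorm k * (R * R) + c * freqNorm k * (S * S) :=
          (norm_sub_le _ _).trans (add_le_add a1 (a3.trans a2))
      _ = c * (R * R + S * S) * freqNorm k := by ring
      _ ≤ _ := by gcongr; exact freqNorm_le_bracket k
  case hmsum =>
    intro m
    have hpos : 0 < 1 / ((m : ℝ) + 1) := by positivity
    refine Summable.of_nonneg_of_le (fun k => mul_nonneg (gaussWeight_pos _ k).le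
      (add_nonneg (eig_nonneg α k) ?_)) (fun k => ?_)
      ((summable_gaussWeight_mul_bracket hpos).mul_left (40 + c * (R * R + S * S)))
    · have := (bracket_pos k).le
      positivity
    · have h1 : eig α k ≤ 40 * bracket k := (eig_le_bracket hα0 hα'.le k).trans
        (by have := bracket_rpow_le_self hα'.le k; linarith)
      calc _ ≤ gaussWeight (1 / ((m : ℝ) + 1)) k *
            (40 * bracket k + c * (R * R + S * S) * bracket k) :=
            mul_le_mul_of_nonneg_left (by linarith) (gaussWeight_pos _ k).le
        _ = _ := by ring
  case hw =>
    have := (tendsto_one_div_add_atTop_nhds_zero_nat (𝕜 := ℝ)).rpow_const (p := κ) (Or.inr hκ.le)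
    rwa [Real.zero_rpow hκ.ne'] at this
  case hcomm =>
    intro m
    have hpos : 0 < 1 / ((m : ℝ) + 1) := by positivity
    have hle1 : 1 / ((m : ℝ) + 1) ≤ 1 := by
      rw [div_le_one (by positivity)]; linarith [(Nat.cast_nonneg m : (0 : ℝ) ≤ m)]
    filter_upwards [hU, hEs] with t h1 h2
    simp only [hNB]
    refine (hcommutator _ hpos hle1 (θ t) (ρ t) (fun i => (h1 i).1) h2).trans ?_
    have h3 : ∑ i, Real.sqrt (∫ x, |drift hK (θ t) i x| ^ q ∂torusMeasure) ≤ 2 * Real.sqrt U := by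
      rw [Fin.sum_univ_two, two_mul]
      exact add_le_add (Real.sqrt_le_sqrt (h1 0).2) (Real.sqrt_le_sqrt (h1 1).2)
    have h4 : 0 ≤ ∑' k, bracket k ^ α * ‖fourierCoeffR (ρ t) k‖ ^ 2 :=
      tsum_nonneg fun k => mul_nonneg (Real.rpow_nonneg (bracket_pos k).le _) (sq_nonneg _)
    have h5 := Real.rpow_nonneg hpos.le κ
    calc _ ≤ C₀ * (1 / ((m : ℝ) + 1)) ^ κ * (1 + 2 * Real.sqrt U) *
          ∑' k, bracket k ^ α * ‖fourierCoeffR (ρ t) k‖ ^ 2 := by gcongr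
      _ = _ := by ring
  -- the continuous representative
  have hsymm : ∀ k t, (∫ τ in (0 : ℝ)..t, (-(N (-k) τ) - eig α (-k) * fourierCoeffR (ρ τ) (-k)))
      = conj (∫ τ in (0 : ℝ)..t, (-(N k τ) - eig α k * fourierCoeffR (ρ τ) k)) := by
    intro k t
    have he : eig α (-k) = eig α k := by rw [eig, eig, freqNorm_neg]
    rw [← intervalIntegral.intervalIntegral_conj]
    refine intervalIntegral.integral_congr fun τ _ => ?_
    simp only [hNdef, he, adv_neg_freq, fourierCoeffR_neg, map_sub, map_neg, map_mul, map_pow,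
      Complex.conj_ofReal]
  have hex : ∀ t, ∃ r : L2, t ∈ Icc 0 T → ∀ k, fourierCoeffR r k
      = ∫ τ in (0 : ℝ)..t, (-(N k τ) - eig α k * fourierCoeffR (ρ τ) k) := by
    intro t
    by_cases ht : t ∈ Icc 0 T
    · obtain ⟨r, hr⟩ := exists_L2_of_summable (hident t ht).summable (fun k => hsymm k t)
      exact ⟨r, fun _ => hr⟩
    · exact ⟨0, fun h => absurd h ht⟩
  choose r hr using hex
  have hrρ : ∀ᵐ t ∂(volume.restrict (Ioo 0 T)), r t = ρ t := by
    filter_upwards [ae_all_iff.2 hmode, ae_restrict_mem measurableSet_Ioo] with t h1 ht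
    refine L2.ext_fourier fun k => ?_
    rw [hr t (Ioo_subset_Icc_self ht), h1 k]
  set G : ℝ → ℝ := fun t => ∑' k, (conj (fourierCoeffR (ρ t) k)
    * forcing hK ε (ρ t) (w t) (z t) k).re with hG
  have hy : ∀ t ∈ Icc 0 T, ‖r t‖ ^ 2 = ∫ τ in (0 : ℝ)..t, (-2 * D τ - 2 * G τ) := by
    intro t ht
    have h1 := L2.hasSum_sq (r t)
    simp only [hr t ht] at h1
    exact h1.unique (hident t ht)
  obtain ⟨hycont, hybound, hDbound⟩ := energy_absorption (y := fun t => ‖r t‖ ^ 2) (D := D)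
    (G := G) (e₁ := e₁) (e₃ := e₃) hT he₁' he₁0
    (fun t => tsum_nonneg fun k => mul_nonneg (eig_nonneg α k) (sq_nonneg _)) hDi
    (integrableOn_tsum_re hhm hBm hRbound hBbound) (fun t _ => sq_nonneg _) hy (by
      filter_upwards [hforce, hrρ] with t h1 h2
      rw [h2]
      exact neg_two_tsum_re_le hT (hρsum t) h1)
  refine ⟨r, ?_, ?_, fun t ht => ?_, ?_⟩
  · refine L2.continuousOn_of_modes (fun k => ?_) hycont
    have hNi : IntegrableOn (fun τ => -(N k τ) - eig α k * fourierCoeffR (ρ τ) k) (Ioo 0 T) := by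
      have hNk : IntegrableOn (N k) (Ioo 0 T) := by
        rw [hNdef]
        exact (integrableOn_adv hK hθmeas hθmeas hR hR k).sub
          ((integrableOn_adv hK hw.meas hw.meas hwS hwS k).const_mul _)
      exact hNk.neg.sub ((integrableOn_coeff hρmeas hρR k).const_mul _)
    have hcont := intervalIntegral.continuousOn_primitive_interval'
      (intervalIntegrable_of_Ioo hNi ⟨hT.le, le_rfl⟩) (a := 0) (by simp)
    rw [uIcc_of_le hT.le] at hcont
    exact hcont.congr fun t ht => hr t ht k
  · filter_upwards [hrρ] with t ht
    rw [ht, hρθ]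
  · have h1 : ‖r t‖ ^ 2 ≤ 8 * T ^ 2 * e₃ := hybound t ht
    have h2 : ‖r t‖ ≤ 7 * (T * (c * S ^ 2)) * |ε| ^ 3 := by
      refine le_of_sq_le_sq (h1.trans ?_) (by positivity)
      have e6 : ε ^ 6 = (|ε| ^ 3) ^ 2 := by
        rw [← pow_mul, ← abs_pow]; exact (abs_of_nonneg (by positivity)).symm
      rw [he₃, e6]
      have := sq_nonneg (|ε| ^ 3 * T * (c * S ^ 2))
      nlinarith
    refine h2.trans ?_
    gcongr
    exact le_add_of_nonneg_right (by positivity)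
  · have h1 : ∫⁻ t in Ioo 0 T, sobolevSq α (r t) = ∫⁻ t in Ioo 0 T, sobolevSq α (ρ t) := by
      refine lintegral_congr_ae ?_
      filter_upwards [hrρ] with t ht
      rw [ht]
    rw [h1]
    refine hEeq.le.trans (ENNReal.ofReal_le_ofReal ?_)
    have h2 : ∫ t in Ioo 0 T, ∑' k, bracket k ^ α * ‖fourierCoeffR (ρ t) k‖ ^ 2
        ≤ ∫ t in Ioo 0 T, (8 * T ^ 2 * e₃ + D t) := by
      refine integral_mono_ae hEi ((integrable_const _).add hDi) ?_
      filter_upwards [hEs, hDs, hrρ, ae_restrict_mem measurableSet_Ioo] with t k1 k2 k3 ht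
      have k4 : ‖ρ t‖ ^ 2 ≤ 8 * T ^ 2 * e₃ := by
        rw [← k3]; exact hybound t (Ioo_subset_Icc_self ht)
      have k5 : ∑' k, bracket k ^ α * ‖fourierCoeffR (ρ t) k‖ ^ 2 ≤ ‖ρ t‖ ^ 2 + D t := by
        refine hasSum_le (fun k => ?_) k1.hasSum ((hρsum t).add k2.hasSum)
        have := mul_le_mul_of_nonneg_right (bracket_rpow_le hα0 hα'.le k)
          (sq_nonneg ‖fourierCoeffR (ρ t) k‖)
        linarith
      exact k5.trans (by linarith)
    have h3 : ∫ t in Ioo 0 T, (8 * T ^ 2 * e₃ + D t) = T * (8 * T ^ 2 * e₃) + ∫ t in Ioo 0 T, D t := by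
      rw [integral_add (integrable_const _) hDi]
      simp [hT.le]
    refine h2.trans (h3.le.trans ?_)
    have h4 : T * (8 * T ^ 2 * e₃) + 4 * T ^ 2 * e₃
        = (48 * T ^ 3 + 24 * T ^ 2) * (c * S ^ 2) ^ 2 * ε ^ 6 := by rw [he₃]; ring
    have h5 : 0 ≤ 7 * (T * (c * S ^ 2)) * ε ^ 6 := by positivity
    linarith

end Remainder

end

section

open UnitAddTorus ComplexConjugate Filter Topology

/-! ### The second linearization -/

/-- The Duhamel formula expresses every mode through `g` alone. -/
lemma SolvesModes.unique {α T : ℝ} {w z : ℝ → L2} {g : ℝ → (Fin 2 → ℤ) → ℂ}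
    (hw : SolvesModes α T w g) (hz : SolvesModes α T z g)
    (hwi : ∀ k, IntegrableOn (fun t => fourierCoeffR (w t) k) (Ioo 0 T))
    (hzi : ∀ k, IntegrableOn (fun t => fourierCoeffR (z t) k) (Ioo 0 T))
    (hg : ∀ k, IntegrableOn (fun t => g t k) (Ioo 0 T)) :
    ∀ᵐ t ∂(volume.restrict (Ioo 0 T)), w t = z t := by
  have h : ∀ᵐ t ∂(volume.restrict (Ioo 0 T)), ∀ k,
      fourierCoeffR (w t) k = fourierCoeffR (z t) k := by
    refine ae_all_iff.2 fun k => ?_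
    filter_upwards [hw.eq_duhamel k (hwi k) (hg k), hz.eq_duhamel k (hzi k) (hg k)] with t h1 h2
    rw [h1, h2]
  filter_upwards [h] with t ht
  exact L2.ext_fourier ht

/-- The second linearization is the mixed part of the second order profiles. -/
lemma IsSecondLinearization.ae_eq {α T : ℝ} (hT : 0 < T) {K : Torus → ℝ}
    (hK : IsAdmissibleKernel K) {w₁ w₂ v z z₁ z₂ : ℝ → L2}
    (hw₁ : ContinuousOn w₁ (Icc 0 T)) (hw₂ : ContinuousOn w₂ (Icc 0 T))
    (hv : IsSecondLinearization α T K w₁ w₂ v)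
    (hz : ContinuousOn z (Icc 0 T)) (hz₁ : ContinuousOn z₁ (Icc 0 T))
    (hz₂ : ContinuousOn z₂ (Icc 0 T))
    (hzm : SolvesModes α T z fun t k => -adv hK (w₁ t + w₂ t) (w₁ t + w₂ t) k)
    (hz₁m : SolvesModes α T z₁ fun t k => -adv hK (w₁ t) (w₁ t) k)
    (hz₂m : SolvesModes α T z₂ fun t k => -adv hK (w₂ t) (w₂ t) k) :
    ∀ᵐ t ∂(volume.restrict (Ioo 0 T)), v t = z t - z₁ t - z₂ t := by
  have meas : ∀ {w : ℝ → L2}, ContinuousOn w (Icc 0 T) →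
      AEStronglyMeasurable w (volume.restrict (Ioo 0 T)) := fun h =>
    (h.mono Ioo_subset_Icc_self).aestronglyMeasurable measurableSet_Ioo
  have hadv : ∀ {a b : ℝ → L2}, ContinuousOn a (Icc 0 T) → ContinuousOn b (Icc 0 T) → ∀ k,
      IntegrableOn (fun t => adv hK (a t) (b t) k) (Ioo 0 T) := by
    intro a b ha hb k
    obtain ⟨R, hR⟩ := exists_norm_le_of_continuousOn ha
    obtain ⟨S, hS⟩ := exists_norm_le_of_continuousOn hb
    exact integrableOn_adv hK (meas ha) (meas hb) hR hS k
  have hw := hw₁.add hw₂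
  have hzz₁ : ContinuousOn (fun t => z t + (-1 : ℝ) • z₁ t) (Icc 0 T) := hz.add (hz₁.const_smul (-1 : ℝ))
  have h1 := hzm.add_smul hz₁m (integrableOn_coeff_of_continuousOn hz)
    (integrableOn_coeff_of_continuousOn hz₁) (fun k => (hadv hw hw k).neg)
    (fun k => (hadv hw₁ hw₁ k).neg) (-1)
  have h2 := h1.add_smul hz₂m (integrableOn_coeff_of_continuousOn hzz₁)
    (integrableOn_coeff_of_continuousOn hz₂)
    (fun k => (hadv hw hw k).neg.add ((hadv hw₁ hw₁ k).neg.const_mul _))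
    (fun k => (hadv hw₂ hw₂ k).neg) (-1)
  -- Polarisation: subtracting the self-interactions of `w₁` and `w₂` from that of `w₁ + w₂` leaves
  -- the two mixed terms.
  have h3 := h2.congr (g' := fun t k => -(adv hK (w₁ t) (w₂ t) k + adv hK (w₂ t) (w₁ t) k))
    (Eventually.of_forall fun t k => by
      simp only [adv_add_left, adv_add_right]; push_cast; ring)
  have h4 := (hv.solvesModes hK hT hw₁ hw₂).unique h3
    (integrableOn_coeff_of_continuousOn hv.continuousOn)
    (integrableOn_coeff_of_continuousOn (hzz₁.add (hz₂.const_smul (-1 : ℝ))))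
    (fun k => ((hadv hw₁ hw₂ k).add (hadv hw₂ hw₁ k)).neg)
  filter_upwards [h4] with t ht
  rw [ht]
  module

lemma summable_bracket_mul {a : (Fin 2 → ℤ) → ℝ} (h0 : ∀ k, 0 ≤ a k)
    (h : Summable fun k => bracket k ^ (3 / 2 : ℝ) * a k) : Summable fun k => bracket k * a k := by
  refine Summable.of_nonneg_of_le (fun k => mul_nonneg (bracket_pos k).le (h0 k)) (fun k => ?_) h
  have h1 : bracket k ^ (1 : ℝ) ≤ bracket k ^ (3 / 2 : ℝ) :=
    Real.rpow_le_rpow_of_exponent_le (one_le_bracket k) (by norm_num)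
  rw [Real.rpow_one] at h1
  exact mul_le_mul_of_nonneg_right h1 (h0 k)

lemma lintegral_sobolevSq_sub_sub_le {r T A B C : ℝ} (hA : 0 ≤ A) (hB : 0 ≤ B) (hC : 0 ≤ C)
    {a b c : ℝ → L2}
    (ha : AEStronglyMeasurable a (volume.restrict (Ioo 0 T)))
    (hb : AEStronglyMeasurable b (volume.restrict (Ioo 0 T)))
    (hfa : ∫⁻ t in Ioo 0 T, sobolevSq r (a t) ≤ ENNReal.ofReal A)
    (hfb : ∫⁻ t in Ioo 0 T, sobolevSq r (b t) ≤ ENNReal.ofReal B)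
    (hfc : ∫⁻ t in Ioo 0 T, sobolevSq r (c t) ≤ ENNReal.ofReal C) :
    ∫⁻ t in Ioo 0 T, sobolevSq r (a t - b t - c t : L2) ≤ ENNReal.ofReal (4 * (A + B + C)) := by
  have hle : ∀ t, sobolevSq r (a t - b t - c t : L2)
      ≤ 4 * (sobolevSq r (a t) + sobolevSq r (b t) + sobolevSq r (c t)) := by
    intro t
    calc sobolevSq r (a t - b t - c t : L2)
        ≤ 2 * (2 * sobolevSq r (a t) + 2 * sobolevSq r (b t)) + 2 * sobolevSq r (c t) :=
          (sobolevSq_sub_le r _ _).trans (by gcongr; exact sobolevSq_sub_le r _ _)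
      _ ≤ 2 * (2 * sobolevSq r (a t) + 2 * sobolevSq r (b t)) + 4 * sobolevSq r (c t) := by
          gcongr; norm_num
      _ = _ := by ring
  refine (lintegral_mono hle).trans ?_
  have hab : AEMeasurable (fun t => sobolevSq r (a t) + sobolevSq r (b t))
      (volume.restrict (Ioo 0 T)) := (aemeasurable_sobolevSq ha r).add (aemeasurable_sobolevSq hb r)
  rw [lintegral_const_mul' _ _ (by simp), lintegral_add_left' hab, lintegral_add_left' (aemeasurable_sobolevSq ha r),
    ENNReal.ofReal_mul (by norm_num), ENNReal.ofReal_add (by positivity) hC,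
    ENNReal.ofReal_add hA hB, ENNReal.ofReal_ofNat]
  gcongr

lemma normL2H_le_of_lintegral_le {T r η : ℝ} (hη : 0 ≤ η) {h : ℝ → L2}
    (H : ∫⁻ t in Ioo 0 T, sobolevSq r (h t) ≤ ENNReal.ofReal (η ^ 2)) :
    normL2H T r h ≤ ENNReal.ofReal η := by
  simp only [normL2H, sobolevNorm_sq]
  refine (ENNReal.rpow_le_rpow H (by norm_num : (0 : ℝ) ≤ 1 / 2)).trans_eq ?_
  rw [ENNReal.ofReal_rpow_of_nonneg (sq_nonneg η) (by norm_num), ← Real.sqrt_eq_rpow,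
    Real.sqrt_sq hη]

end

end ActiveScalar

end

/-! ### Convergence of the second difference quotients -/

theorem proposition4p3 (α s q T : ℝ) (hα : 1 / 2 < α) (hα' : α < 1) (hs : 0 < s)
    (hq : 0 < 1 / q) (hq' : 1 / q < α - 1 / 2) (hT : 0 < T)
    (K : Torus → ℝ) (hK : IsAdmissibleKernel K)
    (f₁ f₂ : ℝ × Torus → ℝ) (hf₁ : IsSource T f₁) (hf₂ : IsSource T f₂)
    (w₁ w₂ v : ℝ → ActiveScalar.L2)
    (hw₁ : IsHeatSolution α T f₁ w₁) (hw₂ : IsHeatSolution α T f₂ w₂)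
    (hv : IsSecondLinearization α T K w₁ w₂ v) :
    ∀ η : ℝ, 0 < η → ∃ δ : ℝ, 0 < δ ∧ ∀ ε : ℝ, ε ≠ 0 → |ε| < δ →
      ∀ θ₁₂ θ₁ θ₂ : ℝ → ActiveScalar.L2,
        IsASESolution α s q T K (fun p => ε * (f₁ p + f₂ p)) θ₁₂ →
        IsASESolution α s q T K (fun p => ε * f₁ p) θ₁ →
        IsASESolution α s q T K (fun p => ε * f₂ p) θ₂ →
        -- the difference quotient, in its representative in `C([0, T]; L²)`
        ∃ D : ℝ → ActiveScalar.L2,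
          (∀ᵐ t ∂(MeasureTheory.volume.restrict (Set.Ioo 0 T)),
            D t = (ε ^ 2)⁻¹ • (θ₁₂ t - θ₁ t - θ₂ t)) ∧
          MemL2H T α D ∧ ContinuousOn D (Set.Icc 0 T) ∧
          normL2H T α (D - v) ≤ ENNReal.ofReal η ∧
          ∀ t ∈ Set.Icc 0 T, ‖D t - v t‖ ≤ η := by
  intro η hη
  obtain ⟨hm₁, a₁, ha₁0, ha₁, hp₁⟩ := hw₁.exists_profile hT hf₁
  obtain ⟨hm₂, a₂, ha₂0, ha₂, hp₂⟩ := hw₂.exists_profile hT hf₂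
  have ha0 : ∀ k, 0 ≤ a₁ k + a₂ k := fun k => add_nonneg (ha₁0 k) (ha₂0 k)
  have ha : Summable fun k => bracket k ^ (3 / 2 : ℝ) * (a₁ k + a₂ k) := by
    simpa only [mul_add] using ha₁.add ha₂
  have hp := hp₁.add hp₂
  have hfadd : ∀ t k, fourierCoeffR (fun x => f₁ (t, x) + f₂ (t, x)) k
      = fourierCoeffR (fun x => f₁ (t, x)) k + fourierCoeffR (fun x => f₂ (t, x)) k := fun t k =>
    fourierCoeffR_add (hf₁.slice_integrable t) (hf₂.slice_integrable t) k
  have hfi : ∀ k, MeasureTheory.IntegrableOn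
      (fun t => fourierCoeffR (fun x => f₁ (t, x) + f₂ (t, x)) k) (Set.Ioo 0 T) := fun k => by
    simp only [hfadd]
    exact (hf₁.integrableOn_coeff k).add (hf₂.integrableOn_coeff k)
  have hm : SolvesModes α T (fun t => w₁ t + w₂ t)
      fun t k => fourierCoeffR (fun x => f₁ (t, x) + f₂ (t, x)) k := by
    have := hm₁.add_smul hm₂ (integrableOn_coeff_of_continuousOn hw₁.continuousOn)
      (integrableOn_coeff_of_continuousOn hw₂.continuousOn) hf₁.integrableOn_coeff
      hf₂.integrableOn_coeff 1
    simpa only [one_smul, Complex.ofReal_one, one_mul, hfadd] using this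
  obtain ⟨z, n, hn0, hn, hzp, hzc, hzm⟩ := hp.exists_second hK (α := α) hT ha0 ha
  obtain ⟨z₁, n₁, hn₁0, hn₁, hz₁p, hz₁c, hz₁m⟩ := hp₁.exists_second hK (α := α) hT ha₁0 ha₁
  obtain ⟨z₂, n₂, hn₂0, hn₂, hz₂p, hz₂c, hz₂m⟩ := hp₂.exists_second hK (α := α) hT ha₂0 ha₂
  have hvz := hv.ae_eq hT hK hw₁.continuousOn hw₂.continuousOn hzc hz₁c hz₂c hzm hz₁m hz₂m
  obtain ⟨C, δ, hC, hδ, H⟩ := exists_remainder hK hα hα' hs hq hq' hT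
    (f := fun p => f₁ p + f₂ p) hfi ha0 (summable_bracket_mul ha0 ha) hn0 hn hp hzp hm hzm
  obtain ⟨C₁, δ₁, hC₁, hδ₁, H₁⟩ := exists_remainder hK hα hα' hs hq hq' hT
    hf₁.integrableOn_coeff ha₁0 (summable_bracket_mul ha₁0 ha₁) hn₁0 hn₁ hp₁ hz₁p hm₁ hz₁m
  obtain ⟨C₂, δ₂, hC₂, hδ₂, H₂⟩ := exists_remainder hK hα hα' hs hq hq' hT
    hf₂.integrableOn_coeff ha₂0 (summable_bracket_mul ha₂0 ha₂) hn₂0 hn₂ hp₂ hz₂p hm₂ hz₂m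
  obtain ⟨M, hM⟩ : ∃ M : ℝ, M = C + C₁ + C₂ := ⟨_, rfl⟩
  have hM0 : 0 ≤ M := by rw [hM]; positivity
  -- Dividing the cubic remainders by `ε²` leaves `M|ε|` in the uniform norm and `4Mε²` in the
  -- squared `L²H^α` norm. The threshold `η/(4M + 1)` bounds these by `η` and `η²`; the `4` comes
  -- from splitting the square of a sum of three terms.
  refine ⟨min (min δ δ₁) (min δ₂ (η / (4 * M + 1))), by positivity,
    fun ε hε0 hε θ₁₂ θ₁ θ₂ h₁₂ h₁ h₂ => ?_⟩
  simp only [lt_min_iff] at hε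
  obtain ⟨⟨hεδ, hεδ₁⟩, hεδ₂, hεη⟩ := hε
  rw [lt_div_iff₀ (by positivity)] at hεη
  have hε' : 0 < |ε| := abs_pos.2 hε0
  have hMε : M * |ε| ≤ η := by nlinarith
  have hMε2 : 4 * M * ε ^ 2 ≤ η ^ 2 := by
    have h1 : (|ε| * (4 * M + 1)) ^ 2 ≤ η ^ 2 := pow_le_pow_left₀ (by positivity) hεη.le 2
    have h2 : 4 * M * ε ^ 2 ≤ (|ε| * (4 * M + 1)) ^ 2 := by
      rw [mul_pow, sq_abs]
      nlinarith [mul_nonneg (sq_nonneg ε) hM0, mul_nonneg (sq_nonneg ε) (sq_nonneg M), sq_nonneg ε]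
    exact h2.trans h1
  obtain ⟨r, hrc, hrθ, hrb, hrE⟩ := H ε hεδ θ₁₂ h₁₂
  obtain ⟨r₁, hr₁c, hr₁θ, hr₁b, hr₁E⟩ := H₁ ε hεδ₁ θ₁ h₁
  obtain ⟨r₂, hr₂c, hr₂θ, hr₂b, hr₂E⟩ := H₂ ε hεδ₂ θ₂ h₂
  have meas : ∀ {w : ℝ → ActiveScalar.L2}, ContinuousOn w (Set.Icc 0 T) →
      MeasureTheory.AEStronglyMeasurable w (MeasureTheory.volume.restrict (Set.Ioo 0 T)) := fun h =>
    (h.mono Set.Ioo_subset_Icc_self).aestronglyMeasurable measurableSet_Ioo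
  have hE := lintegral_sobolevSq_sub_sub_le (by positivity) (by positivity) (by positivity)
    (meas hrc) (meas hr₁c) hrE hr₁E hr₂E
  have hrrc : ContinuousOn (fun t => r t - r₁ t - r₂ t) (Set.Icc 0 T) := (hrc.sub hr₁c).sub hr₂c
  have hDc : ContinuousOn (fun t => v t + (ε ^ 2)⁻¹ • (r t - r₁ t - r₂ t)) (Set.Icc 0 T) :=
    hv.continuousOn.add (hrrc.const_smul (ε ^ 2)⁻¹)
  -- The combination `z - z₁ - z₂` equals `v` almost everywhere, so `v` is put in its place. The
  -- representative is then continuous, and its difference from `v` is exactly the rescaled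
  -- remainder, at every time.
  refine ⟨fun t => v t + (ε ^ 2)⁻¹ • (r t - r₁ t - r₂ t), ?_, ⟨meas hDc, ?_⟩, hDc, ?_, ?_⟩
  · filter_upwards [hvz, hrθ, hr₁θ, hr₂θ] with t e e₁₂ e₁ e₂
    have hε2 : (ε ^ 2)⁻¹ * ε ^ 2 = 1 := inv_mul_cancel₀ (pow_ne_zero 2 hε0)
    have e3 : θ₁₂ t - θ₁ t - θ₂ t = (r t - r₁ t - r₂ t) + ε ^ 2 • (z t - z₁ t - z₂ t) := by
      rw [e₁₂, e₁, e₂]; module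
    rw [e3, smul_add, smul_smul, hε2, one_smul, e, add_comm]
  · exact normL2H_lt_top_iff.2 (lintegral_sobolevSq_add_smul_lt_top (meas hv.continuousOn)
      (normL2H_lt_top_iff.1 hv.memL2H.2) (hE.trans_lt ENNReal.ofReal_lt_top) _)
  · refine normL2H_le_of_lintegral_le hη.le ?_
    have e : ∀ t, ((fun t => v t + (ε ^ 2)⁻¹ • (r t - r₁ t - r₂ t)) - v) t
        = (ε ^ 2)⁻¹ • (r t - r₁ t - r₂ t) := fun t => by simp
    simp only [e, sobolevSq_smul]
    rw [MeasureTheory.lintegral_const_mul' _ _ (by simp)]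
    refine (mul_le_mul_right hE _).trans ?_
    rw [← ENNReal.ofReal_mul (by positivity)]
    refine ENNReal.ofReal_le_ofReal (le_trans (le_of_eq ?_) hMε2)
    rw [hM]; field_simp
  · intro t ht
    rw [add_sub_cancel_left, norm_smul, norm_inv, norm_pow, Real.norm_eq_abs,
      inv_mul_le_iff₀ (by positivity)]
    have h3 : ‖r t - r₁ t - r₂ t‖ ≤ M * |ε| ^ 3 := by
      refine (norm_sub_le _ _).trans ((add_le_add ((norm_sub_le _ _).trans
        (add_le_add (hrb t ht) (hr₁b t ht))) (hr₂b t ht)).trans_eq ?_)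
      rw [hM]; ring
    calc _ ≤ M * |ε| ^ 3 := h3
      _ = |ε| ^ 2 * (M * |ε|) := by ring
      _ ≤ _ := by gcongr
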